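/- Let $1<a<\sqrt2$ and $h>0$. The elliptical stadium is the convex plane region, centered at the origin, whose boundary $\Gamma$ consists of two half-ellipses with half axes $a$ (along the $x$-axis) and $1$, joined by two horizontal segments of length $2h$ on $y=\pm1$. Let $L$ be the length of $\Gamma$, $s\in[0,L)$ the arc length on $\Gamma$, $\beta\in(-\pi/2,\pi/2)$ the angle between the inward normal and the direction of motion just after an impact, and $T(s,\beta)$ the billiard map. For an integer $i\ge0$, a pantographic orbit $Pan(i,a,h)$ is a periodic orbit of $T$ of (minimal) period $4+2i$ which is symmetric with respect to both coordinate axes, whose impacts alternate between $y>0$ and $y<0$, with exactly two impacts on each half-ellipse, joined by a vertical path, and exactly $i$ impacts on each of the two segments (so $4+2i$ impacts in all), and which crosses the $y$-axis exactly twice in a period. The orbit is called hyperbolic if at its points the derivative $DT^{4+2i}$ has two real eigenvalues, one larger than $1$ and the other of modulus smaller than $1$, and elliptic if at its points $DT^{4+2i}$ is linearly conjugate to a rotation by an angle that is not a multiple of $2\pi$ (that is, its eigenvalues are non-real of modulus one, or $DT^{4+2i}=-\mathrm{Id}$). "$Pan(i,a,h)$ is elliptic (hyperbolic)" means that such orbits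 exist and that all of them are elliptic (hyperbolic). Put $\alpha_i=\sqrt{\frac{2+2i}{2+i}}$. 1. Let $i\ge0$ and $\alpha_i<a<\sqrt2$. There is a unique $h_i(a)>0$ such that $Pan(i,a,h)$ is elliptic for $0<h<h_i(a)$ and hyperbolic for $h>h_i(a)$. 2. Let $i\ge1$ and $1<a<\alpha_i$. Then $Pan(i,a,h)$ is hyperbolic for every $h>0$. 3. For $1<a<\sqrt2$ one has $h_0(a)=\sqrt{a^2-1}$. 4. Let $i\ge0$ and $\alpha_i<a<\sqrt2$. The cubic polynomial $$y^3+\frac{i}{2a^2}(a^2-1)\,y^2-\frac1{a^2}\,y-\frac{i}{2a^2}$$ has exactly one root $y=y_i(a)$ in $(0,1)$, and $$h_i(a)=\frac{a\sqrt{1-y^2}}{(a^2+1)y^2-1}\,\bigl(2iy+1-(a^2-1)y^2\bigr).$$ -/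

import Mathlib

noncomputable section

namespace EllipticalStadium

/-- Arc length of the ellipse with half axes `a` and `1`, parametrized by `(a cos θ, sin θ)`,
from the parameter `0` to the parameter `θ`. -/
def ellipseArc (a θ : ℝ) : ℝ :=
  ∫ u in (0 : ℝ)..θ, Real.sqrt (a ^ 2 * Real.sin u ^ 2 + Real.cos u ^ 2)

/-- The parameter `θ` as a function of the arc length (for `a > 0` the function `ellipseArc a` is a
bijection of `ℝ`). -/
def ellipseParam (a : ℝ) : ℝ → ℝ := Function.invFun (ellipseArc a)

/-- The length of a quarter of the ellipse. -/
def quarter (a : ℝ) : ℝ := ellipseArc a (Real.pi / 2)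

/-- The length `L` of the boundary curve `Γ` of the elliptical stadium. -/
def totalLength (a h : ℝ) : ℝ := 4 * quarter a + 4 * h

/-- The boundary curve `Γ` of the elliptical stadium, parametrized by arc length `s ∈ [0, L)`,
counterclockwise, starting at the vertex `(a + h, 0)`: the upper quarter of the right half-ellipse,
the upper segment, the left half-ellipse, the lower segment, and the lower quarter of the right
half-ellipse. The origin is the center of the stadium, the major axis is the `x`-axis. -/
def boundary (a h s : ℝ) : ℝ × ℝ :=
  if s < quarter a then
    (h + a * Real.cos (ellipseParam a s), Real.sin (ellipseParam a s))
  else if s < quarter a + 2 * h then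
    (h - (s - quarter a), 1)
  else if s < 3 * quarter a + 2 * h then
    (-h + a * Real.cos (ellipseParam a (s - 2 * h)), Real.sin (ellipseParam a (s - 2 * h)))
  else if s < 3 * quarter a + 4 * h then
    (-h + (s - (3 * quarter a + 2 * h)), -1)
  else
    (h + a * Real.cos (ellipseParam a (s - 4 * h)), Real.sin (ellipseParam a (s - 4 * h)))

/-- The unit tangent vector of `Γ` (counterclockwise). -/
def tangent (a h s : ℝ) : ℝ × ℝ := deriv (boundary a h) s

/-- The inward unit normal vector of `Γ`: the tangent vector turned by `+π/2`. -/
def normal (a h s : ℝ) : ℝ × ℝ := (-(tangent a h s).2, (tangent a h s).1)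

/-- The phase space `[0, L) × (-π/2, π/2)`: an impact point, and the angle between the inward normal
and the direction of motion just after the impact. -/
def phaseSpace (a h : ℝ) : Set (ℝ × ℝ) :=
  Set.Ico 0 (totalLength a h) ×ˢ Set.Ioo (-(Real.pi / 2)) (Real.pi / 2)

/-- The direction of motion just after the impact. -/
def direction (a h : ℝ) (z : ℝ × ℝ) : ℝ × ℝ :=
  Real.cos z.2 • normal a h z.1 + Real.sin z.2 • tangent a h z.1

/-- The arc length parameter of the next impact: the point, other than the present one, where the
ray of motion meets `Γ` (for a point of the phase space it is unique, the stadium being convex). -/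
def nextImpact (a h : ℝ) (z : ℝ × ℝ) : ℝ :=
  Classical.epsilon fun s' : ℝ => s' ∈ Set.Ico 0 (totalLength a h) ∧
    ∃ r : ℝ, 0 < r ∧ boundary a h s' = boundary a h z.1 + r • direction a h z

/-- The billiard map `T`. An elastic reflection keeps the tangential component of the (unit)
velocity and reverses the normal one, so the new angle is the one in `(-π/2, π/2)` whose sine is
the tangential component of the incoming velocity. -/
def billiardMap (a h : ℝ) (z : ℝ × ℝ) : ℝ × ℝ :=
  (nextImpact a h z,
    Real.arcsin
      ((direction a h z).1 * (tangent a h (nextImpact a h z)).1 +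
        (direction a h z).2 * (tangent a h (nextImpact a h z)).2))

/-- The `k`-th impact point of the orbit of `z`. -/
def impact (a h : ℝ) (z : ℝ × ℝ) (k : ℕ) : ℝ × ℝ :=
  boundary a h ((billiardMap a h)^[k] z).1

/-- The trajectory of `z` is symmetric with respect to the reflection `σ`: `σ` maps each of its
links onto one of its links (travelled in the same or in the opposite sense). -/
def SymmetricUnder (a h : ℝ) (z : ℝ × ℝ) (σ : ℝ × ℝ → ℝ × ℝ) : Prop :=
  ∀ k : ℕ, ∃ m : ℕ,
    (σ (impact a h z k) = impact a h z m ∧ σ (impact a h z (k + 1)) = impact a h z (m + 1)) ∨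
    (σ (impact a h z k) = impact a h z (m + 1) ∧ σ (impact a h z (k + 1)) = impact a h z m)

/-- The orbit of `z` is an `(i, a, h)`-pantographic orbit `Pan(i, a, h)`. -/
structure IsPantographic (i : ℕ) (a h : ℝ) (z : ℝ × ℝ) : Prop where
  mem : z ∈ phaseSpace a h
  /-- it is periodic with period `4 + 2i`, -/
  period : Function.minimalPeriod (billiardMap a h) z = 4 + 2 * i
  /-- symmetric with respect to the `x`-axis -/
  symm_x : SymmetricUnder a h z fun p => (p.1, -p.2)
  /-- and to the `y`-axis, -/
  symm_y : SymmetricUnder a h z fun p => (-p.1, p.2)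
  /-- the impacts alternate up and down, -/
  alternating : ∀ k : ℕ, (impact a h z k).2 * (impact a h z (k + 1)).2 < 0
  /-- two impacts are at the right half-ellipse, -/
  right_card : Set.ncard {k : ℕ | k < 4 + 2 * i ∧ h < (impact a h z k).1} = 2
  /-- joined by a vertical path, -/
  right_vertical : ∃ k : ℕ, h < (impact a h z k).1 ∧
    (impact a h z (k + 1)).1 = (impact a h z k).1
  /-- two impacts are at the left half-ellipse, -/
  left_card : Set.ncard {k : ℕ | k < 4 + 2 * i ∧ (impact a h z k).1 < -h} = 2
  /-- joined by a vertical path, -/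
  left_vertical : ∃ k : ℕ, (impact a h z k).1 < -h ∧
    (impact a h z (k + 1)).1 = (impact a h z k).1
  /-- `i` impacts are at the upper straight part -/
  upper_card : Set.ncard {k : ℕ | k < 4 + 2 * i ∧ |(impact a h z k).1| < h ∧
    (impact a h z k).2 = 1} = i
  /-- and `i` at the lower one, -/
  lower_card : Set.ncard {k : ℕ | k < 4 + 2 * i ∧ |(impact a h z k).1| < h ∧
    (impact a h z k).2 = -1} = i
  /-- and the trajectory meets the `y`-axis exactly twice in a period (`q = (k, τ)` is the
  instant at which the fraction `τ` of the link from impact `k` to impact `k + 1` is travelled). -/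
  crossings : Set.ncard {q : ℕ × ℝ | q.1 < 4 + 2 * i ∧ 0 ≤ q.2 ∧ q.2 < 1 ∧
    (1 - q.2) * (impact a h z q.1).1 + q.2 * (impact a h z (q.1 + 1)).1 = 0} = 2

/-- A linear map of the plane is elliptic if in some basis it is a rotation by an angle `θ` that is
not a multiple of `2π`. So it has the eigenvalues `exp (± i θ)`, of modulus one and different from
`1`; they are non-real unless the map is `-1`. -/
def IsEllipticMap (A : ℝ × ℝ →L[ℝ] ℝ × ℝ) : Prop :=
  ∃ (θ : ℝ) (e f : ℝ × ℝ), Real.cos θ ≠ 1 ∧ LinearIndependent ℝ ![e, f] ∧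
    A e = Real.cos θ • e + Real.sin θ • f ∧ A f = -(Real.sin θ) • e + Real.cos θ • f

/-- A linear map of the plane is hyperbolic if it has two real eigenvalues, one of them larger than
`1`, the other of modulus smaller than `1`. -/
def IsHyperbolicMap (A : ℝ × ℝ →L[ℝ] ℝ × ℝ) : Prop :=
  ∃ μ ν : ℝ, |μ| < 1 ∧ 1 < ν ∧
    Module.End.HasEigenvalue (A : Module.End ℝ (ℝ × ℝ)) μ ∧
    Module.End.HasEigenvalue (A : Module.End ℝ (ℝ × ℝ)) ν

/-- `Pan(i, a, h)` is elliptic: it exists, and at each of its points (whichever the sense of travel)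
`T ^ (4 + 2i)` is differentiable with an elliptic derivative. -/
def PanIsElliptic (i : ℕ) (a h : ℝ) : Prop :=
  (∃ z : ℝ × ℝ, IsPantographic i a h z) ∧
    ∀ z : ℝ × ℝ, IsPantographic i a h z → ∃ A : ℝ × ℝ →L[ℝ] ℝ × ℝ,
      HasFDerivAt ((billiardMap a h)^[4 + 2 * i]) A z ∧ IsEllipticMap A

/-- `Pan(i, a, h)` is hyperbolic: it exists, and at each of its points (whichever the sense of
travel) `T ^ (4 + 2i)` is differentiable with a hyperbolic derivative. -/
def PanIsHyperbolic (i : ℕ) (a h : ℝ) : Prop :=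
  (∃ z : ℝ × ℝ, IsPantographic i a h z) ∧
    ∀ z : ℝ × ℝ, IsPantographic i a h z → ∃ A : ℝ × ℝ →L[ℝ] ℝ × ℝ,
      HasFDerivAt ((billiardMap a h)^[4 + 2 * i]) A z ∧ IsHyperbolicMap A

/-- The number `α_i = √((2 + 2i)/(2 + i))`. -/
def alpha (i : ℕ) : ℝ := Real.sqrt ((2 + 2 * (i : ℝ)) / (2 + (i : ℝ)))

/-- `h₀ > 0` separates the elliptic from the hyperbolic orbits `Pan(i, a, h)`, `h > 0`. -/
def IsThreshold (i : ℕ) (a h₀ : ℝ) : Prop :=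
  0 < h₀ ∧ (∀ h : ℝ, 0 < h → h < h₀ → PanIsElliptic i a h) ∧
    ∀ h : ℝ, h₀ < h → PanIsHyperbolic i a h

/-- The cubic polynomial `y³ + (i/(2a²)) (a² - 1) y² - y/a² - i/(2a²)`. -/
def cubic (i : ℕ) (a y : ℝ) : ℝ :=
  y ^ 3 + (i : ℝ) / (2 * a ^ 2) * (a ^ 2 - 1) * y ^ 2 - 1 / a ^ 2 * y - (i : ℝ) / (2 * a ^ 2)

/-- The half-length `h` given by a root `y` of the cubic polynomial. -/
def heightOfRoot (i : ℕ) (a y : ℝ) : ℝ :=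
  a * Real.sqrt (1 - y ^ 2) / ((a ^ 2 + 1) * y ^ 2 - 1) *
    (2 * (i : ℝ) * y + 1 - (a ^ 2 - 1) * y ^ 2)

end EllipticalStadium

end

/-!
The proof finds the pantographic orbits explicitly and computes their monodromy.

*The orbits.* A vertical chord between the points of ordinate `± y` of the right half-ellipse is
reflected into a direction with known components. The path then zigzags between the segments, and it
reaches the mirror image of the chord on the left after exactly `i` impacts if and only if `y` solves
one equation in `a`, `h`, `y` (`Closing`), that is, if `h = heightOfRoot i a y`. Conversely the
symmetries and the numbers of impacts force a pantographic orbit to be of this form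
(`IsPantographic.exists_orbit`): the two passages between the half-ellipses cover the same horizontal
distance, so they have the same number of impacts. As `heightOfRoot i a` decreases strictly from
infinity to `0`, each `h > 0` belongs to exactly one `y`.

*The billiard map.* The stadium is the sublevel set of a convex `C¹` function (`level`), whence a ray
that enters it meets the boundary exactly once more, transversally (`ray_unique`, `dot_grad_pos`).
So the billiard map is determined by impact points and directions (`Represents`), and away from the
joints the implicit function theorem gives its derivative: in Jacobi coordinates it is a free flight
followed by a reflection (`hasFDerivAt_billiardMap`).

*The type.* The flights between the half-ellipses amount to a single flight, so over half a period
the derivative is, up to a sign, the composition of two flights, and over the period it is the square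
of that composition. The type is therefore decided by the trace of the composition, which differs
from `2` by a negative multiple of the cubic polynomial at `y` (`trace_eq`) and which exceeds `-2`
(`neg_two_lt_trace`): the orbit is elliptic if the cubic polynomial is positive at `y`, hyperbolic if
it is negative (`orbit_type`). The quotient of the cubic polynomial by `y` increases strictly on
`y > 0`, so there is at most one sign change; there is one in `(0, 1)` if `a > α_i`, and none if
`a < α_i`. Since `y` decreases as `h` grows, the height of the root is the threshold
(`isThreshold_heightOfRoot`).
-/

noncomputable section

namespace EllipticalStadium

/-! ### The arc length of the ellipse -/

/-- The speed of the parametrization `(a cos θ, sin θ)` of the ellipse. -/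
def speed (a u : ℝ) : ℝ := Real.sqrt (a ^ 2 * Real.sin u ^ 2 + Real.cos u ^ 2)

lemma speed_sq (a u : ℝ) : speed a u ^ 2 = a ^ 2 * Real.sin u ^ 2 + Real.cos u ^ 2 :=
  Real.sq_sqrt (by positivity)

lemma one_le_speed {a : ℝ} (ha : 1 < a) (u : ℝ) : 1 ≤ speed a u := by
  rw [speed, Real.one_le_sqrt]
  nlinarith [Real.sin_sq_add_cos_sq u, mul_nonneg (sub_nonneg.2 ha.le) (sq_nonneg (Real.sin u)),
    mul_nonneg (mul_nonneg (sub_nonneg.2 ha.le) (by linarith : 0 ≤ a))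
      (sq_nonneg (Real.sin u))]

lemma speed_pos {a : ℝ} (ha : 1 < a) (u : ℝ) : 0 < speed a u :=
  zero_lt_one.trans_le (one_le_speed ha u)

lemma continuous_speed (a : ℝ) : Continuous (speed a) := by
  unfold speed
  fun_prop

lemma hasStrictDerivAt_ellipseArc (a θ : ℝ) :
    HasStrictDerivAt (ellipseArc a) (speed a θ) θ :=
  intervalIntegral.integral_hasStrictDerivAt_right ((continuous_speed a).intervalIntegrable _ _)
    ((continuous_speed a).stronglyMeasurableAtFilter _ _) (continuous_speed a).continuousAt

lemma continuous_ellipseArc (a : ℝ) : Continuous (ellipseArc a) :=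
  continuous_iff_continuousAt.2 fun θ => (hasStrictDerivAt_ellipseArc a θ).hasDerivAt.continuousAt

lemma strictMono_ellipseArc {a : ℝ} (ha : 1 < a) : StrictMono (ellipseArc a) :=
  strictMono_of_hasDerivAt_pos (fun θ => (hasStrictDerivAt_ellipseArc a θ).hasDerivAt)
    (speed_pos ha)

lemma ellipseArc_zero (a : ℝ) : ellipseArc a 0 = 0 := intervalIntegral.integral_same

lemma ellipseArc_add_eq (a θ : ℝ) :
    ellipseArc a (θ + Real.pi) = ellipseArc a θ + ellipseArc a Real.pi := by
  have h1 : ellipseArc a (θ + Real.pi) = ellipseArc a Real.pi +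
      ∫ u in Real.pi..(θ + Real.pi), speed a u :=
    (intervalIntegral.integral_add_adjacent_intervals
      ((continuous_speed a).intervalIntegrable _ _)
      ((continuous_speed a).intervalIntegrable _ _)).symm
  have h2 : ∫ u in (0 : ℝ)..θ, speed a (u + Real.pi) =
      ∫ u in (0 + Real.pi)..(θ + Real.pi), speed a u :=
    intervalIntegral.integral_comp_add_right _ _
  rw [zero_add] at h2
  have h3 : ∀ u, speed a (u + Real.pi) = speed a u := by
    intro u; simp [speed, Real.sin_add_pi, Real.cos_add_pi]
  simp only [h3] at h2
  rw [h1, ← h2, add_comm]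
  rfl

lemma ellipseArc_neg (a θ : ℝ) : ellipseArc a (-θ) = -ellipseArc a θ := by
  have h2 : ∫ u in (0 : ℝ)..θ, speed a (-u) = ∫ u in (-θ)..(-0), speed a u :=
    intervalIntegral.integral_comp_neg _
  have h3 : ∀ u, speed a (-u) = speed a u := by
    intro u; simp [speed]
  simp only [h3, neg_zero] at h2
  show (∫ u in (0 : ℝ)..(-θ), speed a u) = -∫ u in (0 : ℝ)..θ, speed a u
  rw [h2, ← intervalIntegral.integral_symm]

lemma ellipseArc_pi (a : ℝ) : ellipseArc a Real.pi = 2 * quarter a := by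
  have h := ellipseArc_add_eq a (-(Real.pi / 2))
  rw [ellipseArc_neg, show -(Real.pi / 2) + Real.pi = Real.pi / 2 by ring] at h
  unfold quarter
  linarith

lemma ellipseArc_add_pi (a θ : ℝ) :
    ellipseArc a (θ + Real.pi) = ellipseArc a θ + 2 * quarter a := by
  rw [ellipseArc_add_eq, ellipseArc_pi]

lemma ellipseArc_add_two_pi (a θ : ℝ) :
    ellipseArc a (θ + 2 * Real.pi) = ellipseArc a θ + 4 * quarter a := by
  rw [show θ + 2 * Real.pi = θ + Real.pi + Real.pi by ring, ellipseArc_add_pi, ellipseArc_add_pi]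
  ring

lemma quarter_pos {a : ℝ} (ha : 1 < a) : 0 < quarter a := by
  rw [← ellipseArc_zero a]
  exact strictMono_ellipseArc ha (by positivity)

lemma surjective_ellipseArc {a : ℝ} (ha : 1 < a) : Function.Surjective (ellipseArc a) := by
  have key : ∀ n : ℕ, ellipseArc a (n * Real.pi) = n * (2 * quarter a) := by
    intro n
    induction n with
    | zero => simp [ellipseArc_zero]
    | succ n ih =>
      rw [Nat.cast_succ, add_mul, one_mul, ellipseArc_add_pi, ih]
      ring
  intro s
  have hq := quarter_pos ha
  obtain ⟨n, hn⟩ := exists_nat_ge (|s| / (2 * quarter a))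
  rw [div_le_iff₀ (by positivity)] at hn
  have h1 := abs_le.1 hn
  have hmem : s ∈ Set.Icc (ellipseArc a (-(n * Real.pi))) (ellipseArc a (n * Real.pi)) := by
    rw [ellipseArc_neg, key]
    exact ⟨h1.1, h1.2⟩
  obtain ⟨θ, -, hθ⟩ := intermediate_value_Icc
    (by have : (0 : ℝ) ≤ n * Real.pi := by positivity
        linarith) (continuous_ellipseArc a).continuousOn hmem
  exact ⟨θ, hθ⟩

lemma ellipseArc_ellipseParam {a : ℝ} (ha : 1 < a) (s : ℝ) :
    ellipseArc a (ellipseParam a s) = s :=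
  Function.rightInverse_invFun (surjective_ellipseArc ha) s

lemma ellipseParam_ellipseArc {a : ℝ} (ha : 1 < a) (θ : ℝ) :
    ellipseParam a (ellipseArc a θ) = θ :=
  Function.leftInverse_invFun (strictMono_ellipseArc ha).injective θ

lemma strictMono_ellipseParam {a : ℝ} (ha : 1 < a) : StrictMono (ellipseParam a) := by
  intro s t hst
  rw [← (strictMono_ellipseArc ha).lt_iff_lt, ellipseArc_ellipseParam ha,
    ellipseArc_ellipseParam ha]
  exact hst

lemma continuous_ellipseParam {a : ℝ} (ha : 1 < a) : Continuous (ellipseParam a) :=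
  (strictMono_ellipseParam ha).monotone.continuous_of_surjective
    fun θ => ⟨ellipseArc a θ, ellipseParam_ellipseArc ha θ⟩

lemma hasStrictDerivAt_ellipseParam {a : ℝ} (ha : 1 < a) (s : ℝ) :
    HasStrictDerivAt (ellipseParam a) (speed a (ellipseParam a s))⁻¹ s :=
  HasStrictDerivAt.of_local_left_inverse (continuous_ellipseParam ha).continuousAt
    (hasStrictDerivAt_ellipseArc a _) (speed_pos ha _).ne'
    (Filter.Eventually.of_forall (ellipseArc_ellipseParam ha))

lemma ellipseParam_quarter {a : ℝ} (ha : 1 < a) : ellipseParam a (quarter a) = Real.pi / 2 :=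
  ellipseParam_ellipseArc ha _

lemma ellipseParam_zero {a : ℝ} (ha : 1 < a) : ellipseParam a 0 = 0 := by
  simpa [ellipseArc_zero] using ellipseParam_ellipseArc ha 0

lemma ellipseParam_three_quarter {a : ℝ} (ha : 1 < a) :
    ellipseParam a (3 * quarter a) = 3 * Real.pi / 2 := by
  have h := ellipseArc_add_pi a (Real.pi / 2)
  rw [show 3 * quarter a = ellipseArc a (Real.pi / 2 + Real.pi) by rw [h, quarter]; ring,
    ellipseParam_ellipseArc ha]
  ring

lemma ellipseParam_four_quarter {a : ℝ} (ha : 1 < a) :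
    ellipseParam a (4 * quarter a) = 2 * Real.pi := by
  have h := ellipseArc_add_two_pi a 0
  rw [zero_add, ellipseArc_zero, zero_add] at h
  rw [← h, ellipseParam_ellipseArc ha]

/-- The unit tangent of the ellipse, as a function of the arc length. -/
def ellipseTangent (a s : ℝ) : ℝ × ℝ :=
  (-a * Real.sin (ellipseParam a s) / speed a (ellipseParam a s),
    Real.cos (ellipseParam a s) / speed a (ellipseParam a s))

lemma hasStrictDerivAt_ellipse {a : ℝ} (ha : 1 < a) (x s : ℝ) :
    HasStrictDerivAt (fun s => (x + a * Real.cos (ellipseParam a s), Real.sin (ellipseParam a s)))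
      (ellipseTangent a s) s := by
  have hp := hasStrictDerivAt_ellipseParam ha s
  have h1 := ((hp.cos.const_mul a).const_add x).prodMk hp.sin
  refine h1.congr_deriv ?_
  simp only [ellipseTangent, div_eq_mul_inv, Prod.mk.injEq]
  exact ⟨by ring, trivial⟩

lemma hasStrictDerivAt_speed {a : ℝ} (ha : 1 < a) (u : ℝ) :
    HasStrictDerivAt (speed a) ((a ^ 2 - 1) * Real.sin u * Real.cos u / speed a u) u := by
  have hs := Real.hasStrictDerivAt_sin u
  have hc := Real.hasStrictDerivAt_cos u
  have h1 := ((hs.fun_pow 2).const_mul (a ^ 2)).fun_add (hc.fun_pow 2)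
  have h2 := h1.sqrt (f := fun u => a ^ 2 * Real.sin u ^ 2 + Real.cos u ^ 2)
    (by rw [← speed_sq]; exact (pow_pos (speed_pos ha u) 2).ne')
  refine h2.congr_deriv ?_
  show _ / (2 * speed a u) = _
  have := (speed_pos ha u).ne'
  field_simp
  ring

/-- The Frenet equation of the ellipse: its curvature is `a / speed ^ 3`. -/
lemma hasStrictDerivAt_ellipseTangent {a : ℝ} (ha : 1 < a) (s : ℝ) :
    HasStrictDerivAt (ellipseTangent a)
      ((a / speed a (ellipseParam a s) ^ 3) •
        (-(ellipseTangent a s).2, (ellipseTangent a s).1)) s := by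
  have hp := hasStrictDerivAt_ellipseParam ha s
  have hv := (hasStrictDerivAt_speed ha (ellipseParam a s)).comp s hp
  have hne := (speed_pos ha (ellipseParam a s)).ne'
  have h1 := ((hp.sin.const_mul (-a)).fun_div hv hne).prodMk (hp.cos.fun_div hv hne)
  refine HasStrictDerivAt.congr_deriv h1 ?_
  have hsq := speed_sq a (ellipseParam a s)
  have hc := Real.sin_sq_add_cos_sq (ellipseParam a s)
  simp only [ellipseTangent, Prod.smul_mk, smul_eq_mul, Prod.mk.injEq, Function.comp]
  set n := speed a (ellipseParam a s)
  set S := Real.sin (ellipseParam a s)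
  set C := Real.cos (ellipseParam a s)
  constructor
  · field_simp
    linear_combination (-C) * hsq - C * hc
  · field_simp
    linear_combination (-S) * hsq - a ^ 2 * S * hc

/-! ### The stadium as a sublevel set -/

/-- The scalar product of the plane. -/
def dot (u v : ℝ × ℝ) : ℝ := u.1 * v.1 + u.2 * v.2

/-- The signed distance of `x` to the interval `[-h, h]`. -/
def soft (h x : ℝ) : ℝ := x - max (-h) (min x h)

/-- The convex `C¹` function whose sublevel set `level ≤ 1` is the stadium. -/
def level (a h : ℝ) (p : ℝ × ℝ) : ℝ := soft h p.1 ^ 2 / a ^ 2 + p.2 ^ 2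

/-- Half the gradient of `level`, an outward normal vector of the boundary curve. -/
def grad (a h : ℝ) (p : ℝ × ℝ) : ℝ × ℝ := (soft h p.1 / a ^ 2, p.2)

lemma soft_of_ge {h x : ℝ} (hh : 0 < h) (hx : h ≤ x) : soft h x = x - h := by
  rw [soft, min_eq_right hx, max_eq_right (by linarith)]

lemma soft_of_le {h x : ℝ} (hh : 0 < h) (hx : x ≤ -h) : soft h x = x + h := by
  rw [soft, min_eq_left (by linarith), max_eq_left hx]
  ring

lemma soft_of_abs_le {h x : ℝ} (hx : |x| ≤ h) : soft h x = 0 := by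
  have := abs_le.1 hx
  rw [soft, min_eq_left this.2, max_eq_right this.1, sub_self]

lemma soft_sq_ge {h : ℝ} (hh : 0 < h) (x x' : ℝ) :
    soft h x ^ 2 + 2 * soft h x * (x' - x) ≤ soft h x' ^ 2 := by
  have hm : -h ≤ max (-h) (min x' h) ∧ max (-h) (min x' h) ≤ h :=
    ⟨le_max_left _ _, max_le (by linarith) (min_le_right _ _)⟩
  have key : soft h x' ^ 2 - soft h x ^ 2 - 2 * soft h x * (x' - x) =
      (soft h x' - soft h x) ^ 2 +
        2 * soft h x * (max (-h) (min x h) - max (-h) (min x' h)) := by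
    unfold soft; ring
  have h2 : 0 ≤ soft h x * (max (-h) (min x h) - max (-h) (min x' h)) := by
    rcases le_total h x with h1 | h1
    · rw [soft_of_ge hh h1, min_eq_right h1, max_eq_right (by linarith : -h ≤ h)]
      exact mul_nonneg (by linarith) (by linarith)
    · rcases le_total x (-h) with h3 | h3
      · rw [soft_of_le hh h3, min_eq_left h1, max_eq_left h3]
        exact mul_nonneg_of_nonpos_of_nonpos (by linarith) (by linarith)
      · rw [soft_of_abs_le (abs_le.2 ⟨h3, h1⟩), zero_mul]
  nlinarith [sq_nonneg (soft h x' - soft h x)]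

lemma soft_sq_le {h : ℝ} (hh : 0 < h) (x δ : ℝ) :
    soft h (x + δ) ^ 2 ≤ (soft h x + δ) ^ 2 := by
  have hm : -h ≤ max (-h) (min x h) ∧ max (-h) (min x h) ≤ h :=
    ⟨le_max_left _ _, max_le (by linarith) (min_le_right _ _)⟩
  have h2 : soft h x + δ = x + δ - max (-h) (min x h) := by unfold soft; ring
  rw [h2]
  rcases le_total h (x + δ) with h1 | h1
  · rw [soft_of_ge hh h1]
    exact pow_le_pow_left₀ (by linarith) (by linarith) 2
  · rcases le_total (x + δ) (-h) with h3 | h3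
    · rw [soft_of_le hh h3, ← neg_sq, ← neg_sq (x + δ - _)]
      exact pow_le_pow_left₀ (by linarith) (by linarith) 2
    · rw [soft_of_abs_le (abs_le.2 ⟨h3, h1⟩), zero_pow two_ne_zero]
      positivity

lemma level_ge {a h : ℝ} (ha : 1 < a) (hh : 0 < h) (p q : ℝ × ℝ) :
    level a h p + 2 * dot (grad a h p) (q - p) ≤ level a h q := by
  have h1 := div_le_div_of_nonneg_right (soft_sq_ge hh p.1 q.1) (by positivity : 0 ≤ a ^ 2)
  simp only [level, grad, dot, Prod.fst_sub, Prod.snd_sub]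
  have h2 : (soft h p.1 ^ 2 + 2 * soft h p.1 * (q.1 - p.1)) / a ^ 2 =
    soft h p.1 ^ 2 / a ^ 2 + 2 * (soft h p.1 / a ^ 2 * (q.1 - p.1)) := by ring
  nlinarith [sq_nonneg (q.2 - p.2)]

lemma level_add_smul_le {a h : ℝ} (hh : 0 < h) (p d : ℝ × ℝ) (t : ℝ) :
    level a h (p + t • d) ≤
      level a h p + 2 * t * dot (grad a h p) d + t ^ 2 * (d.1 ^ 2 / a ^ 2 + d.2 ^ 2) := by
  have h1 := div_le_div_of_nonneg_right (soft_sq_le hh p.1 (t * d.1)) (by positivity : 0 ≤ a ^ 2)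
  simp only [level, grad, dot, Prod.fst_add, Prod.snd_add, Prod.smul_fst, Prod.smul_snd,
    smul_eq_mul]
  have h2 : (soft h p.1 + t * d.1) ^ 2 / a ^ 2 = soft h p.1 ^ 2 / a ^ 2 +
    2 * t * (soft h p.1 / a ^ 2 * d.1) + t ^ 2 * (d.1 ^ 2 / a ^ 2) := by ring
  nlinarith

/-- A direction with `grad · d < 0` enters the interior of the stadium at once. -/
lemma exists_level_lt_one {a h : ℝ} (hh : 0 < h) {p d : ℝ × ℝ} (hp : level a h p = 1)
    (hd : dot (grad a h p) d < 0) {r : ℝ} (hr : 0 < r) :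
    ∃ t, 0 < t ∧ t < r ∧ level a h (p + t • d) < 1 := by
  set Q := d.1 ^ 2 / a ^ 2 + d.2 ^ 2 with hQ
  have hQ0 : 0 ≤ Q := by positivity
  refine ⟨min (r / 2) (-dot (grad a h p) d / (Q + 1)), ?_, ?_, ?_⟩
  · exact lt_min (by linarith) (div_pos (by linarith) (by linarith))
  · exact (min_le_left _ _).trans_lt (by linarith)
  · set t := min (r / 2) (-dot (grad a h p) d / (Q + 1))
    have ht : 0 < t := lt_min (by linarith) (div_pos (by linarith) (by linarith))
    have ht2 : t * (Q + 1) ≤ -dot (grad a h p) d := by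
      rw [← le_div_iff₀ (by linarith)]
      exact min_le_right _ _
    have := level_add_smul_le (a := a) hh p d t
    rw [hp, ← hQ] at this
    nlinarith [mul_pos ht ht, mul_nonneg ht.le hQ0]

/-- A ray which enters the stadium at a boundary point leaves it transversally. -/
lemma dot_grad_pos {a h : ℝ} (ha : 1 < a) (hh : 0 < h) {p d : ℝ × ℝ} {r : ℝ}
    (hp : level a h p = 1) (hd : dot (grad a h p) d < 0) (hr : 0 < r)
    (hp' : level a h (p + r • d) = 1) : 0 < dot (grad a h (p + r • d)) d := by
  obtain ⟨t, -, htr, ht⟩ := exists_level_lt_one hh hp hd hr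
  have h1 := level_ge ha hh (p + r • d) (p + t • d)
  have h2 : dot (grad a h (p + r • d)) (p + t • d - (p + r • d)) =
      (t - r) * dot (grad a h (p + r • d)) d := by
    simp only [dot, Prod.fst_add, Prod.snd_add, Prod.fst_sub, Prod.snd_sub, Prod.smul_fst,
      Prod.smul_snd, smul_eq_mul]
    ring
  rw [hp', h2] at h1
  by_contra hcon
  nlinarith [not_lt.1 hcon]

/-- A ray which enters the stadium at a boundary point meets the boundary only once more. -/
lemma ray_unique {a h : ℝ} (ha : 1 < a) (hh : 0 < h) {p d : ℝ × ℝ} {r r' : ℝ}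
    (hp : level a h p = 1) (hd : dot (grad a h p) d < 0) (hr : 0 < r) (hr' : 0 < r')
    (h1 : level a h (p + r • d) = 1) (h2 : level a h (p + r' • d) = 1) : r = r' := by
  have aux : ∀ {u v : ℝ}, 0 < u → level a h (p + u • d) = 1 → level a h (p + v • d) = 1 →
      ¬ u < v := by
    intro u v hu h3 h4 huv
    have h5 := dot_grad_pos ha hh hp hd hu h3
    have h6 := level_ge ha hh (p + u • d) (p + v • d)
    have h7 : dot (grad a h (p + u • d)) (p + v • d - (p + u • d)) =
        (v - u) * dot (grad a h (p + u • d)) d := by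
      simp only [dot, Prod.fst_add, Prod.snd_add, Prod.fst_sub, Prod.snd_sub, Prod.smul_fst,
        Prod.smul_snd, smul_eq_mul]
      ring
    rw [h3, h4, h7] at h6
    nlinarith [mul_pos (sub_pos.2 huv) h5]
  exact le_antisymm (not_lt.1 (aux hr' h2 h1)) (not_lt.1 (aux hr h1 h2))

lemma continuous_level (a h : ℝ) : Continuous (level a h) := by
  unfold level soft
  fun_prop

/-- A ray which enters the stadium at a boundary point meets the boundary again. -/
lemma exists_ray_hit {a h : ℝ} (ha : 1 < a) (hh : 0 < h) {p d : ℝ × ℝ}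
    (hp : level a h p = 1) (hd : dot (grad a h p) d < 0) :
    ∃ r : ℝ, 0 < r ∧ level a h (p + r • d) = 1 := by
  obtain ⟨t, ht, -, hlt⟩ := exists_level_lt_one hh hp hd one_pos
  -- far away the ray is outside: a nonzero direction leaves the box `|x| ≤ a + h`, `|y| ≤ 1`
  obtain ⟨R, hR, hR1⟩ : ∃ R : ℝ, t ≤ R ∧ 1 ≤ level a h (p + R • d) := by
    by_cases hd2 : d.2 = 0
    · have hd1 : d.1 ≠ 0 := by
        intro h0
        simp [dot, h0, hd2] at hd
      refine ⟨max t ((|p.1| + a + h) / |d.1|), le_max_left _ _, ?_⟩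
      set R := max t ((|p.1| + a + h) / |d.1|)
      have hRd : |p.1| + a + h ≤ R * |d.1| := by
        rw [← div_le_iff₀ (abs_pos.2 hd1)]
        exact le_max_right _ _
      have hR0 : 0 ≤ R := ht.le.trans (le_max_left _ _)
      have h3 : a + h ≤ |p.1 + R * d.1| := by
        have := abs_sub_abs_le_abs_sub (R * d.1) (-p.1)
        rw [abs_mul, abs_neg, abs_of_nonneg hR0, sub_neg_eq_add, add_comm (R * d.1)] at this
        linarith
      have h4 : a ^ 2 ≤ soft h (p.1 + R * d.1) ^ 2 := by
        rcases le_abs.1 h3 with h5 | h5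
        · rw [soft_of_ge hh (by linarith)]
          nlinarith
        · rw [soft_of_le hh (by linarith)]
          nlinarith
      have h5 : 1 ≤ soft h (p.1 + R * d.1) ^ 2 / a ^ 2 := by
        rw [le_div_iff₀ (by positivity)]
        linarith
      simp only [level, Prod.fst_add, Prod.smul_fst, smul_eq_mul]
      nlinarith [sq_nonneg (p + R • d).2]
    · refine ⟨max t ((|p.2| + 1) / |d.2|), le_max_left _ _, ?_⟩
      set R := max t ((|p.2| + 1) / |d.2|)
      have hRd : |p.2| + 1 ≤ R * |d.2| := by
        rw [← div_le_iff₀ (abs_pos.2 hd2)]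
        exact le_max_right _ _
      have hR0 : 0 ≤ R := ht.le.trans (le_max_left _ _)
      have h3 : 1 ≤ |p.2 + R * d.2| := by
        have := abs_sub_abs_le_abs_sub (R * d.2) (-p.2)
        rw [abs_mul, abs_neg, abs_of_nonneg hR0, sub_neg_eq_add, add_comm (R * d.2)] at this
        linarith
      have h4 : 1 ≤ (p.2 + R * d.2) ^ 2 := by
        rw [← sq_abs]
        nlinarith
      have h5 : 0 ≤ soft h (p + R • d).1 ^ 2 / a ^ 2 := by positivity
      simp only [level, Prod.snd_add, Prod.smul_snd, smul_eq_mul]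
      linarith
  have hcont : Continuous fun r : ℝ => level a h (p + r • d) :=
    (continuous_level a h).comp (by fun_prop)
  have hivt := intermediate_value_Icc hR hcont.continuousOn
  obtain ⟨r, hr, hr1⟩ := hivt ⟨hlt.le, hR1⟩
  exact ⟨r, ht.trans_le hr.1, hr1⟩

/-! ### The boundary curve -/

section pieces

variable {a h s : ℝ}

lemma boundary_of_lt_quarter (h1 : s < quarter a) :
    boundary a h s =
      (h + a * Real.cos (ellipseParam a s), Real.sin (ellipseParam a s)) := by
  rw [boundary, if_pos h1]

lemma boundary_of_upper (h1 : quarter a ≤ s) (h2 : s < quarter a + 2 * h) :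
    boundary a h s = (h - (s - quarter a), 1) := by
  rw [boundary, if_neg h1.not_gt, if_pos h2]

lemma boundary_of_left (hh : 0 < h) (h1 : quarter a + 2 * h ≤ s)
    (h2 : s < 3 * quarter a + 2 * h) :
    boundary a h s =
      (-h + a * Real.cos (ellipseParam a (s - 2 * h)),
        Real.sin (ellipseParam a (s - 2 * h))) := by
  rw [boundary, if_neg (by linarith), if_neg (by linarith), if_pos h2]

lemma boundary_of_lower (ha : 1 < a) (hh : 0 < h) (h1 : 3 * quarter a + 2 * h ≤ s)
    (h2 : s < 3 * quarter a + 4 * h) :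
    boundary a h s = (-h + (s - (3 * quarter a + 2 * h)), -1) := by
  have := quarter_pos ha
  rw [boundary, if_neg (by linarith), if_neg (by linarith), if_neg (by linarith), if_pos h2]

lemma boundary_of_last (ha : 1 < a) (hh : 0 < h) (h1 : 3 * quarter a + 4 * h ≤ s) :
    boundary a h s =
      (h + a * Real.cos (ellipseParam a (s - 4 * h)),
        Real.sin (ellipseParam a (s - 4 * h))) := by
  have := quarter_pos ha
  rw [boundary, if_neg (by linarith), if_neg (by linarith), if_neg (by linarith),
    if_neg (by linarith)]

end pieces

/-- The arc length parameter of a point of the boundary curve. -/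
def arcOf (a h : ℝ) (p : ℝ × ℝ) : ℝ :=
  if h < p.1 then
    if 0 ≤ p.2 then ellipseArc a (Real.arcsin p.2)
    else 4 * h + 4 * quarter a + ellipseArc a (Real.arcsin p.2)
  else if p.1 < -h then 2 * h + ellipseArc a (Real.pi - Real.arcsin p.2)
  else if 0 < p.2 then quarter a + (h - p.1)
  else 3 * quarter a + 2 * h + (p.1 + h)

lemma ellipse_level {a : ℝ} (ha : 1 < a) (θ : ℝ) :
    (a * Real.cos θ) ^ 2 / a ^ 2 + Real.sin θ ^ 2 = 1 := by
  rw [mul_pow, mul_div_cancel_left₀ _ (by positivity)]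
  exact Real.cos_sq_add_sin_sq θ

/-- The boundary curve lies in the level set, and `arcOf` inverts it. -/
lemma level_boundary_and_arcOf_boundary {a h s : ℝ} (ha : 1 < a) (hh : 0 < h)
    (hs : s ∈ Set.Ico 0 (totalLength a h)) :
    level a h (boundary a h s) = 1 ∧ arcOf a h (boundary a h s) = s := by
  obtain ⟨hs0, hsL⟩ := hs
  have hq := quarter_pos ha
  have hmono := strictMono_ellipseParam ha
  have hpi := Real.pi_pos
  rw [totalLength] at hsL
  rcases lt_or_ge s (quarter a) with h1 | h1
  · rw [boundary_of_lt_quarter h1]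
    have l1 := hmono.monotone hs0
    have l2 := hmono h1
    rw [ellipseParam_zero ha] at l1
    rw [ellipseParam_quarter ha] at l2
    have hc := Real.cos_pos_of_mem_Ioo ⟨by linarith, l2⟩
    have hx : h < h + a * Real.cos (ellipseParam a s) := by
      have : 0 < a * Real.cos (ellipseParam a s) := by positivity
      linarith
    refine ⟨?_, ?_⟩
    · simp only [level]
      rw [soft_of_ge hh hx.le, add_sub_cancel_left, ellipse_level ha]
    · simp only [arcOf]
      rw [if_pos hx, if_pos (Real.sin_nonneg_of_nonneg_of_le_pi l1 (by linarith)),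
        Real.arcsin_sin (by linarith) l2.le, ellipseArc_ellipseParam ha]
  rcases lt_or_ge s (quarter a + 2 * h) with h2 | h2
  · rw [boundary_of_upper h1 h2]
    refine ⟨?_, ?_⟩
    · simp only [level]
      rw [soft_of_abs_le (abs_le.2 ⟨by linarith, by linarith⟩)]
      norm_num
    · simp only [arcOf]
      rw [if_neg (by linarith), if_neg (by linarith), if_pos one_pos]
      ring
  rcases lt_or_ge s (3 * quarter a + 2 * h) with h3 | h3
  · rw [boundary_of_left hh h2 h3]
    have l1 := hmono.monotone (by linarith : quarter a ≤ s - 2 * h)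
    have l2 := hmono (by linarith : s - 2 * h < 3 * quarter a)
    rw [ellipseParam_quarter ha] at l1
    rw [ellipseParam_three_quarter ha] at l2
    have hc := Real.cos_nonpos_of_pi_div_two_le_of_le l1 (by linarith)
    have hx : -h + a * Real.cos (ellipseParam a (s - 2 * h)) ≤ -h := by
      have : 0 ≤ a * -Real.cos (ellipseParam a (s - 2 * h)) :=
        mul_nonneg (by linarith) (by linarith)
      linarith
    have hsin : Real.pi - Real.arcsin (Real.sin (ellipseParam a (s - 2 * h))) =
        ellipseParam a (s - 2 * h) := by
      rw [← Real.sin_pi_sub, Real.arcsin_sin (by linarith) (by linarith)]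
      ring
    refine ⟨?_, ?_⟩
    · simp only [level]
      rw [soft_of_le hh hx, neg_add_cancel_comm, ellipse_level ha]
    · simp only [arcOf]
      rw [if_neg (by linarith)]
      rcases hx.lt_or_eq with hx' | hx'
      · rw [if_pos hx', hsin, ellipseArc_ellipseParam ha]
        ring
      · -- the joint `(-h, 1)`
        have hc0 : Real.cos (ellipseParam a (s - 2 * h)) = 0 := by
          have : a * Real.cos (ellipseParam a (s - 2 * h)) = 0 := by linarith
          exact (mul_eq_zero.1 this).resolve_left (by linarith)
        have hθ : ellipseParam a (s - 2 * h) = Real.pi / 2 := by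
          by_contra hne
          have := Real.cos_neg_of_pi_div_two_lt_of_lt (lt_of_le_of_ne l1 (Ne.symm hne))
            (by linarith)
          linarith
        have hs' : s = quarter a + 2 * h := by
          have := ellipseArc_ellipseParam ha (s - 2 * h)
          rw [hθ] at this
          unfold quarter
          linarith
        rw [hθ]
        simp only [Real.cos_pi_div_two, Real.sin_pi_div_two]
        rw [if_neg (by linarith), if_pos one_pos, hs']
        ring
  rcases lt_or_ge s (3 * quarter a + 4 * h) with h4 | h4
  · rw [boundary_of_lower ha hh h3 h4]
    refine ⟨?_, ?_⟩
    · simp only [level]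
      rw [soft_of_abs_le (abs_le.2 ⟨by linarith, by linarith⟩)]
      norm_num
    · simp only [arcOf]
      rw [if_neg (by linarith), if_neg (by linarith), if_neg (by norm_num)]
      ring
  · rw [boundary_of_last ha hh h4]
    have l1 := hmono.monotone (by linarith : 3 * quarter a ≤ s - 4 * h)
    have l2 := hmono (by linarith : s - 4 * h < 4 * quarter a)
    rw [ellipseParam_three_quarter ha] at l1
    rw [ellipseParam_four_quarter ha] at l2
    set θ := ellipseParam a (s - 4 * h) with hθdef
    have hc : 0 ≤ Real.cos θ := by
      rw [← Real.cos_sub_two_pi]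
      exact Real.cos_nonneg_of_mem_Icc ⟨by linarith, by linarith⟩
    have hsn : Real.sin θ < 0 := by
      rw [← Real.sin_sub_two_pi]
      exact Real.sin_neg_of_neg_of_neg_pi_lt (by linarith) (by linarith)
    have hx : h ≤ h + a * Real.cos θ := by
      have : 0 ≤ a * Real.cos θ := mul_nonneg (by linarith) hc
      linarith
    have has : Real.arcsin (Real.sin θ) = θ - 2 * Real.pi := by
      rw [← Real.sin_sub_two_pi, Real.arcsin_sin (by linarith) (by linarith)]
    refine ⟨?_, ?_⟩
    · simp only [level]
      rw [soft_of_ge hh hx, add_sub_cancel_left, ellipse_level ha]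
    · simp only [arcOf]
      rcases hx.lt_or_eq with hx' | hx'
      · rw [if_pos hx', if_neg hsn.not_ge, has]
        have := ellipseArc_add_two_pi a (θ - 2 * Real.pi)
        rw [sub_add_cancel, hθdef, ellipseArc_ellipseParam ha] at this
        linarith
      · -- the joint `(h, -1)`
        have hc0 : Real.cos θ = 0 := by
          have : a * Real.cos θ = 0 := by linarith
          exact (mul_eq_zero.1 this).resolve_left (by linarith)
        have hθ : θ = 3 * Real.pi / 2 := by
          by_contra hne
          have hlt := lt_of_le_of_ne l1 (Ne.symm hne)
          have := Real.cos_pos_of_mem_Ioo (x := θ - 2 * Real.pi) ⟨by linarith, by linarith⟩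
          rw [Real.cos_sub_two_pi] at this
          linarith
        have hs' : s = 3 * quarter a + 4 * h := by
          have h6 := ellipseParam_three_quarter ha
          rw [← hθ, hθdef] at h6
          have := hmono.injective h6
          linarith
        rw [← hx', if_neg (lt_irrefl _), if_neg (by linarith), if_neg (by linarith), hs']
        ring

lemma level_boundary {a h s : ℝ} (ha : 1 < a) (hh : 0 < h)
    (hs : s ∈ Set.Ico 0 (totalLength a h)) : level a h (boundary a h s) = 1 :=
  (level_boundary_and_arcOf_boundary ha hh hs).1

lemma arcOf_boundary {a h s : ℝ} (ha : 1 < a) (hh : 0 < h)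
    (hs : s ∈ Set.Ico 0 (totalLength a h)) : arcOf a h (boundary a h s) = s :=
  (level_boundary_and_arcOf_boundary ha hh hs).2

lemma injOn_boundary {a h : ℝ} (ha : 1 < a) (hh : 0 < h) :
    Set.InjOn (boundary a h) (Set.Ico 0 (totalLength a h)) := by
  intro s hs t ht hst
  rw [← arcOf_boundary ha hh hs, ← arcOf_boundary ha hh ht, hst]

/-- On a half-ellipse of centre `c` the abscissa is determined by the ordinate. -/
lemma mul_cos_arcsin {a w y : ℝ} (ha : 1 < a) (hw : 0 ≤ w) (h1 : w ^ 2 / a ^ 2 + y ^ 2 = 1) :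
    a * Real.cos (Real.arcsin y) = w := by
  rw [Real.cos_arcsin]
  have h2 : 1 - y ^ 2 = (w / a) ^ 2 := by rw [div_pow]; linarith
  rw [h2, Real.sqrt_sq (by positivity)]
  field_simp

lemma boundary_arcOf {a h : ℝ} (ha : 1 < a) (hh : 0 < h) {p : ℝ × ℝ} (hp : level a h p = 1) :
    boundary a h (arcOf a h p) = p ∧ arcOf a h p ∈ Set.Ico 0 (totalLength a h) := by
  obtain ⟨x, y⟩ := p
  have hq := quarter_pos ha
  have hmono := strictMono_ellipseArc ha
  have hpi := Real.pi_pos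
  simp only [level] at hp
  have hy2 : y ^ 2 ≤ 1 := by
    have : 0 ≤ soft h x ^ 2 / a ^ 2 := by positivity
    linarith
  have hy := abs_le_one_iff_mul_self_le_one.2 (by nlinarith : y * y ≤ 1)
  rw [abs_le] at hy
  simp only [totalLength, Set.mem_Ico]
  by_cases hx1 : h < x
  · rw [soft_of_ge hh hx1.le] at hp
    have hcos := mul_cos_arcsin ha (by linarith : 0 ≤ x - h) hp
    have hy1 : y ^ 2 < 1 := by
      have : 0 < (x - h) ^ 2 / a ^ 2 := div_pos (pow_pos (by linarith) 2) (by positivity)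
      linarith
    have hy1' := abs_lt.1 ((sq_lt_one_iff_abs_lt_one y).1 hy1)
    have hlt : Real.arcsin y < Real.pi / 2 := Real.arcsin_lt_pi_div_two.2 hy1'.2
    have hgt : -(Real.pi / 2) < Real.arcsin y := Real.neg_pi_div_two_lt_arcsin.2 hy1'.1
    by_cases hy0 : 0 ≤ y
    · have harc : arcOf a h (x, y) = ellipseArc a (Real.arcsin y) := by
        simp only [arcOf]; rw [if_pos hx1, if_pos hy0]
      have h0 : ellipseArc a 0 ≤ ellipseArc a (Real.arcsin y) :=
        hmono.monotone (Real.arcsin_nonneg.2 hy0)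
      have h1 : ellipseArc a (Real.arcsin y) < quarter a := hmono hlt
      rw [ellipseArc_zero] at h0
      rw [harc, boundary_of_lt_quarter h1, ellipseParam_ellipseArc ha, hcos,
        Real.sin_arcsin hy.1 hy.2]
      exact ⟨by simp, h0, by linarith⟩
    · have harc : arcOf a h (x, y) = 4 * h + 4 * quarter a + ellipseArc a (Real.arcsin y) := by
        simp only [arcOf]; rw [if_pos hx1, if_neg hy0]
      have h0 : ellipseArc a (Real.arcsin y) < ellipseArc a 0 :=
        hmono (Real.arcsin_lt_zero.2 (not_le.1 hy0))
      have h1 : ellipseArc a (-(Real.pi / 2)) < ellipseArc a (Real.arcsin y) := hmono hgt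
      rw [ellipseArc_zero] at h0
      rw [ellipseArc_neg] at h1
      change -quarter a < _ at h1
      have h2 := ellipseArc_add_two_pi a (Real.arcsin y)
      rw [harc, boundary_of_last ha hh (by linarith),
        show 4 * h + 4 * quarter a + ellipseArc a (Real.arcsin y) - 4 * h =
          ellipseArc a (Real.arcsin y + 2 * Real.pi) by rw [h2]; ring,
        ellipseParam_ellipseArc ha, Real.cos_add_two_pi, Real.sin_add_two_pi, hcos,
        Real.sin_arcsin hy.1 hy.2]
      exact ⟨by simp, by linarith, by linarith⟩
  by_cases hx2 : x < -h
  · rw [soft_of_le hh hx2.le] at hp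
    have hcos := mul_cos_arcsin (y := y) ha (by linarith : 0 ≤ -(x + h)) (by rw [neg_sq]; exact hp)
    have hy1 : y ^ 2 < 1 := by
      have : 0 < (-(x + h)) ^ 2 / a ^ 2 := div_pos (pow_pos (by linarith) 2) (by positivity)
      rw [neg_sq] at this
      linarith
    have hy1' := abs_lt.1 ((sq_lt_one_iff_abs_lt_one y).1 hy1)
    have hlt : Real.arcsin y < Real.pi / 2 := Real.arcsin_lt_pi_div_two.2 hy1'.2
    have hgt : -(Real.pi / 2) < Real.arcsin y := Real.neg_pi_div_two_lt_arcsin.2 hy1'.1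
    have harc : arcOf a h (x, y) = 2 * h + ellipseArc a (Real.pi - Real.arcsin y) := by
      simp only [arcOf]; rw [if_neg hx1, if_pos hx2]
    have h3 := ellipseArc_add_pi a (-Real.arcsin y)
    rw [neg_add_eq_sub, ellipseArc_neg] at h3
    have h0 : ellipseArc a (Real.arcsin y) < quarter a := hmono hlt
    have h1 : ellipseArc a (-(Real.pi / 2)) < ellipseArc a (Real.arcsin y) := hmono hgt
    rw [ellipseArc_neg] at h1
    change -quarter a < _ at h1
    rw [harc, boundary_of_left hh (by linarith) (by linarith), add_sub_cancel_left,
      ellipseParam_ellipseArc ha, Real.cos_pi_sub, Real.sin_pi_sub, mul_neg, hcos,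
      Real.sin_arcsin hy.1 hy.2]
    exact ⟨by simp, by linarith, by linarith⟩
  push Not at hx1 hx2
  rw [soft_of_abs_le (abs_le.2 ⟨hx2, hx1⟩)] at hp
  have hy2 : y = 1 ∨ y = -1 := sq_eq_one_iff.1 (by simpa using hp)
  rcases hy2 with rfl | rfl
  · have harc : arcOf a h (x, 1) = quarter a + (h - x) := by
      simp only [arcOf]; rw [if_neg hx1.not_gt, if_neg hx2.not_gt, if_pos one_pos]
    rw [harc]
    refine ⟨?_, by linarith, by linarith⟩
    rcases hx2.lt_or_eq with hx3 | hx3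
    · rw [boundary_of_upper (by linarith) (by linarith)]
      simp
    · rw [boundary_of_left hh (by linarith) (by linarith),
        show quarter a + (h - x) - 2 * h = quarter a by linarith, ellipseParam_quarter ha]
      simp [hx3]
  · have harc : arcOf a h (x, -1) = 3 * quarter a + 2 * h + (x + h) := by
      simp only [arcOf]; rw [if_neg hx1.not_gt, if_neg hx2.not_gt, if_neg (by norm_num)]
    rw [harc]
    refine ⟨?_, by linarith, by linarith⟩
    rcases hx1.lt_or_eq with hx3 | hx3
    · rw [boundary_of_lower ha hh (by linarith) (by linarith)]
      simp
    · rw [boundary_of_last ha hh (by linarith),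
        show 3 * quarter a + 2 * h + (x + h) - 4 * h = 3 * quarter a by linarith,
        ellipseParam_three_quarter ha,
        show 3 * Real.pi / 2 = Real.pi / 2 + Real.pi by ring, Real.cos_add_pi, Real.sin_add_pi]
      simp [hx3]

/-! ### The moving frame of the boundary curve -/

/-- The inward unit normal at a point of the boundary curve, as a function of the point. -/
def nrm (a h : ℝ) (p : ℝ × ℝ) : ℝ × ℝ := -(Real.sqrt (dot (grad a h p) (grad a h p)))⁻¹ • grad a h p

/-- The curvature at a point of the boundary curve (which is not a joint), as a function of the
point. -/
def curv (a h : ℝ) (p : ℝ × ℝ) : ℝ :=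
  if |p.1| < h then 0 else a / Real.sqrt (1 + (a ^ 2 - 1) * p.2 ^ 2) ^ 3

/-- The points of the boundary curve other than the four joints and the two vertices
`(± (a + h), 0)`. -/
structure Regular (a h : ℝ) (p : ℝ × ℝ) : Prop where
  level_eq : level a h p = 1
  abs_ne : |p.1| ≠ h
  snd_ne : p.2 ≠ 0

lemma frame_of_eventuallyEq {a h s k : ℝ} {f f' : ℝ → ℝ × ℝ}
    (heq : boundary a h =ᶠ[nhds s] f) (hf : ∀ t, HasStrictDerivAt f (f' t) t)
    (hf' : HasStrictDerivAt f' (k • (-(f' s).2, (f' s).1)) s) :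
    tangent a h s = f' s ∧ HasStrictDerivAt (boundary a h) (tangent a h s) s ∧
      HasStrictDerivAt (tangent a h) (k • normal a h s) s := by
  have h1 : tangent a h =ᶠ[nhds s] f' := by
    filter_upwards [heq.deriv] with t ht
    rw [tangent, ht, (hf t).hasDerivAt.deriv]
  have h2 : tangent a h s = f' s := h1.self_of_nhds
  refine ⟨h2, ?_, ?_⟩
  · rw [h2]
    exact (hf s).congr_of_eventuallyEq heq.symm
  · rw [normal, h2]
    exact hf'.congr_of_eventuallyEq h1.symm

lemma hasStrictDerivAt_comp_sub {f : ℝ → ℝ × ℝ} {f' : ℝ × ℝ} {s c : ℝ}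
    (hf : HasStrictDerivAt f f' (s - c)) : HasStrictDerivAt (fun t => f (t - c)) f' s := by
  have h1 := HasStrictDerivAt.scomp (h := fun t => t - c) s hf
    ((hasStrictDerivAt_id s).sub_const c)
  rw [one_smul] at h1
  exact h1

lemma speed_eq {a θ : ℝ} : speed a θ = Real.sqrt (1 + (a ^ 2 - 1) * Real.sin θ ^ 2) := by
  rw [speed, Real.cos_sq']
  ring_nf

/-- On a half-ellipse, the normal obtained from the tangent is the normalized gradient. -/
lemma nrm_ellipse {a h x θ : ℝ} (ha : 1 < a) (hx : soft h x = a * Real.cos θ) :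
    (-(Real.cos θ / speed a θ), -a * Real.sin θ / speed a θ) = nrm a h (x, Real.sin θ) := by
  have hn := speed_pos ha θ
  have h1 : dot (grad a h (x, Real.sin θ)) (grad a h (x, Real.sin θ)) = (speed a θ / a) ^ 2 := by
    rw [div_pow, speed_sq]
    simp only [dot, grad, hx]
    field_simp
    ring
  have h2 : Real.sqrt ((speed a θ / a) ^ 2) = speed a θ / a := Real.sqrt_sq (by positivity)
  rw [nrm, h1, h2]
  simp only [grad, hx, neg_smul, Prod.smul_mk, Prod.neg_mk, smul_eq_mul, Prod.mk.injEq]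
  constructor <;> field_simp

section

variable {a h s : ℝ}

lemma mem_Ioo_of_regular (hs : s ∈ Set.Ico 0 (totalLength a h)) (ha : 1 < a)
    (hr : (boundary a h s).2 ≠ 0) : s ∈ Set.Ioo 0 (totalLength a h) := by
  refine ⟨lt_of_le_of_ne hs.1 ?_, hs.2⟩
  rintro rfl
  rw [boundary_of_lt_quarter (quarter_pos ha), ellipseParam_zero ha] at hr
  simp at hr

/-- Away from the joints, the boundary curve satisfies the Frenet equations, and its normal is the
normalized gradient of `level`. -/
lemma frame (ha : 1 < a) (hh : 0 < h) (hs : s ∈ Set.Ioo 0 (totalLength a h))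
    (hj : |(boundary a h s).1| ≠ h) :
    normal a h s = nrm a h (boundary a h s) ∧
      HasStrictDerivAt (boundary a h) (tangent a h s) s ∧
      HasStrictDerivAt (tangent a h) (curv a h (boundary a h s) • normal a h s) s := by
  obtain ⟨hs0, hsL⟩ := hs
  have hq := quarter_pos ha
  have hmono := strictMono_ellipseParam ha
  have hpi := Real.pi_pos
  rw [totalLength] at hsL
  -- a piece of the boundary which is a translate of a part of the ellipse
  have elliptic : ∀ x c : ℝ,
      (∀ᶠ t in nhds s, boundary a h t = (x + a * Real.cos (ellipseParam a (t - c)),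
        Real.sin (ellipseParam a (t - c)))) →
      soft h (boundary a h s).1 = a * Real.cos (ellipseParam a (s - c)) →
      ¬ |(boundary a h s).1| < h →
      normal a h s = nrm a h (boundary a h s) ∧
        HasStrictDerivAt (boundary a h) (tangent a h s) s ∧
        HasStrictDerivAt (tangent a h) (curv a h (boundary a h s) • normal a h s) s := by
    intro x c heq hsoft habs
    have h2 := heq.self_of_nhds
    obtain ⟨h3, h4, h5⟩ := frame_of_eventuallyEq
      (k := a / speed a (ellipseParam a (s - c)) ^ 3)
      (f' := fun t => ellipseTangent a (t - c)) heq
      (fun t => hasStrictDerivAt_comp_sub (hasStrictDerivAt_ellipse ha x (t - c)))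
      (hasStrictDerivAt_comp_sub (hasStrictDerivAt_ellipseTangent ha (s - c)))
    refine ⟨?_, h4, ?_⟩
    · rw [normal, h3]
      have h6 := nrm_ellipse (h := h) ha hsoft
      rw [h2] at h6 ⊢
      exact h6
    · rw [curv, if_neg habs, h2]
      simp only
      rw [← speed_eq]
      exact h5
  -- a horizontal piece
  have straight : ∀ σ c x : ℝ, σ ^ 2 = 1 →
      (∀ᶠ t in nhds s, boundary a h t = (x - σ * (t - c), σ)) →
      |(boundary a h s).1| < h →
      normal a h s = nrm a h (boundary a h s) ∧
        HasStrictDerivAt (boundary a h) (tangent a h s) s ∧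
        HasStrictDerivAt (tangent a h) (curv a h (boundary a h s) • normal a h s) s := by
    intro σ c x hσ heq habs
    have h2 := heq.self_of_nhds
    obtain ⟨h3, h4, h5⟩ := frame_of_eventuallyEq
      (k := 0) (f' := fun _ => (-σ, 0)) heq
      (fun t => by
        have h0 : HasStrictDerivAt (fun t => t - c) 1 t := (hasStrictDerivAt_id t).sub_const c
        have h1 := ((h0.const_mul σ).const_sub x).prodMk (hasStrictDerivAt_const t σ)
        simpa using h1)
      (by simpa using hasStrictDerivAt_const s ((-σ, 0) : ℝ × ℝ))
    refine ⟨?_, h4, ?_⟩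
    · have h7 : (boundary a h s).2 = σ := by rw [h2]
      rw [normal, h3, nrm]
      simp only [grad, dot, soft_of_abs_le habs.le, h7]
      simp [← sq, hσ]
    · rw [curv, if_pos habs]
      exact h5
  rcases lt_trichotomy s (quarter a) with h1 | h1 | h1
  · have l1 := hmono hs0
    have l2 := hmono h1
    rw [ellipseParam_zero ha] at l1
    rw [ellipseParam_quarter ha] at l2
    have hc := Real.cos_pos_of_mem_Ioo ⟨by linarith, l2⟩
    have hx : 0 < a * Real.cos (ellipseParam a s) := by positivity
    have hb := boundary_of_lt_quarter (h := h) h1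
    refine elliptic h 0 ?_ ?_ ?_
    · filter_upwards [gt_mem_nhds h1] with t ht
      rw [boundary_of_lt_quarter ht, sub_zero]
    · rw [hb, soft_of_ge hh (by simp only; linarith), sub_zero]
      simp only
      ring
    · rw [hb, abs_of_pos (by simp only; linarith)]
      simp only
      linarith
  · rw [h1, boundary_of_upper le_rfl (by linarith)] at hj
    simp [abs_of_pos hh] at hj
  rcases lt_trichotomy s (quarter a + 2 * h) with h2 | h2 | h2
  · refine straight 1 (quarter a) h (by norm_num) ?_ ?_
    · filter_upwards [gt_mem_nhds h2, lt_mem_nhds h1] with t ht ht'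
      rw [boundary_of_upper ht'.le ht, one_mul]
    · rw [boundary_of_upper h1.le h2, abs_lt]
      constructor <;> simp only <;> linarith
  · rw [h2, boundary_of_left hh le_rfl (by linarith), add_sub_cancel_right,
      ellipseParam_quarter ha] at hj
    simp [abs_of_pos hh] at hj
  rcases lt_trichotomy s (3 * quarter a + 2 * h) with h3 | h3 | h3
  · have l1 := hmono (by linarith : quarter a < s - 2 * h)
    have l2 := hmono (by linarith : s - 2 * h < 3 * quarter a)
    rw [ellipseParam_quarter ha] at l1
    rw [ellipseParam_three_quarter ha] at l2
    have hc := Real.cos_neg_of_pi_div_two_lt_of_lt l1 (by linarith)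
    have hx : 0 < a * -Real.cos (ellipseParam a (s - 2 * h)) := mul_pos (by linarith) (by linarith)
    have hb := boundary_of_left hh h2.le h3
    refine elliptic (-h) (2 * h) ?_ ?_ ?_
    · filter_upwards [gt_mem_nhds h3, lt_mem_nhds h2] with t ht ht'
      rw [boundary_of_left hh ht'.le ht]
    · rw [hb, soft_of_le hh (by simp only; linarith)]
      simp only
      ring
    · rw [hb, abs_of_neg (by simp only; linarith)]
      simp only
      linarith
  · rw [h3, boundary_of_lower ha hh le_rfl (by linarith)] at hj
    simp [abs_of_pos hh] at hj
  rcases lt_trichotomy s (3 * quarter a + 4 * h) with h4 | h4 | h4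
  · refine straight (-1) (3 * quarter a + 2 * h) (-h) (by norm_num) ?_ ?_
    · filter_upwards [gt_mem_nhds h4, lt_mem_nhds h3] with t ht ht'
      rw [boundary_of_lower ha hh ht'.le ht, neg_one_mul, sub_neg_eq_add]
    · rw [boundary_of_lower ha hh h3.le h4, abs_lt]
      constructor <;> simp only <;> linarith
  · rw [h4, boundary_of_last ha hh le_rfl, add_sub_cancel_right,
      ellipseParam_three_quarter ha, show 3 * Real.pi / 2 = Real.pi / 2 + Real.pi by ring,
      Real.cos_add_pi] at hj
    simp [abs_of_pos hh] at hj
  · have l1 := hmono (by linarith : 3 * quarter a < s - 4 * h)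
    have l2 := hmono (by linarith : s - 4 * h < 4 * quarter a)
    rw [ellipseParam_three_quarter ha] at l1
    rw [ellipseParam_four_quarter ha] at l2
    have hc : 0 < Real.cos (ellipseParam a (s - 4 * h)) := by
      rw [← Real.cos_sub_two_pi]
      exact Real.cos_pos_of_mem_Ioo ⟨by linarith, by linarith⟩
    have hx : 0 < a * Real.cos (ellipseParam a (s - 4 * h)) := by positivity
    have hb := boundary_of_last ha hh h4.le
    refine elliptic h (4 * h) ?_ ?_ ?_
    · filter_upwards [lt_mem_nhds h4] with t ht
      rw [boundary_of_last ha hh ht.le]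
    · rw [hb, soft_of_ge hh (by simp only; linarith)]
      simp only
      ring
    · rw [hb, abs_of_pos (by simp only; linarith)]
      simp only
      linarith

end

lemma Regular.dot_grad_pos {a h : ℝ} {p : ℝ × ℝ} (hp : Regular a h p) :
    0 < dot (grad a h p) (grad a h p) := by
  have := sq_pos_of_ne_zero hp.snd_ne
  simp only [dot, grad]
  nlinarith [sq_nonneg (soft h p.1 / a ^ 2)]

lemma Regular.dot_nrm {a h : ℝ} {p : ℝ × ℝ} (hp : Regular a h p) :
    dot (nrm a h p) (nrm a h p) = 1 := by
  have h1 := hp.dot_grad_pos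
  have h2 := Real.sq_sqrt h1.le
  have h3 := Real.sqrt_pos.2 h1
  set r := Real.sqrt (dot (grad a h p) (grad a h p)) with hr
  have h4 : dot (nrm a h p) (nrm a h p) = (r⁻¹) ^ 2 * dot (grad a h p) (grad a h p) := by
    rw [nrm, ← hr]
    simp only [dot, Prod.fst_neg, Prod.snd_neg, Prod.smul_fst, Prod.smul_snd, smul_eq_mul, neg_smul]
    ring
  rw [h4, ← h2]
  field_simp

lemma Regular.dot_nrm_eq {a h : ℝ} {p : ℝ × ℝ} (d : ℝ × ℝ) :
    dot (nrm a h p) d =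
      -(Real.sqrt (dot (grad a h p) (grad a h p)))⁻¹ * dot (grad a h p) d := by
  simp only [nrm, dot, Prod.fst_neg, Prod.snd_neg, Prod.smul_fst, Prod.smul_snd, smul_eq_mul,
    neg_smul]
  ring

lemma Regular.dot_nrm_pos_iff {a h : ℝ} {p d : ℝ × ℝ} (hp : Regular a h p) :
    0 < dot (nrm a h p) d ↔ dot (grad a h p) d < 0 := by
  have h3 := inv_pos.2 (Real.sqrt_pos.2 hp.dot_grad_pos)
  rw [Regular.dot_nrm_eq, neg_mul, neg_pos, mul_neg_iff]
  constructor
  · rintro (h | h)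
    · exact h.2
    · linarith [h.1]
  · exact fun h => Or.inl ⟨h3, h⟩

/-! ### One step of the billiard map -/

/-- The phase point `z` has the impact point `p` and the direction of motion `d`. -/
structure Represents (a h : ℝ) (z p d : ℝ × ℝ) : Prop where
  mem : z ∈ phaseSpace a h
  pt : boundary a h z.1 = p
  dir : direction a h z = d

/-- The elastic reflection of the direction `d` at the boundary point `p`. -/
def reflect (a h : ℝ) (p d : ℝ × ℝ) : ℝ × ℝ := d - (2 * dot (nrm a h p) d) • nrm a h p

lemma tangent_eq (a h s : ℝ) : tangent a h s = ((normal a h s).2, -(normal a h s).1) := by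
  simp [normal]

section

variable {a h : ℝ} {z : ℝ × ℝ}

lemma normal_eq_nrm {s : ℝ} (ha : 1 < a) (hh : 0 < h) (hs : s ∈ Set.Ico 0 (totalLength a h))
    (hr : Regular a h (boundary a h s)) : normal a h s = nrm a h (boundary a h s) :=
  (frame ha hh (mem_Ioo_of_regular hs ha hr.snd_ne) hr.abs_ne).1

lemma dot_normal_normal {s : ℝ} (ha : 1 < a) (hh : 0 < h) (hs : s ∈ Set.Ico 0 (totalLength a h))
    (hr : Regular a h (boundary a h s)) : dot (normal a h s) (normal a h s) = 1 := by
  rw [normal_eq_nrm ha hh hs hr, hr.dot_nrm]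

lemma regular_boundary {s : ℝ} (ha : 1 < a) (hh : 0 < h) (hs : s ∈ Set.Ico 0 (totalLength a h))
    (h1 : |(boundary a h s).1| ≠ h) (h2 : (boundary a h s).2 ≠ 0) :
    Regular a h (boundary a h s) :=
  ⟨level_boundary ha hh hs, h1, h2⟩

lemma cos_pos_of_mem (hz : z ∈ phaseSpace a h) : 0 < Real.cos z.2 :=
  Real.cos_pos_of_mem_Ioo hz.2

lemma direction_fst_snd (z : ℝ × ℝ) :
    (direction a h z).1 = Real.cos z.2 * (normal a h z.1).1 + Real.sin z.2 * (normal a h z.1).2 ∧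
      (direction a h z).2 =
        Real.cos z.2 * (normal a h z.1).2 - Real.sin z.2 * (normal a h z.1).1 := by
  rw [direction, tangent_eq]
  simp only [Prod.fst_add, Prod.snd_add, Prod.smul_fst, Prod.smul_snd, smul_eq_mul]
  exact ⟨trivial, by ring⟩

lemma dot_direction (ha : 1 < a) (hh : 0 < h) (hz : z ∈ phaseSpace a h)
    (hr : Regular a h (boundary a h z.1)) :
    dot (direction a h z) (direction a h z) = 1 ∧
      dot (nrm a h (boundary a h z.1)) (direction a h z) = Real.cos z.2 ∧
      dot (direction a h z) (tangent a h z.1) = Real.sin z.2 := by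
  obtain ⟨h1, h2⟩ := direction_fst_snd (a := a) (h := h) z
  have h3 := dot_normal_normal ha hh hz.1 hr
  rw [← normal_eq_nrm ha hh hz.1 hr, tangent_eq]
  simp only [dot] at *
  rw [h1, h2]
  have h4 := Real.sin_sq_add_cos_sq z.2
  refine ⟨?_, ?_, ?_⟩
  · linear_combination h3 * (Real.sin z.2 ^ 2 + Real.cos z.2 ^ 2) + h4
  · linear_combination Real.cos z.2 * h3
  · linear_combination Real.sin z.2 * h3

lemma dot_grad_direction_neg (ha : 1 < a) (hh : 0 < h) (hz : z ∈ phaseSpace a h)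
    (hr : Regular a h (boundary a h z.1)) :
    dot (grad a h (boundary a h z.1)) (direction a h z) < 0 := by
  rw [← hr.dot_nrm_pos_iff, (dot_direction ha hh hz hr).2.1]
  exact cos_pos_of_mem hz

/-- The impact point and the direction determine the phase point. -/
lemma Represents.unique {z' p d : ℝ × ℝ} (ha : 1 < a) (hh : 0 < h) (hp : Regular a h p)
    (h1 : Represents a h z p d) (h2 : Represents a h z' p d) : z = z' := by
  have h3 : z.1 = z'.1 := injOn_boundary ha hh h1.mem.1 h2.mem.1 (h1.pt.trans h2.pt.symm)
  have h4 := (dot_direction ha hh h1.mem (h1.pt.symm ▸ hp)).2.2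
  have h5 := (dot_direction ha hh h2.mem (h2.pt.symm ▸ hp)).2.2
  rw [h1.dir] at h4
  rw [h2.dir, ← h3, h4] at h5
  have h6 : z.2 = z'.2 :=
    Real.injOn_sin ⟨h1.mem.2.1.le, h1.mem.2.2.le⟩ ⟨h2.mem.2.1.le, h2.mem.2.2.le⟩ h5
  exact Prod.ext h3 h6

/-- The direction of a unit vector `d` in the orthonormal frame of the boundary. -/
lemma direction_eq_of_dot {s : ℝ} {d : ℝ × ℝ}
    (hn : dot (normal a h s) (normal a h s) = 1) (hd : dot d d = 1)
    (hpos : 0 < dot (normal a h s) d) :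
    dot d (tangent a h s) ∈ Set.Ioo (-1) 1 ∧
      direction a h (s, Real.arcsin (dot d (tangent a h s))) = d := by
  rw [tangent_eq]
  set u := dot (normal a h s) d with hu
  set v := dot d ((normal a h s).2, -(normal a h s).1) with hv
  have huv : u ^ 2 + v ^ 2 = 1 := by
    rw [hu, hv]
    simp only [dot] at *
    linear_combination (d.1 * d.1 + d.2 * d.2) * hn + hd
  have hv1 : v ∈ Set.Ioo (-1) 1 := by
    constructor <;> nlinarith
  refine ⟨hv1, ?_⟩
  have hs : Real.sin (Real.arcsin v) = v := Real.sin_arcsin hv1.1.le hv1.2.le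
  have hc : Real.cos (Real.arcsin v) = u := by
    rw [Real.cos_arcsin, show 1 - v ^ 2 = u ^ 2 by linarith, Real.sqrt_sq hpos.le]
  obtain ⟨h1, h2⟩ := direction_fst_snd (a := a) (h := h) (s, Real.arcsin v)
  simp only [hs, hc] at h1 h2
  ext
  · rw [h1, hu, hv]
    simp only [dot] at *
    linear_combination d.1 * hn
  · rw [h2, hu, hv]
    simp only [dot] at *
    linear_combination d.2 * hn

lemma exists_represents {p d : ℝ × ℝ} (ha : 1 < a) (hh : 0 < h) (hp : Regular a h p)
    (hd : dot d d = 1) (hpd : dot (grad a h p) d < 0) : ∃ z, Represents a h z p d := by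
  obtain ⟨h1, h2⟩ := boundary_arcOf ha hh hp.level_eq
  have h3 := normal_eq_nrm ha hh h2 (h1.symm ▸ hp)
  rw [h1] at h3
  rw [← hp.dot_nrm_pos_iff, ← h3] at hpd
  obtain ⟨h4, h5⟩ := direction_eq_of_dot (h3.symm ▸ hp.dot_nrm) hd hpd
  refine ⟨(arcOf a h p, Real.arcsin (dot d (tangent a h (arcOf a h p)))), ⟨h2, ?_, ?_⟩, h1, h5⟩
  · exact Real.neg_pi_div_two_lt_arcsin.2 h4.1
  · exact Real.arcsin_lt_pi_div_two.2 h4.2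

lemma billiardMap_hit (ha : 1 < a) (hh : 0 < h) (hz : z ∈ phaseSpace a h)
    (hr : Regular a h (boundary a h z.1)) :
    (billiardMap a h z).1 ∈ Set.Ico 0 (totalLength a h) ∧
      ∃ r : ℝ, 0 < r ∧ boundary a h (billiardMap a h z).1 =
        boundary a h z.1 + r • direction a h z := by
  obtain ⟨r, hr0, hr1⟩ := exists_ray_hit ha hh hr.level_eq (dot_grad_direction_neg ha hh hz hr)
  obtain ⟨h1, h2⟩ := boundary_arcOf ha hh hr1
  exact Classical.epsilon_spec (p := fun s' : ℝ => s' ∈ Set.Ico 0 (totalLength a h) ∧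
    ∃ r : ℝ, 0 < r ∧ boundary a h s' = boundary a h z.1 + r • direction a h z) ⟨_, h2, r, hr0, h1⟩

lemma billiardMap_fst_eq {s' r : ℝ} (ha : 1 < a) (hh : 0 < h) (hz : z ∈ phaseSpace a h)
    (hr : Regular a h (boundary a h z.1)) (hs' : s' ∈ Set.Ico 0 (totalLength a h)) (hr0 : 0 < r)
    (heq : boundary a h s' = boundary a h z.1 + r • direction a h z) :
    (billiardMap a h z).1 = s' := by
  obtain ⟨h1, r', hr'0, h2⟩ := billiardMap_hit ha hh hz hr
  apply injOn_boundary ha hh h1 hs'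
  have h3 := level_boundary ha hh h1
  have h4 := level_boundary ha hh hs'
  rw [h2] at h3
  rw [heq] at h4
  rw [h2, heq, ray_unique ha hh hr.level_eq (dot_grad_direction_neg ha hh hz hr) hr'0 hr0 h3 h4]

/-- The billiard map preserves the phase space, and acts by elastic reflection. -/
lemma billiardMap_represents (ha : 1 < a) (hh : 0 < h) (hz : z ∈ phaseSpace a h)
    (hr : Regular a h (boundary a h z.1))
    (hr' : Regular a h (boundary a h (billiardMap a h z).1)) :
    Represents a h (billiardMap a h z) (boundary a h (billiardMap a h z).1)
      (reflect a h (boundary a h (billiardMap a h z).1) (direction a h z)) := by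
  obtain ⟨h1, r, hr0, h2⟩ := billiardMap_hit ha hh hz hr
  set z' := billiardMap a h z with hz'
  set d := direction a h z with hd
  have hN := normal_eq_nrm ha hh h1 hr'
  have hNN := dot_normal_normal ha hh h1 hr'
  have hdd : dot d d = 1 := (dot_direction ha hh hz hr).1
  have hneg : dot (normal a h z'.1) d < 0 := by
    have h3 := level_boundary ha hh h1
    rw [h2] at h3
    have h4 := dot_grad_pos ha hh hr.level_eq (dot_grad_direction_neg ha hh hz hr) hr0 h3
    rw [← h2] at h4
    rw [hN, Regular.dot_nrm_eq, neg_mul, neg_lt_zero]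
    exact mul_pos (inv_pos.2 (Real.sqrt_pos.2 hr'.dot_grad_pos)) h4
  set d' := reflect a h (boundary a h z'.1) d with hd'
  have e1 : d'.1 = d.1 - 2 * dot (normal a h z'.1) d * (normal a h z'.1).1 := by
    rw [hd', reflect, ← hN]; rfl
  have e2 : d'.2 = d.2 - 2 * dot (normal a h z'.1) d * (normal a h z'.1).2 := by
    rw [hd', reflect, ← hN]; rfl
  have hd'd' : dot d' d' = 1 := by
    rw [dot, e1, e2]
    simp only [dot] at *
    linear_combination hdd + 4 * ((normal a h z'.1).1 * d.1 + (normal a h z'.1).2 * d.2) ^ 2 * hNN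
  have hpos : 0 < dot (normal a h z'.1) d' := by
    have : dot (normal a h z'.1) d' = -dot (normal a h z'.1) d := by
      rw [dot, e1, e2]
      simp only [dot] at *
      linear_combination (-2) * ((normal a h z'.1).1 * d.1 + (normal a h z'.1).2 * d.2) * hNN
    linarith
  have htan : dot d' (tangent a h z'.1) = dot d (tangent a h z'.1) := by
    rw [dot, e1, e2, tangent_eq]
    simp only [dot]
    ring
  obtain ⟨h4, h5⟩ := direction_eq_of_dot hNN hd'd' hpos
  rw [htan] at h4 h5
  have h6 : z' = (z'.1, Real.arcsin (dot d (tangent a h z'.1))) := Prod.ext rfl rfl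
  refine ⟨⟨h1, ?_⟩, rfl, ?_⟩
  · rw [h6]
    exact ⟨Real.neg_pi_div_two_lt_arcsin.2 h4.1, Real.arcsin_lt_pi_div_two.2 h4.2⟩
  · rw [h6]
    exact h5

lemma Represents.step {p d p' : ℝ × ℝ} {r : ℝ} (ha : 1 < a) (hh : 0 < h)
    (hz : Represents a h z p d) (hp : Regular a h p) (hp' : Regular a h p') (hr : 0 < r)
    (heq : p' = p + r • d) :
    Represents a h (billiardMap a h z) p' (reflect a h p' d) := by
  obtain ⟨h1, h2⟩ := boundary_arcOf ha hh hp'.level_eq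
  have hreg : Regular a h (boundary a h z.1) := hz.pt.symm ▸ hp
  have h3 := billiardMap_fst_eq ha hh hz.mem hreg h2 hr (by rw [h1, hz.pt, hz.dir, heq])
  have h4 : boundary a h (billiardMap a h z).1 = p' := by rw [h3, h1]
  have h5 := billiardMap_represents ha hh hz.mem hreg (h4.symm ▸ hp')
  rwa [h4, hz.dir] at h5

end

/-! ### The derivative of the billiard map -/

/-- The Jacobi coordinates of a tangent vector `v = (ds, dβ)` of the phase space: the displacement
orthogonal to the direction of motion, and the variation of the angle of that direction. -/
def jacobi (a h : ℝ) (z v : ℝ × ℝ) : ℝ × ℝ :=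
  (Real.cos z.2 * v.1, v.2 - curv a h (boundary a h z.1) * v.1)

/-- Free flight of length `r` followed by a reflection of strength `g`, in Jacobi coordinates. -/
def flight (r g : ℝ) : (ℝ × ℝ) →ₗ[ℝ] (ℝ × ℝ) where
  toFun w := (-(w.1 + r * w.2), -w.2 + g * (w.1 + r * w.2))
  map_add' v w := by ext <;> simp <;> ring
  map_smul' c w := by ext <;> simp <;> ring

lemma flight_apply (r g : ℝ) (w : ℝ × ℝ) :
    flight r g w = (-(w.1 + r * w.2), -w.2 + g * (w.1 + r * w.2)) := rfl

/-- The strength of the reflection at the phase point `z`: twice the curvature over the cosine of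
the angle. -/
def strength (a h : ℝ) (z : ℝ × ℝ) : ℝ := 2 * curv a h (boundary a h z.1) / Real.cos z.2

section

variable {a h : ℝ} {z : ℝ × ℝ}

/-- The derivative of the angle of the direction of motion. -/
def angleDeriv (a h : ℝ) (z : ℝ × ℝ) : ℝ × ℝ →L[ℝ] ℝ :=
  ContinuousLinearMap.snd ℝ ℝ ℝ - curv a h (boundary a h z.1) • ContinuousLinearMap.fst ℝ ℝ ℝ

lemma angleDeriv_apply (v : ℝ × ℝ) :
    angleDeriv a h z v = v.2 - curv a h (boundary a h z.1) * v.1 := by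
  simp [angleDeriv]

lemma hasStrictDerivAt_fst_snd {f : ℝ → ℝ × ℝ} {f' : ℝ × ℝ} {s : ℝ} (hf : HasStrictDerivAt f f' s) :
    HasStrictDerivAt (fun t => (f t).1) f'.1 s ∧ HasStrictDerivAt (fun t => (f t).2) f'.2 s :=
  ⟨(ContinuousLinearMap.fst ℝ ℝ ℝ).hasStrictFDerivAt.comp_hasStrictDerivAt s hf,
    (ContinuousLinearMap.snd ℝ ℝ ℝ).hasStrictFDerivAt.comp_hasStrictDerivAt s hf⟩

/-- When the phase point varies, the direction of motion turns by the variation of its angle. -/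
lemma hasStrictFDerivAt_direction (ha : 1 < a) (hh : 0 < h)
    (hz : z ∈ phaseSpace a h) (hr : Regular a h (boundary a h z.1)) :
    HasStrictFDerivAt (fun w => (direction a h w).1)
        ((direction a h z).2 • angleDeriv a h z) z ∧
      HasStrictFDerivAt (fun w => (direction a h w).2)
        (-(direction a h z).1 • angleDeriv a h z) z := by
  obtain ⟨-, -, hT⟩ := frame ha hh (mem_Ioo_of_regular hz.1 ha hr.snd_ne) hr.abs_ne
  obtain ⟨hx, hy⟩ := hasStrictDerivAt_fst_snd hT
  have hx' := hx.comp_hasStrictFDerivAt z (hasStrictFDerivAt_fst (𝕜 := ℝ) (E := ℝ) (F := ℝ))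
  have hy' := hy.comp_hasStrictFDerivAt z (hasStrictFDerivAt_fst (𝕜 := ℝ) (E := ℝ) (F := ℝ))
  have hc := (Real.hasStrictDerivAt_cos z.2).comp_hasStrictFDerivAt z
    (hasStrictFDerivAt_snd (𝕜 := ℝ) (E := ℝ) (F := ℝ))
  have hs := (Real.hasStrictDerivAt_sin z.2).comp_hasStrictFDerivAt z
    (hasStrictFDerivAt_snd (𝕜 := ℝ) (E := ℝ) (F := ℝ))
  constructor
  · refine ((hc.mul hy'.neg).add (hs.mul hx')).congr_fderiv ?_
    ext <;> simp [direction, normal, angleDeriv] <;> ring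
  · refine ((hc.mul hx').add (hs.mul hy')).congr_fderiv ?_
    ext <;> simp [direction, normal, angleDeriv] <;> ring

lemma dot_tangent (a h s : ℝ) (d : ℝ × ℝ) :
    -d.2 * (tangent a h s).1 + d.1 * (tangent a h s).2 = -dot (normal a h s) d := by
  rw [tangent_eq]
  simp only [dot]
  ring

/-- The derivative of the billiard map in Jacobi coordinates. -/
theorem hasFDerivAt_billiardMap {r : ℝ} (ha : 1 < a) (hh : 0 < h) (hz : z ∈ phaseSpace a h)
    (hr : Regular a h (boundary a h z.1))
    (hr' : Regular a h (boundary a h (billiardMap a h z).1)) (hr0 : 0 < r)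
    (heq : boundary a h (billiardMap a h z).1 = boundary a h z.1 + r • direction a h z) :
    ∃ A : ℝ × ℝ →L[ℝ] ℝ × ℝ, HasFDerivAt (billiardMap a h) A z ∧
      ∀ v, jacobi a h (billiardMap a h z) (A v) =
        flight r (strength a h (billiardMap a h z)) (jacobi a h z v) := by
  obtain ⟨hs1, -⟩ := billiardMap_hit ha hh hz hr
  have hrep := billiardMap_represents ha hh hz hr hr'
  have hN1 := normal_eq_nrm ha hh hs1 hr'
  have hNN1 := dot_normal_normal ha hh hs1 hr'
  -- the incoming direction makes the angle `β` of the reflected one with the normal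
  have hcos1 : dot (normal a h (billiardMap a h z).1) (direction a h z) =
      -Real.cos (billiardMap a h z).2 := by
    have h1 := (dot_direction ha hh hrep.mem hr').2.1
    rw [hrep.dir, reflect, ← hN1] at h1
    rw [← h1]
    simp only [dot, Prod.fst_sub, Prod.snd_sub, Prod.smul_fst, Prod.smul_snd, smul_eq_mul] at *
    linear_combination (-2) * ((normal a h (billiardMap a h z).1).1 * (direction a h z).1 +
      (normal a h (billiardMap a h z).1).2 * (direction a h z).2) * hNN1
  have hcospos : 0 < Real.cos (billiardMap a h z).2 := cos_pos_of_mem hrep.mem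
  have hsin1 : Real.sin (billiardMap a h z).2 =
      dot (direction a h z) (tangent a h (billiardMap a h z).1) := by
    have h1 := (dot_direction ha hh hrep.mem hr').2.2
    rw [← h1, hrep.dir, reflect, ← hN1, tangent_eq]
    simp only [dot, Prod.fst_sub, Prod.snd_sub, Prod.smul_fst, Prod.smul_snd, smul_eq_mul]
    ring
  set s1 := (billiardMap a h z).1 with hs1def
  have hs1' := mem_Ioo_of_regular hs1 ha hr'.snd_ne
  have hz1' := mem_Ioo_of_regular hz.1 ha hr.snd_ne
  obtain ⟨-, hG, -⟩ := frame ha hh hz1' hr.abs_ne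
  obtain ⟨-, hG1, hT1⟩ := frame ha hh hs1' hr'.abs_ne
  obtain ⟨hdd, hcos0, -⟩ := dot_direction ha hh hz hr
  rw [← normal_eq_nrm ha hh hz.1 hr] at hcos0
  obtain ⟨hd1, hd2⟩ := hasStrictFDerivAt_direction ha hh hz hr
  obtain ⟨hGx, hGy⟩ := hasStrictDerivAt_fst_snd hG
  obtain ⟨hG1x, hG1y⟩ := hasStrictDerivAt_fst_snd hG1
  obtain ⟨hT1x, hT1y⟩ := hasStrictDerivAt_fst_snd hT1
  set d := direction a h z with hd
  have heq1 : (boundary a h s1).1 - (boundary a h z.1).1 = r * d.1 := by rw [heq]; simp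
  have heq2 : (boundary a h s1).2 - (boundary a h z.1).2 = r * d.2 := by rw [heq]; simp
  -- the equation of the next impact: the new point lies on the line of motion
  let Φ : (ℝ × ℝ) × ℝ → ℝ := fun u =>
    -(direction a h u.1).2 * ((boundary a h u.2).1 - (boundary a h u.1.1).1) +
      (direction a h u.1).1 * ((boundary a h u.2).2 - (boundary a h u.1.1).2)
  let F' : (ℝ × ℝ) × ℝ →L[ℝ] ℝ :=
    (r • angleDeriv a h z + Real.cos z.2 • ContinuousLinearMap.fst ℝ ℝ ℝ).comp
      (ContinuousLinearMap.fst ℝ (ℝ × ℝ) ℝ) +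
    Real.cos (billiardMap a h z).2 • ContinuousLinearMap.snd ℝ (ℝ × ℝ) ℝ
  have hΦ : HasStrictFDerivAt Φ F' (z, s1) := by
    have hfst := hasStrictFDerivAt_fst (𝕜 := ℝ) (E := ℝ × ℝ) (F := ℝ) (p := (z, s1))
    have hsnd := hasStrictFDerivAt_snd (𝕜 := ℝ) (E := ℝ × ℝ) (F := ℝ) (p := (z, s1))
    have hfst1 := (hasStrictFDerivAt_fst (𝕜 := ℝ) (E := ℝ) (F := ℝ) (p := z)).comp (z, s1) hfst
    have k1 := hd1.comp (z, s1) hfst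
    have k2 := hd2.comp (z, s1) hfst
    have k3 := hG1x.comp_hasStrictFDerivAt (z, s1) hsnd
    have k4 := hG1y.comp_hasStrictFDerivAt (z, s1) hsnd
    have k5 := hGx.comp_hasStrictFDerivAt (z, s1) hfst1
    have k6 := hGy.comp_hasStrictFDerivAt (z, s1) hfst1
    refine ((k2.neg.mul (k3.sub k5)).add (k1.mul (k4.sub k6))).congr_fderiv ?_
    refine ContinuousLinearMap.ext fun ⟨v, σ⟩ => ?_
    have e1 := dot_tangent a h s1 d
    have e2 := dot_tangent a h z.1 d
    rw [hcos1] at e1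
    rw [hcos0] at e2
    simp only [F', Function.comp, add_apply, smul_apply,
      sub_apply, neg_apply, ContinuousLinearMap.comp_apply,
      ContinuousLinearMap.coe_fst', ContinuousLinearMap.coe_snd', smul_eq_mul, Pi.neg_apply,
      Pi.sub_apply, ← hd, heq1, heq2]
    simp only [dot] at hdd
    linear_combination r * angleDeriv a h z v * hdd + σ * e1 - v.1 * e2
  have hinv : (F' ∘L .inr ℝ (ℝ × ℝ) ℝ).IsInvertible := by
    refine ⟨ContinuousLinearEquiv.unitsEquivAut ℝ (Units.mk0 _ hcospos.ne'), ?_⟩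
    ext
    simp [F']
  set ψ := hΦ.implicitFunctionOfProdDomain hinv with hψdef
  have hψ := hΦ.hasStrictFDerivAt_implicitFunctionOfProdDomain hinv
  rw [← hψdef] at hψ
  simp only at hψ
  set ψ' := -(F' ∘L .inr ℝ (ℝ × ℝ) ℝ).inverse ∘L (F' ∘L .inl ℝ (ℝ × ℝ) ℝ) with hψ'def
  have hψz : ψ z = s1 := by
    have := hΦ.tendsto_implicitFunctionOfProdDomain hinv
    exact eq_of_tendsto_nhds this
  have hΦ0 : Φ (z, s1) = 0 := by
    simp only [Φ, ← hd, heq1, heq2]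
    ring
  have hΦψ : ∀ᶠ w in nhds z, Φ (w, ψ w) = 0 := by
    have := hΦ.eventually_apply_implicitFunctionOfProdDomain hinv
    rwa [hΦ0] at this
  have hψ'v : ∀ v, Real.cos (billiardMap a h z).2 * ψ' v =
      -(Real.cos z.2 * v.1 + r * angleDeriv a h z v) := by
    intro v
    have h1 : HasFDerivAt (fun w => Φ (w, ψ w)) (F'.comp ((ContinuousLinearMap.id ℝ _).prod ψ')) z :=
      HasFDerivAt.comp (g := Φ) (f := fun w => (w, ψ w)) z (by rw [hψz]; exact hΦ.hasFDerivAt)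
        ((hasFDerivAt_id z).prodMk hψ.hasFDerivAt)
    have h2 : HasFDerivAt (fun w => Φ (w, ψ w)) (0 : ℝ × ℝ →L[ℝ] ℝ) z :=
      (hasFDerivAt_const (0 : ℝ) z).congr_of_eventuallyEq hΦψ
    have h3 := congrArg (fun A : ℝ × ℝ →L[ℝ] ℝ => A v) (h1.unique h2)
    simp [F'] at h3
    linarith
  have hψc : ContinuousAt ψ z := hψ.hasFDerivAt.continuousAt
  -- near `z` the solution `ψ` of the equation is the next impact
  have hT : ∀ᶠ w in nhds z, (billiardMap a h w).1 = ψ w := by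
    have c0 : ContinuousAt (fun w : ℝ × ℝ => boundary a h w.1) z :=
      ContinuousAt.comp (f := Prod.fst) hG.hasDerivAt.continuousAt continuousAt_fst
    have c1 : ContinuousAt (fun w => boundary a h (ψ w)) z :=
      ContinuousAt.comp (g := boundary a h) (by rw [hψz]; exact hG1.hasDerivAt.continuousAt) hψc
    have c2 : ContinuousAt (fun w => (direction a h w).1) z := hd1.hasFDerivAt.continuousAt
    have c3 : ContinuousAt (fun w => (direction a h w).2) z := hd2.hasFDerivAt.continuousAt
    have c4 : ContinuousAt (fun w => (direction a h w).1 *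
        ((boundary a h (ψ w)).1 - (boundary a h w.1).1) +
        (direction a h w).2 * ((boundary a h (ψ w)).2 - (boundary a h w.1).2)) z := by
      fun_prop
    have o1 : ∀ᶠ w in nhds z, w ∈ Set.Ioo 0 (totalLength a h) ×ˢ
        Set.Ioo (-(Real.pi / 2)) (Real.pi / 2) :=
      (isOpen_Ioo.prod isOpen_Ioo).mem_nhds ⟨hz1', hz.2⟩
    have o2 : ∀ᶠ w in nhds z, |(boundary a h w.1).1| ≠ h :=
      (c0.fst.abs).eventually_ne hr.abs_ne
    have o3 : ∀ᶠ w in nhds z, (boundary a h w.1).2 ≠ 0 := c0.snd.eventually_ne hr.snd_ne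
    have o4 : ∀ᶠ w in nhds z, ψ w ∈ Set.Ioo 0 (totalLength a h) :=
      hψc.eventually_mem (isOpen_Ioo.mem_nhds (by rw [hψz]; exact hs1'))
    have o5 := c4.eventually_const_lt (u := 0) (by
      simp only [hψz, heq1, heq2, ← hd]
      simp only [dot] at hdd
      nlinarith)
    filter_upwards [o1, o2, o3, o4, o5, hΦψ] with w w1 w2 w3 w4 w5 w6
    have hwmem : w ∈ phaseSpace a h := ⟨⟨w1.1.1.le, w1.1.2⟩, w1.2⟩
    have hwreg := regular_boundary ha hh hwmem.1 w2 w3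
    have hwdd := (dot_direction ha hh hwmem hwreg).1
    refine billiardMap_fst_eq ha hh hwmem hwreg ⟨w4.1.le, w4.2⟩ w5 ?_
    simp only [Φ] at w6
    simp only [dot] at hwdd
    ext
    · simp only [Prod.fst_add, Prod.smul_fst, smul_eq_mul]
      linear_combination (-((boundary a h (ψ w)).1 - (boundary a h w.1).1)) * hwdd -
        (direction a h w).2 * w6
    · simp only [Prod.snd_add, Prod.smul_snd, smul_eq_mul]
      linear_combination (-((boundary a h (ψ w)).2 - (boundary a h w.1).2)) * hwdd +
        (direction a h w).1 * w6
  have hsq : Real.sqrt (1 - dot d (tangent a h s1) ^ 2) = Real.cos (billiardMap a h z).2 := by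
    rw [← hsin1, ← Real.cos_sq', Real.sqrt_sq hcospos.le]
  have hne : dot d (tangent a h s1) ≠ -1 ∧ dot d (tangent a h s1) ≠ 1 := by
    rw [← hsin1]
    have := Real.sin_sq_add_cos_sq (billiardMap a h z).2
    constructor <;> intro h0 <;> rw [h0] at this <;> nlinarith
  -- the new angle
  have hβ : HasFDerivAt (fun w => Real.arcsin ((direction a h w).1 * (tangent a h (ψ w)).1 +
      (direction a h w).2 * (tangent a h (ψ w)).2))
      (-(angleDeriv a h z) - curv a h (boundary a h s1) • ψ') z := by
    have k3 := HasStrictDerivAt.comp_hasStrictFDerivAt (h₂ := fun t => (tangent a h t).1) z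
      (by rw [hψz]; exact hT1x) hψ
    have k4 := HasStrictDerivAt.comp_hasStrictFDerivAt (h₂ := fun t => (tangent a h t).2) z
      (by rw [hψz]; exact hT1y) hψ
    have k5 := (hd1.mul k3).add (hd2.mul k4)
    have k6 : HasStrictFDerivAt (fun w => (direction a h w).1 * (tangent a h (ψ w)).1 +
        (direction a h w).2 * (tangent a h (ψ w)).2) (Real.cos (billiardMap a h z).2 •
          (-(angleDeriv a h z) - curv a h (boundary a h s1) • ψ')) z := by
      refine k5.congr_fderiv (ContinuousLinearMap.ext fun v => ?_)
      have e1 := dot_tangent a h s1 d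
      rw [hcos1] at e1
      simp only [dot] at hcos1
      simp only [add_apply, smul_apply, sub_apply, neg_apply, smul_eq_mul, ← hd, hψz, Function.comp,
        Prod.smul_fst, Prod.smul_snd]
      linear_combination (-angleDeriv a h z v) * e1 + curv a h (boundary a h s1) * ψ' v * hcos1
    have hval : (direction a h z).1 * (tangent a h (ψ z)).1 +
        (direction a h z).2 * (tangent a h (ψ z)).2 = dot d (tangent a h s1) := by
      rw [hψz]
      rfl
    have k7 := HasDerivAt.comp_hasFDerivAt (h₂ := Real.arcsin) z
      (by rw [hval]; exact (Real.hasStrictDerivAt_arcsin hne.1 hne.2).hasDerivAt) k6.hasFDerivAt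
    refine k7.congr_fderiv ?_
    rw [hsq, smul_smul, one_div_mul_cancel hcospos.ne', one_smul]
  refine ⟨ψ'.prod (-(angleDeriv a h z) - curv a h (boundary a h s1) • ψ'), ?_, ?_⟩
  · refine (hψ.hasFDerivAt.prodMk hβ).congr_of_eventuallyEq ?_
    filter_upwards [hT] with w hw
    rw [← hw]
    rfl
  · intro v
    have h1 := hψ'v v
    have h2 : strength a h (billiardMap a h z) * Real.cos (billiardMap a h z).2 =
        2 * curv a h (boundary a h s1) := by
      rw [strength, div_mul_cancel₀ _ hcospos.ne']
    rw [angleDeriv_apply] at h1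
    rw [flight_apply, jacobi, jacobi, ContinuousLinearMap.prod_apply]
    simp only [sub_apply, neg_apply,
      smul_apply, smul_eq_mul, angleDeriv_apply]
    ext
    · simp only
      linarith
    · simp only
      linear_combination ψ' v * h2 - strength a h (billiardMap a h z) * h1
end

/-! ### Elliptic and hyperbolic squares -/

lemma isEllipticMap_of_sq {A : ℝ × ℝ →L[ℝ] ℝ × ℝ} {K : ℝ × ℝ →ₗ[ℝ] ℝ × ℝ} {t : ℝ}
    (hA : ∀ v, A v = K (K v)) (hK : ∀ v, K (K v) = t • K v - v) (ht : |t| < 2) :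
    IsEllipticMap A := by
  obtain ⟨ht1, ht2⟩ := abs_lt.1 ht
  set φ := Real.arccos (t / 2) with hφ
  have hcos : t = 2 * Real.cos φ := by
    rw [hφ, Real.cos_arccos (by linarith) (by linarith)]
    ring
  have hsin : 0 < Real.sin φ := by
    rw [hφ, Real.sin_arccos]
    exact Real.sqrt_pos.2 (by nlinarith)
  have hsc := Real.sin_sq_add_cos_sq φ
  -- in the basis `e`, `f` the map `K` is the rotation by `φ`
  set e : ℝ × ℝ := (1, 0) with he
  set f : ℝ × ℝ := (Real.sin φ)⁻¹ • (K e - Real.cos φ • e) with hf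
  have hKe : K e = Real.cos φ • e + Real.sin φ • f := by
    rw [hf, smul_smul, mul_inv_cancel₀ hsin.ne', one_smul]
    abel
  have hKf : K f = -(Real.sin φ) • e + Real.cos φ • f := by
    have h1 : Real.sin φ • K f = Real.sin φ • (-(Real.sin φ) • e + Real.cos φ • f) := by
      have h2 : Real.sin φ • K f = K (K e) - Real.cos φ • K e := by
        conv_rhs => rw [hKe, map_add, map_smul, map_smul, hKe]
        module
      rw [h2, hK, hKe, hcos]
      have h3 : e = (Real.sin φ ^ 2 + Real.cos φ ^ 2) • e := by rw [hsc, one_smul]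
      nth_rewrite 2 [h3]
      module
    exact smul_right_injective _ hsin.ne' h1
  refine ⟨2 * φ, e, f, ?_, ?_, ?_, ?_⟩
  · rw [Real.cos_two_mul]
    nlinarith
  · rw [LinearIndependent.pair_iff]
    intro x y hxy
    -- apply `K` and eliminate `f`
    have h1 : K (x • e + y • f) = 0 := by rw [hxy, map_zero]
    rw [map_add, map_smul, map_smul, hKe, hKf] at h1
    have h2 : Real.sin φ • (x • f - y • e) = 0 := by
      have h3 : Real.sin φ • (x • f - y • e) =
          x • (Real.cos φ • e + Real.sin φ • f) + y • (-(Real.sin φ) • e + Real.cos φ • f) -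
            Real.cos φ • (x • e + y • f) := by module
      rw [h3, h1, hxy]
      simp
    have h3 := (smul_eq_zero.1 h2).resolve_left hsin.ne'
    have h4 : (x ^ 2 + y ^ 2) • e = 0 := by
      have h5 : (x ^ 2 + y ^ 2) • e = x • (x • e + y • f) - y • (x • f - y • e) := by module
      rw [h5, hxy, h3]
      simp
    have h5 : x ^ 2 + y ^ 2 = 0 := by simpa [he] using h4
    constructor <;> nlinarith [sq_nonneg x, sq_nonneg y]
  · rw [hA, hKe, map_add, map_smul, map_smul, hKe, hKf, Real.cos_two_mul, Real.sin_two_mul]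
    have h3 : Real.cos φ • (Real.cos φ • e + Real.sin φ • f) + Real.sin φ •
        (-(Real.sin φ) • e + Real.cos φ • f) = (2 * Real.cos φ ^ 2 -
          (Real.sin φ ^ 2 + Real.cos φ ^ 2)) • e + (2 * Real.sin φ * Real.cos φ) • f := by
      module
    rw [h3, hsc]
  · rw [hA, hKf, map_add, map_smul, map_smul, hKe, hKf, Real.cos_two_mul, Real.sin_two_mul]
    have h3 : -(Real.sin φ) • (Real.cos φ • e + Real.sin φ • f) + Real.cos φ •
        (-(Real.sin φ) • e + Real.cos φ • f) = -(2 * Real.sin φ * Real.cos φ) • e +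
          (2 * Real.cos φ ^ 2 - (Real.sin φ ^ 2 + Real.cos φ ^ 2)) • f := by
      module
    rw [h3, hsc]

lemma isHyperbolicMap_of_sq {A : ℝ × ℝ →L[ℝ] ℝ × ℝ} {K : ℝ × ℝ →ₗ[ℝ] ℝ × ℝ} {t : ℝ}
    (hA : ∀ v, A v = K (K v)) (hK : ∀ v, K (K v) = t • K v - v) (ht : 2 < |t|)
    (hne : ∀ c : ℝ, ∃ v, K v ≠ c • v) : IsHyperbolicMap A := by
  obtain ⟨l, hl, hlt⟩ : ∃ l : ℝ, l ^ 2 - t * l + 1 = 0 ∧ 1 < |l| := by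
    have h4 : 0 ≤ t ^ 2 - 4 := by rw [← sq_abs]; nlinarith
    have hsq := Real.sq_sqrt h4
    have hs0 := Real.sqrt_nonneg (t ^ 2 - 4)
    rcases lt_abs.1 ht with h | h
    · refine ⟨(t + Real.sqrt (t ^ 2 - 4)) / 2, by nlinarith, ?_⟩
      rw [lt_abs]
      left
      linarith
    · refine ⟨(t - Real.sqrt (t ^ 2 - 4)) / 2, by nlinarith, ?_⟩
      rw [lt_abs]
      right
      linarith
  have hl0 : l ≠ 0 := by rintro rfl; simp at hlt; linarith
  have hl2 : 1 < l ^ 2 := by rw [← sq_abs]; nlinarith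
  -- an eigenvector of `K` for `x` is obtained by applying `K - y`, `y` the other root
  have key : ∀ x y : ℝ, x + y = t → x * y = 1 →
      Module.End.HasEigenvalue (A : Module.End ℝ (ℝ × ℝ)) (x ^ 2) := by
    intro x y hxy hxy1
    obtain ⟨w, hw⟩ := hne y
    set v := K w - y • w with hv
    have hv0 : v ≠ 0 := sub_ne_zero.2 hw
    have hKv : K v = x • v := by
      rw [hv, map_sub, map_smul, hK, ← hxy]
      have : w = (x * y) • w := by rw [hxy1, one_smul]
      nth_rewrite 2 [this]
      module
    refine Module.End.hasEigenvalue_of_hasEigenvector (x := v) ⟨?_, hv0⟩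
    rw [Module.End.mem_eigenspace_iff]
    show A v = _
    rw [hA, hKv, map_smul, hKv, smul_smul, sq]
  refine ⟨(l⁻¹) ^ 2, l ^ 2, ?_, hl2, key l⁻¹ l ?_ (inv_mul_cancel₀ hl0), key l l⁻¹ ?_
    (mul_inv_cancel₀ hl0)⟩
  · rw [inv_pow, abs_inv, abs_of_pos (by linarith)]
    exact inv_lt_one_of_one_lt₀ hl2
  · field_simp
    linarith
  · field_simp
    linarith

/-- A rotation in some basis has no real eigenvalue larger than `1`. -/
lemma IsEllipticMap.not_isHyperbolicMap {A : ℝ × ℝ →L[ℝ] ℝ × ℝ} (hA : IsEllipticMap A) :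
    ¬ IsHyperbolicMap A := by
  rintro ⟨-, ν, -, hν, -, hev⟩
  obtain ⟨θ, e, f, -, hli, he, hf⟩ := hA
  obtain ⟨w, hw⟩ := hev.exists_hasEigenvector
  have hw1 : A w = ν • w := Module.End.mem_eigenspace_iff.1 hw.1
  have hspan : Submodule.span ℝ (Set.range ![e, f]) = ⊤ :=
    hli.span_eq_top_of_card_eq_finrank' (by simp)
  have hwmem : w ∈ Submodule.span ℝ (Set.range ![e, f]) := hspan ▸ Submodule.mem_top
  rw [Matrix.range_cons_cons_empty, Submodule.mem_span_pair] at hwmem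
  obtain ⟨x, y, rfl⟩ := hwmem
  rw [map_add, map_smul, map_smul, he, hf] at hw1
  rw [LinearIndependent.pair_iff] at hli
  obtain ⟨h1, h2⟩ := hli (x * Real.cos θ - y * Real.sin θ - ν * x)
    (x * Real.sin θ + y * Real.cos θ - ν * y) (by
      rw [← sub_eq_zero] at hw1
      rw [← hw1]
      module)
  have h3 : (ν ^ 2 - 1) * (x ^ 2 + y ^ 2) = 0 := by
    have := Real.sin_sq_add_cos_sq θ
    linear_combination (-(x * Real.cos θ - y * Real.sin θ) - ν * x) * h1 -
      (x * Real.sin θ + y * Real.cos θ + ν * y) * h2 + (x ^ 2 + y ^ 2) * this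
  have h4 : x ^ 2 + y ^ 2 = 0 := (mul_eq_zero.1 h3).resolve_left (by nlinarith)
  have hx : x = 0 := by nlinarith [sq_nonneg x, sq_nonneg y]
  have hy : y = 0 := by nlinarith [sq_nonneg x, sq_nonneg y]
  exact hw.2 (by rw [hx, hy]; simp)

/-- Two flights of lengths `l₁`, `l₂`, each followed by a reflection of strength `g`. -/
lemma flight_flight_sq (l₁ l₂ g : ℝ) (v : ℝ × ℝ) :
    (flight l₂ g ∘ₗ flight l₁ g) ((flight l₂ g ∘ₗ flight l₁ g) v) =
      (2 - 2 * g * (l₁ + l₂) + g ^ 2 * l₁ * l₂) • (flight l₂ g ∘ₗ flight l₁ g) v - v := by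
  ext <;> simp [flight_apply] <;> ring

lemma flight_flight_ne {l₁ l₂ g : ℝ} (hg : g ≠ 0) (hl : g * l₂ ≠ 2) (c : ℝ) :
    ∃ v, (flight l₂ g ∘ₗ flight l₁ g) v ≠ c • v := by
  refine ⟨(1, 0), fun h0 => ?_⟩
  have h1 := congrArg Prod.snd h0
  simp [flight_apply] at h1
  have h2 : g * (g * l₂ - 2) = 0 := by linarith
  rcases mul_eq_zero.1 h2 with h3 | h3
  · exact hg h3
  · exact hl (by linarith)

/-- If `A` is conjugate to the square of the composition of two flights, its type is determined by
the trace of that composition. -/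
lemma type_of_semiconj {A : ℝ × ℝ →L[ℝ] ℝ × ℝ} (W : (ℝ × ℝ) ≃ₗ[ℝ] (ℝ × ℝ)) {l₁ l₂ g : ℝ}
    (hW : ∀ v, W (A v) = (flight l₂ g ∘ₗ flight l₁ g) ((flight l₂ g ∘ₗ flight l₁ g) (W v)))
    (hg : g ≠ 0) (hl : g * l₂ ≠ 2) :
    (|2 - 2 * g * (l₁ + l₂) + g ^ 2 * l₁ * l₂| < 2 → IsEllipticMap A) ∧
      (2 < |2 - 2 * g * (l₁ + l₂) + g ^ 2 * l₁ * l₂| → IsHyperbolicMap A) := by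
  set H := flight l₂ g ∘ₗ flight l₁ g
  set K : ℝ × ℝ →ₗ[ℝ] ℝ × ℝ := W.symm.toLinearMap ∘ₗ H ∘ₗ W.toLinearMap with hK
  have hKv : ∀ v, K v = W.symm (H (W v)) := fun v => rfl
  have hA : ∀ v, A v = K (K v) := by
    intro v
    rw [hKv, hKv, W.apply_symm_apply, ← hW, W.symm_apply_apply]
  have hsq : ∀ v, K (K v) =
      (2 - 2 * g * (l₁ + l₂) + g ^ 2 * l₁ * l₂) • K v - v := by
    intro v
    rw [hKv, hKv, W.apply_symm_apply, flight_flight_sq, map_sub, map_smul, W.symm_apply_apply]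
  refine ⟨isEllipticMap_of_sq hA hsq, fun ht => isHyperbolicMap_of_sq hA hsq ht fun c => ?_⟩
  obtain ⟨v, hv⟩ := flight_flight_ne (l₁ := l₁) hg hl c
  refine ⟨W.symm v, fun h0 => hv ?_⟩
  rw [hKv, W.apply_symm_apply, ← map_smul] at h0
  exact W.symm.injective h0

/-! ### The explicit orbit -/

/-- The ordinate `y` of the impacts at the half-ellipses closes up a pantographic orbit: the last
equation says that the path which leaves the right half-ellipse at height `y` after a vertical link
reaches, after `i` impacts at the segments, the symmetric point of the left half-ellipse. -/
structure Closing (i : ℕ) (a h y : ℝ) : Prop where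
  one_lt : 1 < a
  sq_lt : a ^ 2 < 2
  pos : 0 < h
  y_pos : 0 < y
  y_lt : y < 1
  den_pos : 0 < (a ^ 2 + 1) * y ^ 2 - 1
  closing : (h + a * Real.sqrt (1 - y ^ 2)) * ((a ^ 2 + 1) * y ^ 2 - 1) =
    2 * a * y * Real.sqrt (1 - y ^ 2) * (i + y)

/-- The abscissa of the point of the right half-ellipse at height `± y`. -/
def abscissa (a h y : ℝ) : ℝ := h + a * Real.sqrt (1 - y ^ 2)

/-- The absolute values of the components of the velocity after the reflection, at height `± y`
of a half-ellipse, of a vertical motion. -/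
def velocity (a y : ℝ) : ℝ × ℝ :=
  (2 * a * y * Real.sqrt (1 - y ^ 2) / (1 + (a ^ 2 - 1) * y ^ 2),
    ((a ^ 2 + 1) * y ^ 2 - 1) / (1 + (a ^ 2 - 1) * y ^ 2))

/-- The horizontal distance travelled per unit of vertical distance. -/
def slope (a y : ℝ) : ℝ := 2 * a * y * Real.sqrt (1 - y ^ 2) / ((a ^ 2 + 1) * y ^ 2 - 1)

/-- The absolute value of the ordinate of the `j`-th impact of a half-period; the impacts `0`, `1`
and `i + 2` are at half-ellipses, the others at the segments. -/
def height (i : ℕ) (y : ℝ) (j : ℕ) : ℝ := if 2 ≤ j ∧ j ≤ i + 1 then 1 else y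

/-- The total vertical distance travelled from the impact `1` to the impact `j` of a half-period. -/
def travel (i : ℕ) (y : ℝ) (j : ℕ) : ℝ :=
  if j ≤ 1 then 0 else if j ≤ i + 1 then 1 + y + 2 * ((j : ℝ) - 2) else 2 * i + 2 * y

/-- The `j`-th impact of the `m`-th half-period. The sign `ε` is that of the first vertical link. -/
def orbitPoint (i : ℕ) (a h y ε : ℝ) (m j : ℕ) : ℝ × ℝ :=
  ((-1) ^ m * (abscissa a h y - slope a y * travel i y j),
    -(ε * (-1) ^ (m * (i + 2) + j)) * height i y j)

/-- The direction of motion after the `j`-th impact of the `m`-th half-period. -/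
def orbitDir (i : ℕ) (a y ε : ℝ) (m j : ℕ) : ℝ × ℝ :=
  if j = 0 then (0, ε * (-1) ^ (m * (i + 2) + j))
  else (-(-1) ^ m * (velocity a y).1, ε * (-1) ^ (m * (i + 2) + j) * (velocity a y).2)

/-- The length of the link which follows the `j`-th impact of a half-period. -/
def linkLength (i : ℕ) (a y : ℝ) (j : ℕ) : ℝ :=
  if j = 0 then 2 * y else (height i y j + height i y (j + 1)) / (velocity a y).2

lemma reflect_eq {a h : ℝ} {p : ℝ × ℝ} (hp : Regular a h p) (d : ℝ × ℝ) :
    reflect a h p d =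
      d - (2 * dot (grad a h p) d / dot (grad a h p) (grad a h p)) • grad a h p := by
  have h1 := hp.dot_grad_pos
  have h2 := Real.sq_sqrt h1.le
  have h3 := Real.sqrt_pos.2 h1
  rw [reflect, Regular.dot_nrm_eq, nrm]
  set r := Real.sqrt (dot (grad a h p) (grad a h p))
  rw [← h2, neg_smul, smul_neg, smul_smul, ← neg_smul]
  congr 2
  field_simp

lemma Regular.of_segment {a h x σ : ℝ} (hx : |x| < h) (hσ : σ ^ 2 = 1) : Regular a h (x, σ) := by
  refine ⟨?_, hx.ne, ?_⟩
  · simp only [level]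
    rw [soft_of_abs_le hx.le, hσ]
    simp
  · rintro rfl
    simp at hσ

lemma reflect_segment {a h x σ : ℝ} (hx : |x| < h) (hσ : σ ^ 2 = 1) (d : ℝ × ℝ) :
    reflect a h (x, σ) d = (d.1, -d.2) := by
  rw [reflect_eq (Regular.of_segment hx hσ)]
  simp only [grad, soft_of_abs_le hx.le, dot]
  ext
  · simp
  · simp [← sq, hσ]
    linear_combination (-2 * d.2) * hσ

section

variable {i : ℕ} {a h y ε : ℝ}

lemma sqrt_pos_of_lt (hy0 : 0 < y) (hy1 : y < 1) : 0 < Real.sqrt (1 - y ^ 2) :=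
  Real.sqrt_pos.2 (by nlinarith)

lemma sq_sqrt_of_lt (hy0 : 0 < y) (hy1 : y < 1) : Real.sqrt (1 - y ^ 2) ^ 2 = 1 - y ^ 2 :=
  Real.sq_sqrt (by nlinarith)

lemma Closing.sqrt_pos (H : Closing i a h y) : 0 < Real.sqrt (1 - y ^ 2) :=
  sqrt_pos_of_lt H.y_pos H.y_lt

lemma norm_pos (ha : 1 < a) (y : ℝ) : 0 < 1 + (a ^ 2 - 1) * y ^ 2 := by
  have : 0 ≤ (a ^ 2 - 1) * y ^ 2 := mul_nonneg (by nlinarith) (sq_nonneg _)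
  linarith

lemma lt_abscissa (ha : 1 < a) (hy0 : 0 < y) (hy1 : y < 1) : h < abscissa a h y := by
  have : 0 < a * Real.sqrt (1 - y ^ 2) := mul_pos (by linarith) (sqrt_pos_of_lt hy0 hy1)
  rw [abscissa]
  linarith

lemma soft_abscissa {α : ℝ} (ha : 1 < a) (hh : 0 < h) (hy0 : 0 < y) (hy1 : y < 1)
    (hα : α = 1 ∨ α = -1) :
    soft h (α * abscissa a h y) = α * (a * Real.sqrt (1 - y ^ 2)) := by
  have h1 := lt_abscissa (h := h) ha hy0 hy1
  rcases hα with rfl | rfl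
  · rw [one_mul, soft_of_ge hh h1.le, abscissa]
    ring
  · rw [soft_of_le hh (by linarith), abscissa]
    ring

lemma abs_sign_mul {α : ℝ} (hα : α = 1 ∨ α = -1) (x : ℝ) : |α * x| = |x| := by
  rcases hα with rfl | rfl <;> simp

lemma Regular.of_ellipse {α β : ℝ} (ha : 1 < a) (hh : 0 < h) (hy0 : 0 < y) (hy1 : y < 1)
    (hα : α = 1 ∨ α = -1) (hβ : β = 1 ∨ β = -1) :
    Regular a h (α * abscissa a h y, β * y) := by
  have h1 := lt_abscissa (h := h) ha hy0 hy1
  refine ⟨?_, ?_, ?_⟩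
  · simp only [level]
    rw [soft_abscissa ha hh hy0 hy1 hα]
    have hsq := sq_sqrt_of_lt hy0 hy1
    have hα2 : α ^ 2 = 1 := sq_eq_one_iff.2 hα
    have hβ2 : β ^ 2 = 1 := sq_eq_one_iff.2 hβ
    rw [mul_pow, mul_pow, mul_pow, hα2, hβ2, hsq]
    field_simp
    ring
  · rw [abs_sign_mul hα, abs_of_pos (hh.trans h1)]
    exact h1.ne'
  · rcases hβ with rfl | rfl <;> simp [hy0.ne']

lemma dot_grad_ellipse {α β : ℝ} (ha : 1 < a) (hh : 0 < h) (hy0 : 0 < y) (hy1 : y < 1)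
    (hα : α = 1 ∨ α = -1) (hβ : β = 1 ∨ β = -1) :
    grad a h (α * abscissa a h y, β * y) = (α * (Real.sqrt (1 - y ^ 2) / a), β * y) ∧
    dot (grad a h (α * abscissa a h y, β * y)) (grad a h (α * abscissa a h y, β * y)) =
      (1 + (a ^ 2 - 1) * y ^ 2) / a ^ 2 := by
  have h1 : grad a h (α * abscissa a h y, β * y) = (α * (Real.sqrt (1 - y ^ 2) / a), β * y) := by
    rw [grad, soft_abscissa ha hh hy0 hy1 hα]
    ext
    · simp only
      field_simp
    · rfl
  refine ⟨h1, ?_⟩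
  rw [h1]
  have hsq := sq_sqrt_of_lt hy0 hy1
  have hα2 : α ^ 2 = 1 := sq_eq_one_iff.2 hα
  have hβ2 : β ^ 2 = 1 := sq_eq_one_iff.2 hβ
  simp only [dot]
  have h2 : α * (Real.sqrt (1 - y ^ 2) / a) * (α * (Real.sqrt (1 - y ^ 2) / a)) +
      β * y * (β * y) = α ^ 2 * Real.sqrt (1 - y ^ 2) ^ 2 / a ^ 2 + β ^ 2 * y ^ 2 := by
    field_simp
  rw [h2, hα2, hβ2, hsq]
  field_simp
  ring

/-- The reflection at a half-ellipse of a vertical motion. -/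
lemma reflect_vertical {α β : ℝ} (ha : 1 < a) (hh : 0 < h) (hy0 : 0 < y) (hy1 : y < 1)
    (hα : α = 1 ∨ α = -1) (hβ : β = 1 ∨ β = -1) :
    reflect a h (α * abscissa a h y, β * y) (0, β) =
      (-α * (velocity a y).1, -β * (velocity a y).2) := by
  obtain ⟨h1, h2⟩ := dot_grad_ellipse (h := h) ha hh hy0 hy1 hα hβ
  have hsq := sq_sqrt_of_lt hy0 hy1
  have hn := (norm_pos ha y).ne'
  have hβ2 : β ^ 2 = 1 := sq_eq_one_iff.2 hβ
  rw [reflect_eq (Regular.of_ellipse ha hh hy0 hy1 hα hβ), h2, h1]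
  simp only [dot, velocity, mul_zero, zero_add]
  rw [show β * y * β = y by linear_combination y * hβ2]
  generalize hn' : 1 + (a ^ 2 - 1) * y ^ 2 = n at hn
  ext
  · simp only [Prod.fst_sub, Prod.smul_fst, smul_eq_mul]
    field_simp
    ring
  · simp only [Prod.snd_sub, Prod.smul_snd, smul_eq_mul]
    field_simp
    rw [← hn']
    ring

lemma dot_velocity {α β : ℝ} (ha : 1 < a) (hy0 : 0 < y) (hy1 : y < 1)
    (hα : α = 1 ∨ α = -1) (hβ : β = 1 ∨ β = -1) :
    dot (α * (Real.sqrt (1 - y ^ 2) / a), β * y)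
      (α * (velocity a y).1, β * (velocity a y).2) = y := by
  have hsq := sq_sqrt_of_lt hy0 hy1
  have hn := (norm_pos ha y).ne'
  have hα2 : α ^ 2 = 1 := sq_eq_one_iff.2 hα
  have hβ2 : β ^ 2 = 1 := sq_eq_one_iff.2 hβ
  simp only [dot, velocity]
  have : α * (Real.sqrt (1 - y ^ 2) / a) *
      (α * (2 * a * y * Real.sqrt (1 - y ^ 2) / (1 + (a ^ 2 - 1) * y ^ 2))) +
      β * y * (β * (((a ^ 2 + 1) * y ^ 2 - 1) / (1 + (a ^ 2 - 1) * y ^ 2))) =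
      (α ^ 2 * (2 * y) * Real.sqrt (1 - y ^ 2) ^ 2 + β ^ 2 * y * ((a ^ 2 + 1) * y ^ 2 - 1)) /
        (1 + (a ^ 2 - 1) * y ^ 2) := by
    field_simp
  rw [this, hα2, hβ2, hsq, div_eq_iff hn]
  ring

/-- The reflection at a half-ellipse which makes a motion vertical. -/
lemma reflect_to_vertical {α β : ℝ} (ha : 1 < a) (hh : 0 < h) (hy0 : 0 < y) (hy1 : y < 1)
    (hα : α = 1 ∨ α = -1) (hβ : β = 1 ∨ β = -1) :
    reflect a h (α * abscissa a h y, β * y) (α * (velocity a y).1, β * (velocity a y).2) =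
      (0, -β) := by
  obtain ⟨h1, h2⟩ := dot_grad_ellipse (h := h) ha hh hy0 hy1 hα hβ
  have hsq := sq_sqrt_of_lt hy0 hy1
  have hn := (norm_pos ha y).ne'
  have hα2 : α ^ 2 = 1 := sq_eq_one_iff.2 hα
  have hβ2 : β ^ 2 = 1 := sq_eq_one_iff.2 hβ
  rw [reflect_eq (Regular.of_ellipse ha hh hy0 hy1 hα hβ), h2, h1]
  have h3 := dot_velocity ha hy0 hy1 hα hβ
  rw [h3]
  simp only [velocity]
  generalize hn' : 1 + (a ^ 2 - 1) * y ^ 2 = n at hn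
  ext
  · simp only [Prod.fst_sub, Prod.smul_fst, smul_eq_mul]
    field_simp
    ring
  · simp only [Prod.snd_sub, Prod.smul_snd, smul_eq_mul]
    field_simp
    rw [← hn']
    ring

lemma Closing.velocity_pos (H : Closing i a h y) :
    0 < (velocity a y).1 ∧ 0 < (velocity a y).2 := by
  have h1 := H.sqrt_pos
  have h2 := norm_pos H.one_lt y
  have h3 := H.den_pos
  have h4 := H.y_pos
  have h5 := H.one_lt
  exact ⟨by simp only [velocity]; positivity, div_pos h3 h2⟩

lemma Closing.slope_pos (H : Closing i a h y) : 0 < slope a y := by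
  have h1 := H.sqrt_pos
  have h3 := H.den_pos
  have h4 := H.y_pos
  have h5 := H.one_lt
  simp only [slope]
  positivity

lemma slope_mul_velocity (ha : 1 < a) (hd : 0 < (a ^ 2 + 1) * y ^ 2 - 1) :
    slope a y * (velocity a y).2 = (velocity a y).1 := by
  have h2 := (norm_pos ha y).ne'
  simp only [slope, velocity]
  rw [div_mul_div_cancel₀ hd.ne']

lemma Closing.abscissa_eq (H : Closing i a h y) : abscissa a h y = slope a y * (i + y) := by
  have h3 := H.den_pos
  rw [abscissa, slope, div_mul_eq_mul_div, eq_div_iff h3.ne']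
  exact H.closing

/-- The first impact after leaving a half-ellipse is not on the same half-ellipse. -/
lemma Closing.lt_slope (H : Closing i a h y) :
    a * Real.sqrt (1 - y ^ 2) < slope a y * (1 + y) := by
  have h1 := H.sqrt_pos
  have h3 := H.den_pos
  have h4 := H.y_pos
  have h5 := H.y_lt
  have h6 := H.sq_lt
  have h7 := H.one_lt
  rw [slope, div_mul_eq_mul_div, lt_div_iff₀ h3]
  have h8 : (a ^ 2 + 1) * y ^ 2 - 1 < 2 * y * (1 + y) := by
    have : (a ^ 2 - 1) * y ^ 2 < 1 := by nlinarith
    nlinarith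
  have h9 : 0 < a * Real.sqrt (1 - y ^ 2) := by positivity
  nlinarith

lemma travel_succ {j : ℕ} (hj : 1 ≤ j) (hj' : j ≤ i + 1) :
    travel i y (j + 1) = travel i y j + (height i y j + height i y (j + 1)) := by
  simp only [travel, height]
  rcases hj.eq_or_lt with rfl | hj
  · rcases Nat.eq_zero_or_pos i with rfl | hi
    · simp
      ring
    · rw [if_neg (by omega), if_pos (by omega), if_pos le_rfl, if_neg (by omega),
        if_pos (by omega)]
      push_cast
      ring
  · rw [if_neg (by omega : ¬ j + 1 ≤ 1), if_neg (by omega : ¬ j ≤ 1), if_pos hj',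
      if_pos (⟨hj, hj'⟩ : 2 ≤ j ∧ j ≤ i + 1)]
    rcases hj'.eq_or_lt with rfl | hj'
    · rw [if_neg (by omega), if_neg (by omega)]
      push_cast
      ring
    · rw [if_pos (by omega), if_pos (by omega)]
      push_cast
      ring

lemma travel_last : travel i y (i + 2) = 2 * i + 2 * y := by
  rw [travel, if_neg (by omega), if_neg (by omega)]

lemma height_pos (hy : 0 < y) (j : ℕ) : 0 < height i y j := by
  rw [height]
  split_ifs
  · exact one_pos
  · exact hy

/-- The abscissa of the impact at a segment is in `(-h, h)`. -/
lemma Closing.abs_lt (H : Closing i a h y) {j : ℕ} (hj : 2 ≤ j) (hj' : j ≤ i + 1) :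
    |abscissa a h y - slope a y * travel i y j| < h := by
  have h1 := H.lt_slope
  have h2 := H.abscissa_eq
  have h3 := H.slope_pos
  have h4 : abscissa a h y = h + a * Real.sqrt (1 - y ^ 2) := rfl
  have h5 : (2 : ℝ) ≤ j := by exact_mod_cast hj
  have h6 : (j : ℝ) ≤ i + 1 := by exact_mod_cast hj'
  rw [travel, if_neg (by omega), if_pos hj', _root_.abs_lt]
  constructor
  · nlinarith [mul_nonneg h3.le (sub_nonneg.2 h6)]
  · nlinarith [mul_nonneg h3.le (sub_nonneg.2 h5)]

lemma sign_pow (m : ℕ) : (-1 : ℝ) ^ m = 1 ∨ (-1 : ℝ) ^ m = -1 := neg_one_pow_eq_or ℝ m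

lemma sign_mul (hε : ε = 1 ∨ ε = -1) (m : ℕ) : ε * (-1) ^ m = 1 ∨ ε * (-1) ^ m = -1 := by
  rcases hε with rfl | rfl <;> rcases sign_pow m with h | h <;> simp [h]

lemma orbitPoint_of_le_one {m j : ℕ} (hj : j ≤ 1) :
    orbitPoint i a h y ε m j =
      ((-1) ^ m * abscissa a h y, -(ε * (-1) ^ (m * (i + 2) + j)) * y) := by
  rw [orbitPoint, travel, if_pos hj, height, if_neg (by omega)]
  simp

lemma orbitPoint_last (H : Closing i a h y) (m : ℕ) :
    orbitPoint i a h y ε m (i + 2) = orbitPoint i a h y ε (m + 1) 0 := by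
  rw [orbitPoint_of_le_one zero_le_one, orbitPoint, travel_last, height, if_neg (by omega),
    H.abscissa_eq]
  ext
  · simp only
    ring
  · simp only
    ring

lemma neg_sign {β : ℝ} (hβ : β = 1 ∨ β = -1) : -β = 1 ∨ -β = -1 := by
  rcases hβ with rfl | rfl <;> simp

lemma regular_orbitPoint (H : Closing i a h y) (hε : ε = 1 ∨ ε = -1) {m j : ℕ}
    (hj : j ≤ i + 1) : Regular a h (orbitPoint i a h y ε m j) := by
  rcases Nat.lt_or_ge j 2 with h1 | h1
  · rw [orbitPoint_of_le_one (by omega)]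
    exact Regular.of_ellipse H.one_lt H.pos H.y_pos H.y_lt (sign_pow m)
      (neg_sign (sign_mul hε _))
  · rw [orbitPoint, height, if_pos ⟨h1, hj⟩, mul_one]
    refine Regular.of_segment ?_ (sq_eq_one_iff.2 (neg_sign (sign_mul hε _)))
    rw [abs_sign_mul (sign_pow m)]
    exact H.abs_lt h1 hj

/-- The impacts are joined by the links. -/
lemma orbitPoint_succ (H : Closing i a h y) {m j : ℕ} (hj : j ≤ i + 1) :
    orbitPoint i a h y ε m (j + 1) =
      orbitPoint i a h y ε m j + linkLength i a y j • orbitDir i a y ε m j := by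
  rcases Nat.eq_zero_or_pos j with rfl | hj0
  · rw [orbitPoint_of_le_one zero_le_one, orbitPoint_of_le_one le_rfl, linkLength, if_pos rfl,
      orbitDir, if_pos rfl]
    ext
    · simp
    · simp only [Prod.snd_add, Prod.smul_snd, smul_eq_mul]
      ring
  · have hv := H.velocity_pos.2.ne'
    have hs := slope_mul_velocity H.one_lt H.den_pos
    rw [orbitPoint, orbitPoint, linkLength, if_neg hj0.ne', orbitDir, if_neg hj0.ne',
      travel_succ hj0 hj]
    ext
    · simp only [Prod.fst_add, Prod.smul_fst, smul_eq_mul]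
      rw [← hs]
      field_simp
      ring
    · simp only [Prod.snd_add, Prod.smul_snd, smul_eq_mul]
      field_simp
      ring

lemma orbitDir_succ (H : Closing i a h y) (hε : ε = 1 ∨ ε = -1) {m j : ℕ} (hj : j ≤ i) :
    orbitDir i a y ε m (j + 1) =
      reflect a h (orbitPoint i a h y ε m (j + 1)) (orbitDir i a y ε m j) := by
  rw [orbitDir, if_neg (by omega)]
  rcases Nat.eq_zero_or_pos j with rfl | hj0
  · rw [orbitPoint_of_le_one le_rfl, orbitDir, if_pos rfl]
    have h1 : -(ε * (-1) ^ (m * (i + 2) + (0 + 1))) = ε * (-1) ^ (m * (i + 2) + 0) := by ring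
    rw [h1, reflect_vertical H.one_lt H.pos H.y_pos H.y_lt (sign_pow m) (sign_mul hε _), ← h1,
      neg_neg]
  · rw [orbitDir, if_neg hj0.ne', orbitPoint, height, if_pos ⟨by omega, by omega⟩, mul_one,
      reflect_segment]
    · ext
      · rfl
      · simp only
        ring
    · rw [abs_sign_mul (sign_pow m)]
      exact H.abs_lt (by omega) (by omega)
    · exact sq_eq_one_iff.2 (neg_sign (sign_mul hε _))

lemma orbitDir_last (H : Closing i a h y) (hε : ε = 1 ∨ ε = -1) (m : ℕ) :
    orbitDir i a y ε (m + 1) 0 =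
      reflect a h (orbitPoint i a h y ε (m + 1) 0) (orbitDir i a y ε m (i + 1)) := by
  rw [orbitDir, if_pos rfl, orbitDir, if_neg (by omega), orbitPoint_of_le_one zero_le_one]
  have h1 := reflect_to_vertical (h := h) H.one_lt H.pos H.y_pos H.y_lt (sign_pow (m + 1))
    (neg_sign (sign_mul hε ((m + 1) * (i + 2) + 0)))
  rw [neg_neg] at h1
  rw [← h1]
  congr 1
  ext
  · simp only
    ring
  · simp only
    ring

lemma orbitPoint_zero_zero :
    orbitPoint i a h y ε 0 0 = (abscissa a h y, -ε * y) ∧ orbitDir i a y ε 0 0 = (0, ε) := by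
  rw [orbitPoint_of_le_one zero_le_one, orbitDir, if_pos rfl]
  simp

/-- The billiard orbit of the initial point of the vertical link on the right is explicit. -/
theorem represents_orbit (H : Closing i a h y) (hε : ε = 1 ∨ ε = -1) {z : ℝ × ℝ}
    (hz : Represents a h z (abscissa a h y, -ε * y) (0, ε)) (m j : ℕ) (hj : j ≤ i + 1) :
    Represents a h ((billiardMap a h)^[m * (i + 2) + j] z) (orbitPoint i a h y ε m j)
      (orbitDir i a y ε m j) := by
  have hlen : ∀ j, 0 < linkLength i a y j := by
    intro j
    rw [linkLength]
    have h1 := H.y_pos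
    have h2 := H.velocity_pos.2
    have h3 := height_pos (i := i) h1 j
    have h4 := height_pos (i := i) h1 (j + 1)
    split_ifs <;> positivity
  have hblock : ∀ m, Represents a h ((billiardMap a h)^[m * (i + 2)] z)
      (orbitPoint i a h y ε m 0) (orbitDir i a y ε m 0) → ∀ j, j ≤ i + 1 →
      Represents a h ((billiardMap a h)^[m * (i + 2) + j] z) (orbitPoint i a h y ε m j)
        (orbitDir i a y ε m j) := by
    intro m h0 j
    induction j with
    | zero => exact fun _ => h0
    | succ j ih =>
      intro hj
      have h1 := (ih (by omega)).step H.one_lt H.pos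
        (regular_orbitPoint H hε (by omega)) (regular_orbitPoint H hε hj) (hlen j)
        (orbitPoint_succ H (by omega))
      rw [← orbitDir_succ H hε (by omega)] at h1
      rw [← add_assoc, Function.iterate_succ_apply']
      exact h1
  refine hblock m ?_ j hj
  clear hj
  induction m with
  | zero =>
    rw [zero_mul, orbitPoint_zero_zero.1, (orbitPoint_zero_zero (h := h)).2]
    exact hz
  | succ m ih =>
    have h1 := (hblock m ih (i + 1) le_rfl).step H.one_lt H.pos
      (regular_orbitPoint H hε le_rfl)
      (regular_orbitPoint (m := m + 1) (j := 0) H hε (by omega)) (hlen (i + 1))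
      (by rw [← orbitPoint_last H, orbitPoint_succ H le_rfl])
    rw [← orbitDir_last H hε] at h1
    rw [show (m + 1) * (i + 2) = m * (i + 2) + (i + 1) + 1 by ring, Function.iterate_succ_apply']
    exact h1

lemma exists_orbit (H : Closing i a h y) (hε : ε = 1 ∨ ε = -1) :
    ∃ z, Represents a h z (abscissa a h y, -ε * y) (0, ε) := by
  have h1 := Regular.of_ellipse (h := h) H.one_lt H.pos H.y_pos H.y_lt (Or.inl rfl) (neg_sign hε)
  rw [one_mul] at h1
  refine exists_represents H.one_lt H.pos h1 ?_ ?_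
  · rw [dot]
    have := sq_eq_one_iff.2 hε
    simp only
    linarith
  · have := sq_eq_one_iff.2 hε
    have h2 := H.y_pos
    simp only [dot, grad]
    nlinarith

lemma orbit_periodic (H : Closing i a h y) (hε : ε = 1 ∨ ε = -1) {z : ℝ × ℝ}
    (hz : Represents a h z (abscissa a h y, -ε * y) (0, ε)) :
    (billiardMap a h)^[4 + 2 * i] z = z := by
  have h1 := represents_orbit H hε hz 2 0 (by omega)
  rw [show 2 * (i + 2) + 0 = 4 + 2 * i by ring] at h1
  have h2 : orbitPoint i a h y ε 2 0 = (abscissa a h y, -ε * y) := by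
    rw [orbitPoint_of_le_one zero_le_one]
    simp [pow_mul]
  have h3 : orbitDir i a y ε 2 0 = (0, ε) := by
    rw [orbitDir, if_pos rfl]
    simp [pow_mul]
  rw [h2, h3] at h1
  have h4 := Regular.of_ellipse (h := h) H.one_lt H.pos H.y_pos H.y_lt (Or.inl rfl) (neg_sign hε)
  rw [one_mul] at h4
  exact h1.unique H.one_lt H.pos h4 hz

end

/-! ### The monodromy of the explicit orbit -/

/-- The composition of the flights `k, …, k + n - 1` of a sequence of flights. -/
def flights (r g : ℕ → ℝ) (k : ℕ) : ℕ → (ℝ × ℝ) →ₗ[ℝ] (ℝ × ℝ)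
  | 0 => LinearMap.id
  | n + 1 => flight (r (k + n)) (g (k + n)) ∘ₗ flights r g k n

lemma flights_succ_apply (r g : ℕ → ℝ) (k n : ℕ) (w : ℝ × ℝ) :
    flights r g k (n + 1) w = flight (r (k + n)) (g (k + n)) (flights r g k n w) := rfl

lemma flights_add_apply (r g : ℕ → ℝ) (k n m : ℕ) (w : ℝ × ℝ) :
    flights r g k (n + m) w = flights r g (k + n) m (flights r g k n w) := by
  induction m with
  | zero => rfl
  | succ m ih => rw [← add_assoc, flights_succ_apply, ih, flights_succ_apply, add_assoc]

lemma flights_periodic {r g : ℕ → ℝ} {p : ℕ} (hr : ∀ k, r (k + p) = r k)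
    (hg : ∀ k, g (k + p) = g k) (k n : ℕ) : flights r g (k + p) n = flights r g k n := by
  induction n with
  | zero => rfl
  | succ n ih =>
    refine LinearMap.ext fun w => ?_
    rw [flights_succ_apply, flights_succ_apply, ih, add_right_comm, hr, hg]

lemma injective_flight (r g : ℝ) : Function.Injective (flight r g) := by
  rw [← LinearMap.ker_eq_bot, LinearMap.ker_eq_bot']
  rintro ⟨u, v⟩ h
  rw [flight_apply, Prod.mk_eq_zero] at h
  simp only at h
  have h1 : u + r * v = 0 := by linarith [h.1]
  have h2 : v = 0 := by have := h.2; rw [h1] at this; linarith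
  rw [h2, mul_zero, add_zero] at h1
  rw [h1, h2]
  rfl

lemma injective_flights (r g : ℕ → ℝ) (k n : ℕ) : Function.Injective (flights r g k n) := by
  induction n with
  | zero => exact Function.injective_id
  | succ n ih => exact (injective_flight _ _).comp ih

/-- The derivatives of the iterates of the billiard map along an orbit, in Jacobi coordinates. -/
lemma exists_hasFDerivAt_iterate {a h : ℝ} {z : ℝ × ℝ} {r g : ℕ → ℝ}
    (hstep : ∀ k, ∃ A : ℝ × ℝ →L[ℝ] ℝ × ℝ,
      HasFDerivAt (billiardMap a h) A ((billiardMap a h)^[k] z) ∧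
      ∀ v, jacobi a h ((billiardMap a h)^[k + 1] z) (A v) =
        flight (r k) (g k) (jacobi a h ((billiardMap a h)^[k] z) v)) (k n : ℕ) :
    ∃ A : ℝ × ℝ →L[ℝ] ℝ × ℝ,
      HasFDerivAt (billiardMap a h)^[n] A ((billiardMap a h)^[k] z) ∧
      ∀ v, jacobi a h ((billiardMap a h)^[k + n] z) (A v) =
        flights r g k n (jacobi a h ((billiardMap a h)^[k] z) v) := by
  induction n with
  | zero => exact ⟨ContinuousLinearMap.id ℝ _, hasFDerivAt_id _, fun v => rfl⟩
  | succ n ih =>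
    obtain ⟨A, hA, hA'⟩ := ih
    obtain ⟨B, hB, hB'⟩ := hstep (k + n)
    refine ⟨B.comp A, ?_, fun v => ?_⟩
    · rw [Function.iterate_succ']
      refine HasFDerivAt.comp _ ?_ hA
      rw [← Function.iterate_add_apply, add_comm n k]
      exact hB
    · rw [flights_succ_apply, ← hA', ← hB', ← add_assoc]
      rfl

section

variable {i : ℕ} {a h y ε : ℝ}

/-- The strength of the reflections at the half-ellipses. -/
def ellipseStrength (a y : ℝ) : ℝ := 2 / (y * (1 + (a ^ 2 - 1) * y ^ 2))

lemma cos_eq_dot {z p d : ℝ × ℝ} (ha : 1 < a) (hh : 0 < h) (hz : Represents a h z p d)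
    (hp : Regular a h p) : Real.cos z.2 = dot (nrm a h p) d := by
  have h1 := (dot_direction ha hh hz.mem (hz.pt.symm ▸ hp)).2.1
  rw [← h1, hz.pt, hz.dir]

lemma strength_ellipse {z d : ℝ × ℝ} {α β : ℝ} (ha : 1 < a) (hh : 0 < h) (hy0 : 0 < y)
    (hy1 : y < 1) (hα : α = 1 ∨ α = -1) (hβ : β = 1 ∨ β = -1)
    (hz : Represents a h z (α * abscissa a h y, β * y) d)
    (hd : dot (grad a h (α * abscissa a h y, β * y)) d = -y) :
    strength a h z = ellipseStrength a y := by
  have hX := lt_abscissa (h := h) ha hy0 hy1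
  have h1 := cos_eq_dot ha hh hz (Regular.of_ellipse ha hh hy0 hy1 hα hβ)
  have hn := norm_pos ha y
  have hβ2 : β ^ 2 = 1 := sq_eq_one_iff.2 hβ
  have hs := Real.sq_sqrt hn.le
  have hs0 := Real.sqrt_pos.2 hn
  rw [Regular.dot_nrm_eq, hd, (dot_grad_ellipse ha hh hy0 hy1 hα hβ).2, Real.sqrt_div' _ (sq_nonneg a),
    Real.sqrt_sq (by linarith)] at h1
  rw [strength, hz.pt, h1, curv, if_neg (by
    rw [abs_sign_mul hα, abs_of_pos (hh.trans hX)]; exact hX.not_gt)]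
  simp only
  rw [mul_pow, hβ2, one_mul, ellipseStrength]
  generalize Real.sqrt (1 + (a ^ 2 - 1) * y ^ 2) = q at hs hs0
  rw [← hs]
  have : 0 < a := by linarith
  field_simp

lemma strength_orbit (H : Closing i a h y) (hε : ε = 1 ∨ ε = -1) {z : ℝ × ℝ} {m j : ℕ}
    (hj : j ≤ i + 1)
    (hz : Represents a h z (orbitPoint i a h y ε m j) (orbitDir i a y ε m j)) :
    strength a h z = if j ≤ 1 then ellipseStrength a y else 0 := by
  split_ifs with h1
  · rw [orbitPoint_of_le_one h1] at hz
    refine strength_ellipse H.one_lt H.pos H.y_pos H.y_lt (sign_pow m)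
      (neg_sign (sign_mul hε _)) hz ?_
    have hsign := sq_eq_one_iff.2 (sign_mul hε (m * (i + 2) + j))
    rw [(dot_grad_ellipse H.one_lt H.pos H.y_pos H.y_lt (sign_pow m)
      (neg_sign (sign_mul hε _))).1, orbitDir]
    split_ifs with h2
    · simp only [dot]
      linear_combination (-y) * hsign
    · have h3 := dot_velocity H.one_lt H.y_pos H.y_lt (sign_pow m)
        (neg_sign (sign_mul hε (m * (i + 2) + j)))
      simp only [dot] at h3 ⊢
      linear_combination -h3
  · rw [strength, hz.pt, curv, if_pos, mul_zero, zero_div]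
    rw [orbitPoint]
    simp only
    rw [abs_sign_mul (sign_pow m)]
    exact H.abs_lt (by omega) hj

lemma represents_orbit_mod (H : Closing i a h y) (hε : ε = 1 ∨ ε = -1) {z : ℝ × ℝ}
    (hz : Represents a h z (abscissa a h y, -ε * y) (0, ε)) (k : ℕ) :
    Represents a h ((billiardMap a h)^[k] z) (orbitPoint i a h y ε (k / (i + 2)) (k % (i + 2)))
      (orbitDir i a y ε (k / (i + 2)) (k % (i + 2))) := by
  have h1 := represents_orbit H hε hz (k / (i + 2)) (k % (i + 2))
    (Nat.lt_succ_iff.1 (Nat.mod_lt k (by omega)))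
  rwa [mul_comm, Nat.div_add_mod] at h1

lemma orbit_step (H : Closing i a h y) (hε : ε = 1 ∨ ε = -1) {z : ℝ × ℝ}
    (hz : Represents a h z (abscissa a h y, -ε * y) (0, ε)) (k : ℕ) :
    ∃ A : ℝ × ℝ →L[ℝ] ℝ × ℝ,
      HasFDerivAt (billiardMap a h) A ((billiardMap a h)^[k] z) ∧
      ∀ v, jacobi a h ((billiardMap a h)^[k + 1] z) (A v) =
        flight (linkLength i a y (k % (i + 2)))
          (if (k + 1) % (i + 2) ≤ 1 then ellipseStrength a y else 0)
          (jacobi a h ((billiardMap a h)^[k] z) v) := by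
  have h1 := represents_orbit_mod H hε hz k
  have h2 := represents_orbit_mod H hε hz (k + 1)
  have hj : ∀ k, k % (i + 2) ≤ i + 1 := fun k => Nat.lt_succ_iff.1 (Nat.mod_lt k (by omega))
  rw [Function.iterate_succ_apply'] at h2 ⊢
  have hlen : 0 < linkLength i a y (k % (i + 2)) := by
    rw [linkLength]
    have h1 := H.y_pos
    have h2 := H.velocity_pos.2
    have h3 := height_pos (i := i) h1 (k % (i + 2))
    have h4 := height_pos (i := i) h1 (k % (i + 2) + 1)
    split_ifs <;> positivity
  have hnext : orbitPoint i a h y ε ((k + 1) / (i + 2)) ((k + 1) % (i + 2)) =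
      orbitPoint i a h y ε (k / (i + 2)) (k % (i + 2) + 1) := by
    rcases (hj k).lt_or_eq with hlt | heq
    · rw [Nat.add_mod_of_add_mod_lt (by rw [Nat.mod_eq_of_lt (by omega : 1 < i + 2)]; omega),
        Nat.mod_eq_of_lt (by omega : 1 < i + 2), Nat.succ_div_of_not_dvd]
      rw [Nat.dvd_iff_mod_eq_zero,
        Nat.add_mod_of_add_mod_lt (by rw [Nat.mod_eq_of_lt (by omega : 1 < i + 2)]; omega),
        Nat.mod_eq_of_lt (by omega : 1 < i + 2)]
      omega
    · have hd : (i + 2) ∣ (k + 1) := by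
        rw [Nat.dvd_iff_mod_eq_zero, Nat.add_mod, heq, Nat.mod_eq_of_lt (by omega : 1 < i + 2)]
        exact Nat.mod_self _
      rw [Nat.succ_div_of_dvd hd, Nat.mod_eq_zero_of_dvd hd, heq, ← orbitPoint_last H]
  have h3 := hasFDerivAt_billiardMap (r := linkLength i a y (k % (i + 2))) H.one_lt H.pos h1.mem
    (h1.pt.symm ▸ regular_orbitPoint H hε (hj k))
    (h2.pt.symm ▸ regular_orbitPoint H hε (hj (k + 1))) hlen
    (by rw [h2.pt, h1.pt, h1.dir, ← orbitPoint_succ H (hj k), hnext])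
  rwa [strength_orbit H hε (hj _) h2] at h3

/-- The flights at the segments amount to one free flight, up to a sign. -/
lemma flights_half (H : Closing i a h y) {r g : ℕ → ℝ}
    (hr : ∀ j ≤ i + 1, r j = linkLength i a y j)
    (hg : ∀ j ≤ i + 1, g j = if j = 0 ∨ j = i + 1 then ellipseStrength a y else 0) (w : ℝ × ℝ) :
    flights r g 0 (i + 2) w = (-1 : ℝ) ^ i •
      (flight ((2 * i + 2 * y) / (velocity a y).2) (ellipseStrength a y) ∘ₗ
        flight (2 * y) (ellipseStrength a y)) w := by
  have hv := H.velocity_pos.2.ne'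
  have key : ∀ n ≤ i, flights r g 0 (n + 1) w = (-1 : ℝ) ^ n •
      ((flight (2 * y) (ellipseStrength a y) w).1 + travel i y (n + 1) / (velocity a y).2 *
        (flight (2 * y) (ellipseStrength a y) w).2,
        (flight (2 * y) (ellipseStrength a y) w).2) := by
    intro n
    induction n with
    | zero =>
      intro _
      rw [flights_succ_apply, add_zero, hr 0 (by omega), hg 0 (by omega), if_pos (Or.inl rfl),
        linkLength, if_pos rfl, travel, if_pos le_rfl]
      simp [flights]
    | succ n ih =>
      intro hn
      rw [flights_succ_apply, ih (by omega), zero_add, hr _ (by omega), hg _ (by omega),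
        if_neg (by omega), linkLength, if_neg (by omega), travel_succ (j := n + 1) (by omega)
        (by omega), flight_apply]
      ext
      · simp only [Prod.smul_fst, Prod.smul_snd, smul_eq_mul]
        field_simp
        ring
      · simp only [Prod.smul_fst, Prod.smul_snd, smul_eq_mul]
        ring
  rw [flights_succ_apply, key i le_rfl, zero_add, hr _ le_rfl, hg _ le_rfl, if_pos (Or.inr rfl),
    linkLength, if_neg (by omega), ← travel_last (i := i), travel_succ (j := i + 1) (by omega)
    le_rfl, flight_apply, LinearMap.comp_apply,
    flight_apply ((travel i y (i + 1) + _) / _)]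
  ext
  · simp only [Prod.smul_fst, Prod.smul_snd, smul_eq_mul]
    field_simp
    ring
  · simp only [Prod.smul_fst, Prod.smul_snd, smul_eq_mul]
    field_simp
    ring

lemma injective_jacobi {z : ℝ × ℝ} (hz : z ∈ phaseSpace a h) :
    ∃ J : (ℝ × ℝ) →ₗ[ℝ] (ℝ × ℝ), Function.Injective J ∧ ∀ v, J v = jacobi a h z v := by
  have hc := (cos_pos_of_mem hz).ne'
  refine ⟨{ toFun := jacobi a h z, map_add' := ?_, map_smul' := ?_ }, ?_, fun v => rfl⟩
  · intro v w
    ext <;> simp [jacobi] <;> ring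
  · intro c v
    ext <;> simp [jacobi] <;> ring
  · intro v w hvw
    have h1 : jacobi a h z v = jacobi a h z w := hvw
    simp only [jacobi, Prod.mk.injEq] at h1
    have h2 : v.1 = w.1 := mul_left_cancel₀ hc h1.1
    have h3 := h1.2
    rw [h2] at h3
    exact Prod.ext h2 (by linarith)

/-- The trace of the monodromy of half a period is governed by the cubic polynomial. -/
lemma trace_eq (H : Closing i a h y) :
    2 - 2 * ellipseStrength a y * (2 * y + (2 * i + 2 * y) / (velocity a y).2) +
      ellipseStrength a y ^ 2 * (2 * y) * ((2 * i + 2 * y) / (velocity a y).2) =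
    2 - 16 * a ^ 2 * cubic i a y /
      (y * (1 + (a ^ 2 - 1) * y ^ 2) * ((a ^ 2 + 1) * y ^ 2 - 1)) := by
  have h1 := H.y_pos.ne'
  have h2 := (norm_pos H.one_lt y).ne'
  have h3 := H.den_pos.ne'
  have h4 : a ≠ 0 := by have := H.one_lt; positivity
  simp only [ellipseStrength, velocity, cubic]
  generalize hn : 1 + (a ^ 2 - 1) * y ^ 2 = n at *
  generalize hm : (a ^ 2 + 1) * y ^ 2 - 1 = m at *
  field_simp
  rw [← hn, ← hm]
  ring

lemma neg_two_lt_trace (H : Closing i a h y) :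
    16 * a ^ 2 * cubic i a y /
      (y * (1 + (a ^ 2 - 1) * y ^ 2) * ((a ^ 2 + 1) * y ^ 2 - 1)) < 4 := by
  have h1 := H.y_pos
  have h2 := norm_pos H.one_lt y
  have h3 := H.den_pos
  have h4 : a ≠ 0 := by have := H.one_lt; positivity
  have h5 := H.sq_lt
  have h6 := H.y_lt
  have h7 := H.one_lt
  rw [div_lt_iff₀ (by positivity)]
  have h8 : 16 * a ^ 2 * cubic i a y = 16 * a ^ 2 * y ^ 3 + 8 * i * (a ^ 2 - 1) * y ^ 2 -
      16 * y - 8 * i := by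
    rw [cubic]
    field_simp
    ring
  rw [h8]
  -- with `n = 1 + (a² - 1) y² < 2` and `m = (a² + 1) y² - 1 < 2`, the difference of the two sides
  -- is `4 (2 - n) (2 i + y (2 - m))`
  have h9 : 0 < 1 - (a ^ 2 - 1) * y ^ 2 := by nlinarith
  have h10 : 0 < 2 - ((a ^ 2 + 1) * y ^ 2 - 1) := by nlinarith
  have h11 : (0 : ℝ) ≤ i := Nat.cast_nonneg i
  have h12 : 0 < (1 - (a ^ 2 - 1) * y ^ 2) * (2 * i + y * (2 - ((a ^ 2 + 1) * y ^ 2 - 1))) := by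
    positivity
  nlinarith

lemma strength_mul_ne_two (H : Closing i a h y) :
    ellipseStrength a y * ((2 * i + 2 * y) / (velocity a y).2) ≠ 2 := by
  have h1 := H.y_pos
  have h2 := norm_pos H.one_lt y
  have h3 := H.den_pos
  have h5 := H.sq_lt
  have h6 := H.y_lt
  have h10 : 0 < 2 - ((a ^ 2 + 1) * y ^ 2 - 1) := by nlinarith
  have h11 : (0 : ℝ) ≤ i := Nat.cast_nonneg i
  have h7 : ellipseStrength a y * ((2 * i + 2 * y) / (velocity a y).2) =
      4 * (i + y) / (y * ((a ^ 2 + 1) * y ^ 2 - 1)) := by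
    simp only [ellipseStrength, velocity]
    generalize 1 + (a ^ 2 - 1) * y ^ 2 = n at *
    generalize (a ^ 2 + 1) * y ^ 2 - 1 = m at *
    field_simp
    ring
  rw [h7, ne_eq, div_eq_iff (by positivity)]
  nlinarith [mul_pos h1 h10]

/-- The type of the explicit orbit, at each of its points, is the sign of the cubic polynomial. -/
theorem orbit_type (H : Closing i a h y) (hε : ε = 1 ∨ ε = -1) {z : ℝ × ℝ}
    (hz : Represents a h z (abscissa a h y, -ε * y) (0, ε)) (k : ℕ) :
    ∃ A : ℝ × ℝ →L[ℝ] ℝ × ℝ,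
      HasFDerivAt (billiardMap a h)^[4 + 2 * i] A ((billiardMap a h)^[k] z) ∧
      (0 < cubic i a y → IsEllipticMap A) ∧ (cubic i a y < 0 → IsHyperbolicMap A) := by
  set r : ℕ → ℝ := fun k => linkLength i a y (k % (i + 2)) with hr
  set g : ℕ → ℝ := fun k => if (k + 1) % (i + 2) ≤ 1 then ellipseStrength a y else 0 with hg
  obtain ⟨A, hA, hA'⟩ := exists_hasFDerivAt_iterate (r := r) (g := g) (orbit_step H hε hz) k
    (4 + 2 * i)
  refine ⟨A, hA, ?_⟩
  have hper : (billiardMap a h)^[k + (4 + 2 * i)] z = (billiardMap a h)^[k] z := by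
    rw [Function.iterate_add_apply, orbit_periodic H hε hz]
  rw [hper] at hA'
  obtain ⟨J, hJ, hJ'⟩ := injective_jacobi (represents_orbit_mod H hε hz k).mem
  simp only [← hJ'] at hA'
  have hrp : ∀ k, r (k + (i + 2)) = r k := fun k => by simp [hr]
  have hgp : ∀ k, g (k + (i + 2)) = g k := fun k => by
    simp only [hg]
    rw [add_right_comm, Nat.add_mod_right]
  set F := flight ((2 * i + 2 * y) / (velocity a y).2) (ellipseStrength a y) ∘ₗ
        flight (2 * y) (ellipseStrength a y) with hF
  have hhalf : ∀ w, flights r g 0 (i + 2) w = (-1 : ℝ) ^ i • F w := by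
    refine flights_half H (fun j hj => ?_) (fun j hj => ?_)
    · simp only [hr]
      rw [Nat.mod_eq_of_lt (by omega)]
    · simp only [hg]
      rcases hj.eq_or_lt with rfl | hj'
      · simp
      · rw [Nat.mod_eq_of_lt (by omega)]
        congr 1
        apply propext
        omega
  have hsq : ∀ w, flights r g 0 (4 + 2 * i) w = F (F w) := by
    intro w
    rw [show 4 + 2 * i = (i + 2) + (i + 2) by ring, flights_add_apply, flights_periodic hrp hgp,
      hhalf, hhalf, map_smul, smul_smul, ← pow_add, ← two_mul, pow_mul]
    simp
  -- the monodromies at the point `k` and at the point `0` are conjugate by `Q`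
  set Q := LinearEquiv.ofInjectiveEndo _ (injective_flights r g 0 k) with hQ
  have hQv : ∀ w, Q w = flights r g 0 k w := fun w => rfl
  have hconj : ∀ w, flights r g k (4 + 2 * i) (Q w) = Q (F (F w)) := by
    intro w
    rw [hQv, hQv, ← hsq]
    have h1 := flights_add_apply r g 0 k (4 + 2 * i) w
    have h2 := flights_add_apply r g 0 (4 + 2 * i) k w
    rw [zero_add] at h1 h2
    rw [← h1, add_comm k, h2]
    have hrp2 : ∀ k, r (k + (4 + 2 * i)) = r k := fun k => by
      rw [show k + (4 + 2 * i) = k + (i + 2) + (i + 2) by ring, hrp, hrp]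
    have hgp2 : ∀ k, g (k + (4 + 2 * i)) = g k := fun k => by
      rw [show k + (4 + 2 * i) = k + (i + 2) + (i + 2) by ring, hgp, hgp]
    have h3 := flights_periodic hrp2 hgp2 0 k
    rw [zero_add] at h3
    rw [h3]
  set W := (LinearEquiv.ofInjectiveEndo J hJ).trans Q.symm with hW
  have hWv : ∀ v, W v = Q.symm (J v) := fun v => rfl
  have hWA : ∀ v, W (A v) = F (F (W v)) := by
    intro v
    rw [hWv, hWv, hA', LinearEquiv.symm_apply_eq, ← hconj, LinearEquiv.apply_symm_apply]
  have hg0 : ellipseStrength a y ≠ 0 := by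
    have h1 := H.y_pos
    have h2 := norm_pos H.one_lt y
    rw [ellipseStrength]
    positivity
  obtain ⟨he, hh⟩ := type_of_semiconj W hWA hg0 (strength_mul_ne_two H)
  rw [trace_eq H] at he hh
  have hlt := neg_two_lt_trace H
  have hden : 0 < y * (1 + (a ^ 2 - 1) * y ^ 2) * ((a ^ 2 + 1) * y ^ 2 - 1) :=
    mul_pos (mul_pos H.y_pos (norm_pos H.one_lt y)) H.den_pos
  have ha2 : 0 < 16 * a ^ 2 := by
    have := H.one_lt
    positivity
  refine ⟨fun hc => he ?_, fun hc => hh ?_⟩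
  · have : 0 < 16 * a ^ 2 * cubic i a y /
        (y * (1 + (a ^ 2 - 1) * y ^ 2) * ((a ^ 2 + 1) * y ^ 2 - 1)) :=
      div_pos (mul_pos ha2 hc) hden
    rw [abs_lt]
    constructor <;> linarith
  · have : 16 * a ^ 2 * cubic i a y /
        (y * (1 + (a ^ 2 - 1) * y ^ 2) * ((a ^ 2 + 1) * y ^ 2 - 1)) < 0 :=
      div_neg_of_neg_of_pos (mul_neg_of_pos_of_neg ha2 hc) hden
    rw [lt_abs]
    left
    linarith

end

/-! ### The explicit orbit is pantographic -/

section

variable {i : ℕ} {a h y ε : ℝ} {z : ℝ × ℝ}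

lemma impact_orbit (H : Closing i a h y) (hε : ε = 1 ∨ ε = -1)
    (hz : Represents a h z (abscissa a h y, -ε * y) (0, ε)) {m j : ℕ} (hj : j ≤ i + 2) :
    impact a h z (m * (i + 2) + j) = orbitPoint i a h y ε m j := by
  rcases hj.lt_or_eq with hj | rfl
  · exact (represents_orbit H hε hz m j (by omega)).pt
  · rw [orbitPoint_last H, ← (represents_orbit H hε hz (m + 1) 0 (by omega)).pt, impact]
    congr 3
    ring

/-- The orbit is invariant under a half-turn or the reflection in the `y`-axis, according to the
parity of `i`. -/
lemma impact_add_half (H : Closing i a h y) (hε : ε = 1 ∨ ε = -1)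
    (hz : Represents a h z (abscissa a h y, -ε * y) (0, ε)) (k : ℕ) :
    impact a h z (k + (i + 2)) = (-(impact a h z k).1, (-1) ^ i * (impact a h z k).2) := by
  have hj : k % (i + 2) ≤ i + 2 := (Nat.mod_lt k (by omega)).le
  have hk := Nat.div_add_mod k (i + 2)
  have h1 := impact_orbit H hε hz (m := k / (i + 2)) hj
  have h2 := impact_orbit H hε hz (m := k / (i + 2) + 1) hj
  rw [show k / (i + 2) * (i + 2) + k % (i + 2) = k by rw [mul_comm]; exact hk] at h1
  rw [show (k / (i + 2) + 1) * (i + 2) + k % (i + 2) = k + (i + 2) by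
    rw [add_mul, one_mul, mul_comm, add_right_comm, hk]] at h2
  rw [h1, h2, orbitPoint, orbitPoint]
  ext
  · simp only
    ring
  · simp only
    ring

lemma impact_add_period (H : Closing i a h y) (hε : ε = 1 ∨ ε = -1)
    (hz : Represents a h z (abscissa a h y, -ε * y) (0, ε)) (k : ℕ) :
    impact a h z (k + (4 + 2 * i)) = impact a h z k := by
  rw [impact, Function.iterate_add_apply, orbit_periodic H hε hz]
  rfl

lemma travel_symm {j : ℕ} (hj : 1 ≤ j) (hj' : j ≤ i + 2) :
    travel i y (i + 3 - j) = 2 * i + 2 * y - travel i y j := by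
  rcases hj.eq_or_lt with rfl | h1
  · rw [show i + 3 - 1 = i + 2 by omega, travel_last, travel, if_pos le_rfl, sub_zero]
  rcases hj'.eq_or_lt with rfl | h2
  · rw [show i + 3 - (i + 2) = 1 by omega, travel_last, travel, if_pos le_rfl, sub_self]
  · rw [travel, travel, if_neg (by omega), if_pos (by omega), if_neg (by omega), if_pos (by omega),
      Nat.cast_sub (by omega)]
    push_cast
    ring

lemma height_symm {j : ℕ} (hj' : j ≤ i + 2) :
    height i y (i + 3 - j) = height i y j := by
  rw [height, height]
  congr 1
  apply propext
  omega

/-- Travelled backwards, the orbit is the mirror image of itself in the `x`-axis. -/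
lemma impact_mirror (H : Closing i a h y) (hε : ε = 1 ∨ ε = -1)
    (hz : Represents a h z (abscissa a h y, -ε * y) (0, ε)) {k : ℕ} (hk : k ≤ 4 + 2 * i + 1) :
    impact a h z (4 + 2 * i + 1 - k) = ((impact a h z k).1, -(impact a h z k).2) := by
  have key : ∀ k, 1 ≤ k → k ≤ i + 2 →
      impact a h z (4 + 2 * i + 1 - k) = ((impact a h z k).1, -(impact a h z k).2) := by
    intro k hk1 hk2
    have h1 := impact_orbit H hε hz (m := 0) hk2
    have h2 := impact_orbit H hε hz (m := 1) (j := i + 3 - k) (by omega)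
    rw [zero_mul, zero_add] at h1
    rw [show 1 * (i + 2) + (i + 3 - k) = 4 + 2 * i + 1 - k by omega] at h2
    rw [h1, h2, orbitPoint, orbitPoint, travel_symm hk1 hk2, height_symm hk2,
      H.abscissa_eq, show 1 * (i + 2) + (i + 3 - k) = 4 + 2 * i + 1 - k by omega]
    have h3 : (-1 : ℝ) ^ (4 + 2 * i + 1 - k) = -(-1) ^ (0 * (i + 2) + k) := by
      have h4 : (-1 : ℝ) ^ (4 + 2 * i + 1 - k) * (-1) ^ k = -1 := by
        rw [← pow_add, Nat.sub_add_cancel (by omega), show 4 + 2 * i + 1 = 2 * (i + 2) + 1 by ring,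
          pow_succ, pow_mul]
        simp
      have h5 : (-1 : ℝ) ^ k * (-1) ^ k = 1 := by
        rw [← pow_add, ← two_mul, pow_mul]
        simp
      rw [zero_mul, zero_add]
      linear_combination (-1 : ℝ) ^ k * h4 - (-1 : ℝ) ^ (4 + 2 * i + 1 - k) * h5
    rw [h3]
    ext
    · simp only
      ring
    · simp only
      ring
  have key0 : impact a h z 1 = ((impact a h z 0).1, -(impact a h z 0).2) := by
    have h0 := impact_orbit H hε hz (m := 0) (j := 0) (by omega)
    have h1 := impact_orbit H hε hz (m := 0) (j := 1) (by omega)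
    simp only [zero_mul, zero_add] at h0 h1
    rw [h0, h1, orbitPoint_of_le_one zero_le_one, orbitPoint_of_le_one le_rfl]
    simp
  rcases Nat.eq_zero_or_pos k with rfl | h1
  · rw [Nat.sub_zero, add_comm, impact_add_period H hε hz, key0]
  rcases le_or_gt k (i + 2) with h2 | h2
  · exact key k h1 h2
  rcases hk.lt_or_eq with h3 | h3
  · have h4 := key (4 + 2 * i + 1 - k) (by omega) (by omega)
    rw [Nat.sub_sub_self hk] at h4
    rw [h4]
    simp
  · rw [h3, Nat.sub_self, add_comm, impact_add_period H hε hz, key0]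
    simp

lemma impact_fst_of_lt (H : Closing i a h y) (hε : ε = 1 ∨ ε = -1)
    (hz : Represents a h z (abscissa a h y, -ε * y) (0, ε)) {j : ℕ} (hj : j ≤ i + 2) :
    impact a h z j = (abscissa a h y - slope a y * travel i y j,
      -(ε * (-1) ^ j) * height i y j) := by
  have h1 := impact_orbit H hε hz (m := 0) hj
  rw [zero_mul, zero_add] at h1
  rw [h1, orbitPoint]
  simp

/-- In the first half-period, the impacts `0`, `1` are on the right, the others at the segments. -/
lemma impact_position (H : Closing i a h y) (hε : ε = 1 ∨ ε = -1)
    (hz : Represents a h z (abscissa a h y, -ε * y) (0, ε)) {j : ℕ} (hj : j < i + 2) :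
    (j ≤ 1 ∧ h < (impact a h z j).1) ∨ (2 ≤ j ∧ |(impact a h z j).1| < h) := by
  rw [impact_fst_of_lt H hε hz hj.le]
  rcases le_or_gt j 1 with h1 | h1
  · left
    rw [travel, if_pos h1, mul_zero, sub_zero]
    exact ⟨h1, lt_abscissa H.one_lt H.y_pos H.y_lt⟩
  · exact Or.inr ⟨h1, H.abs_lt h1 (by omega)⟩

/-- The impacts of the period, on the right, at the segments, and on the left. -/
lemma impact_position_period (H : Closing i a h y) (hε : ε = 1 ∨ ε = -1)
    (hz : Represents a h z (abscissa a h y, -ε * y) (0, ε)) {k : ℕ} (hk : k < 4 + 2 * i) :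
    (k ≤ 1 ∧ h < (impact a h z k).1) ∨
      ((2 ≤ k ∧ k ≤ i + 1 ∨ i + 4 ≤ k) ∧ |(impact a h z k).1| < h) ∨
      ((k = i + 2 ∨ k = i + 3) ∧ (impact a h z k).1 < -h) := by
  rcases lt_or_ge k (i + 2) with h1 | h1
  · rcases impact_position H hε hz h1 with h2 | h2
    · exact Or.inl h2
    · exact Or.inr (Or.inl ⟨Or.inl ⟨h2.1, by omega⟩, h2.2⟩)
  · obtain ⟨j, rfl⟩ := Nat.exists_eq_add_of_le' h1
    rw [impact_add_half H hε hz]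
    rcases impact_position H hε hz (by omega : j < i + 2) with h2 | h2
    · exact Or.inr (Or.inr ⟨by omega, neg_lt_neg h2.2⟩)
    · exact Or.inr (Or.inl ⟨Or.inr (by omega), by simpa using h2.2⟩)

lemma impact_snd (H : Closing i a h y) (hε : ε = 1 ∨ ε = -1)
    (hz : Represents a h z (abscissa a h y, -ε * y) (0, ε)) (k : ℕ) :
    (impact a h z k).2 = -(ε * (-1) ^ k) * height i y (k % (i + 2)) := by
  have h1 := represents_orbit_mod H hε hz k
  rw [impact, h1.pt, orbitPoint, mul_comm (k / (i + 2)), Nat.div_add_mod]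

lemma segment_card (H : Closing i a h y)
    (hz : Represents a h z (abscissa a h y, -1 * y) (0, 1)) {σ : ℝ} (hσ : σ = 1 ∨ σ = -1) :
    Set.ncard {k : ℕ | k < 4 + 2 * i ∧ |(impact a h z k).1| < h ∧ (impact a h z k).2 = σ} = i := by
  have hε : (1 : ℝ) = 1 ∨ (1 : ℝ) = -1 := Or.inl rfl
  -- of the two impacts `j`, `2 i + 5 - j` which are mirror images in the `x`-axis, one belongs to
  -- the given segment
  let f : ℕ → ℕ := fun j => if (-1 : ℝ) ^ j = -σ then j else 2 * i + 5 - j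
  have himage : {k : ℕ | k < 4 + 2 * i ∧ |(impact a h z k).1| < h ∧ (impact a h z k).2 = σ} =
      f '' Set.Icc 2 (i + 1) := by
    have hpar : ∀ k ≤ 2 * i + 5, (-1 : ℝ) ^ (2 * i + 5 - k) = -(-1) ^ k := by
      intro k hk
      rw [show 2 * i + 5 - k = 2 * i + 5 - k by rfl]
      rcases Nat.even_or_odd k with he | ho
      · rw [he.neg_one_pow, Odd.neg_one_pow]
        rw [Nat.odd_sub hk]
        have : Odd (2 * i + 5) := ⟨i + 2, by ring⟩
        simp [this, he]
      · rw [ho.neg_one_pow, Even.neg_one_pow, neg_neg]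
        rw [Nat.even_sub hk]
        have h1 : ¬ Even (2 * i + 5) := by
          rw [Nat.not_even_iff_odd]
          exact ⟨i + 2, by ring⟩
        have h2 : ¬ Even k := Nat.not_even_iff_odd.2 ho
        simp [h1, h2]
    have hflat : ∀ k < 4 + 2 * i, (2 ≤ k ∧ k ≤ i + 1 ∨ i + 4 ≤ k) →
        |(impact a h z k).1| < h ∧ ((impact a h z k).2 = σ ↔ (-1 : ℝ) ^ k = -σ) := by
      intro k hk hk'
      have h1 := impact_position_period H hε hz hk
      have h2 : |(impact a h z k).1| < h := by
        rcases h1 with h1 | h1 | h1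
        · omega
        · exact h1.2
        · omega
      refine ⟨h2, ?_⟩
      have h3 : height i y (k % (i + 2)) = 1 := by
        have h4 : 2 ≤ k % (i + 2) ∧ k % (i + 2) ≤ i + 1 := by
          rcases hk' with hk' | hk'
          · rw [Nat.mod_eq_of_lt (by omega)]
            exact hk'
          · rw [Nat.mod_eq_sub_mod (by omega), Nat.mod_eq_of_lt (by omega)]
            omega
        rw [height, if_pos h4]
      rw [impact_snd H hε hz, h3]
      constructor <;> intro h5 <;> linarith
    ext k
    simp only [Set.mem_ofPred_eq, Set.mem_image, Set.mem_Icc]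
    constructor
    · rintro ⟨hk, hk1, hk2⟩
      have h1 : 2 ≤ k ∧ k ≤ i + 1 ∨ i + 4 ≤ k := by
        rcases impact_position_period H hε hz hk with h1 | h1 | h1
        · have := (abs_lt.1 hk1).2
          linarith [h1.2]
        · exact h1.1
        · have := (abs_lt.1 hk1).1
          linarith [h1.2]
      have h2 := (hflat k hk h1).2.1 hk2
      rcases h1 with h1 | h1
      · exact ⟨k, h1, if_pos h2⟩
      · refine ⟨2 * i + 5 - k, by omega, ?_⟩
        have h3 : ¬ (-1 : ℝ) ^ (2 * i + 5 - k) = -σ := by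
          rw [hpar k (by omega), h2]
          rcases hσ with rfl | rfl <;> norm_num
        simp only [f]
        rw [if_neg h3]
        omega
    · rintro ⟨j, hj, rfl⟩
      by_cases hs : (-1 : ℝ) ^ j = -σ
      · simp only [f]
        rw [if_pos hs]
        have h1 := hflat j (by omega) (Or.inl hj)
        exact ⟨by omega, h1.1, h1.2.2 hs⟩
      · simp only [f]
        rw [if_neg hs]
        have h1 := hflat (2 * i + 5 - j) (by omega) (Or.inr (by omega))
        refine ⟨by omega, h1.1, h1.2.2 ?_⟩
        rw [hpar j (by omega)]
        rcases hσ with rfl | rfl <;> rcases sign_pow j with h2 | h2 <;> simp_all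
  have hinj : Set.InjOn f (Set.Icc 2 (i + 1)) := by
    intro j hj k hk hjk
    simp only [Set.mem_Icc] at hj hk
    simp only [f] at hjk
    split_ifs at hjk <;> omega
  rw [himage, hinj.ncard_image, ← Finset.coe_Icc, Set.ncard_coe_finset, Nat.card_Icc]
  omega

lemma travel_le_iff (hy : 0 < y) {j : ℕ} (hj : 1 ≤ j) (hj' : j ≤ i + 2) :
    0 ≤ i + y - travel i y j ↔ 2 * j ≤ i + 3 := by
  have hi : (0 : ℝ) ≤ i := Nat.cast_nonneg i
  rcases hj.eq_or_lt with rfl | h1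
  · rw [travel, if_pos le_rfl]
    exact ⟨fun _ => by omega, fun _ => by linarith⟩
  rcases hj'.eq_or_lt with rfl | h2
  · rw [travel_last]
    exact ⟨fun h => by linarith, fun h => by omega⟩
  · rw [travel, if_neg (by omega), if_pos (by omega)]
    constructor
    · intro h3
      have : (2 : ℝ) * j ≤ i + 3 := by linarith
      exact_mod_cast this
    · intro h3
      have : (2 : ℝ) * j ≤ i + 3 := by exact_mod_cast h3
      linarith

/-- In a half-period, the `y`-axis is met exactly once. -/
lemma crossing_half (H : Closing i a h y) : ∃ k₀ < i + 2, ∃ τ₀ : ℝ, ∀ j < i + 2, ∀ τ : ℝ,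
    (0 ≤ τ ∧ τ < 1 ∧ (1 - τ) * (abscissa a h y - slope a y * travel i y j) +
      τ * (abscissa a h y - slope a y * travel i y (j + 1)) = 0) ↔ j = k₀ ∧ τ = τ₀ := by
  set g : ℕ → ℝ := fun j => i + y - travel i y j with hg
  have hs := H.slope_pos
  have hx : ∀ j, abscissa a h y - slope a y * travel i y j = slope a y * g j := by
    intro j
    rw [H.abscissa_eq, hg]
    ring
  have heq : ∀ j τ, (1 - τ) * (abscissa a h y - slope a y * travel i y j) +
      τ * (abscissa a h y - slope a y * travel i y (j + 1)) = 0 ↔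
      (1 - τ) * g j + τ * g (j + 1) = 0 := by
    intro j τ
    rw [hx, hx, show (1 - τ) * (slope a y * g j) + τ * (slope a y * g (j + 1)) =
      slope a y * ((1 - τ) * g j + τ * g (j + 1)) by ring, mul_eq_zero, or_iff_right hs.ne']
  have hdec : ∀ j, 1 ≤ j → j < i + 2 → g (j + 1) < g j := by
    intro j h1 h2
    have h3 := height_pos (i := i) H.y_pos j
    have h4 := height_pos (i := i) H.y_pos (j + 1)
    simp only [hg]
    rw [travel_succ h1 (by omega)]
    linarith
  set k₀ := (i + 3) / 2 with hk₀
  have hk1 : 1 ≤ k₀ := by omega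
  have hk2 : k₀ < i + 2 := by omega
  have hpos : 0 ≤ g k₀ := (travel_le_iff H.y_pos hk1 hk2.le).2 (by omega)
  have hneg : g (k₀ + 1) < 0 := by
    rw [← not_le]
    exact fun h1 => by
      have := (travel_le_iff H.y_pos (by omega : 1 ≤ k₀ + 1) (by omega)).1 h1
      omega
  refine ⟨k₀, hk2, g k₀ / (g k₀ - g (k₀ + 1)), fun j hj τ => ?_⟩
  rw [heq]
  have hd : 0 < g k₀ - g (k₀ + 1) := by linarith
  constructor
  · rintro ⟨h0, h1, h2⟩
    have hj1 : 1 ≤ j := by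
      by_contra hcon
      have hj0 : j = 0 := by omega
      subst hj0
      simp [hg, travel] at h2
      have := H.y_pos
      have hi : (0 : ℝ) ≤ i := Nat.cast_nonneg i
      nlinarith
    have h3 := hdec j hj1 hj
    have h4 : 0 ≤ g j := by
      by_contra hcon
      nlinarith
    have h5 : ¬ 0 ≤ g (j + 1) := by
      intro hcon
      nlinarith
    have h6 := (travel_le_iff H.y_pos hj1 hj.le).1 h4
    have h7 : ¬ 2 * (j + 1) ≤ i + 3 := fun h8 =>
      h5 ((travel_le_iff H.y_pos (by omega) (by omega)).2 h8)
    have h8 : j = k₀ := by omega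
    subst h8
    refine ⟨rfl, ?_⟩
    rw [eq_div_iff hd.ne']
    linarith
  · rintro ⟨rfl, rfl⟩
    refine ⟨div_nonneg hpos hd.le, ?_, ?_⟩
    · rw [div_lt_one hd]
      linarith
    · field_simp
      ring

lemma crossings_card (H : Closing i a h y) (hε : ε = 1 ∨ ε = -1)
    (hz : Represents a h z (abscissa a h y, -ε * y) (0, ε)) :
    Set.ncard {q : ℕ × ℝ | q.1 < 4 + 2 * i ∧ 0 ≤ q.2 ∧ q.2 < 1 ∧
      (1 - q.2) * (impact a h z q.1).1 + q.2 * (impact a h z (q.1 + 1)).1 = 0} = 2 := by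
  obtain ⟨k₀, hk₀, τ₀, hiff⟩ := crossing_half H
  have himp : ∀ j < i + 2, ∀ τ : ℝ, (0 ≤ τ ∧ τ < 1 ∧ (1 - τ) * (impact a h z j).1 +
      τ * (impact a h z (j + 1)).1 = 0) ↔ j = k₀ ∧ τ = τ₀ := by
    intro j hj τ
    rw [impact_fst_of_lt H hε hz hj.le, impact_fst_of_lt H hε hz (by omega : j + 1 ≤ i + 2)]
    exact hiff j hj τ
  have hset : {q : ℕ × ℝ | q.1 < 4 + 2 * i ∧ 0 ≤ q.2 ∧ q.2 < 1 ∧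
      (1 - q.2) * (impact a h z q.1).1 + q.2 * (impact a h z (q.1 + 1)).1 = 0} =
      {(k₀, τ₀), (k₀ + (i + 2), τ₀)} := by
    ext ⟨k, τ⟩
    simp only [Set.mem_ofPred_eq, Set.mem_insert_iff, Set.mem_singleton_iff, Prod.mk.injEq]
    rcases lt_or_ge k (i + 2) with h1 | h1
    · rw [himp k h1 τ]
      constructor
      · exact fun h2 => Or.inl h2.2
      · rintro (h2 | h2)
        · exact ⟨by omega, h2⟩
        · omega
    · obtain ⟨j, rfl⟩ := Nat.exists_eq_add_of_le' h1
      rw [add_right_comm, impact_add_half H hε hz, impact_add_half H hε hz]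
      have h3 : (1 - τ) * -(impact a h z j).1 + τ * -(impact a h z (j + 1)).1 = 0 ↔
          (1 - τ) * (impact a h z j).1 + τ * (impact a h z (j + 1)).1 = 0 := by
        constructor <;> intro h4 <;> linarith
      simp only [h3]
      constructor
      · rintro ⟨h2, h4⟩
        have h5 := (himp j (by omega) τ).1 h4
        exact Or.inr ⟨by omega, h5.2⟩
      · rintro (h2 | h2)
        · omega
        · exact ⟨by omega, (himp j (by omega) τ).2 ⟨by omega, h2.2⟩⟩
  rw [hset, Set.ncard_pair]
  intro h1
  simp at h1

/-- The explicit orbit, started with the upward vertical link on the right, is pantographic. -/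
theorem isPantographic_orbit (H : Closing i a h y)
    (hz : Represents a h z (abscissa a h y, -1 * y) (0, 1)) : IsPantographic i a h z := by
  have hε : (1 : ℝ) = 1 ∨ (1 : ℝ) = -1 := Or.inl rfl
  have hmirror := fun {k : ℕ} (hk : k ≤ 4 + 2 * i + 1) => impact_mirror H hε hz hk
  have hright : {k : ℕ | k < 4 + 2 * i ∧ h < (impact a h z k).1} = {0, 1} := by
    ext k
    simp only [Set.mem_ofPred_eq, Set.mem_insert_iff, Set.mem_singleton_iff]
    constructor
    · rintro ⟨h1, h2⟩
      rcases impact_position_period H hε hz h1 with h3 | h3 | h3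
      · omega
      · have := (abs_lt.1 h3.2).2
        linarith
      · have := H.pos
        linarith [h3.2]
    · intro h1
      have h2 : k < 4 + 2 * i := by omega
      rcases impact_position_period H hε hz h2 with h3 | h3 | h3
      · exact ⟨h2, h3.2⟩
      · omega
      · omega
  have hleft : {k : ℕ | k < 4 + 2 * i ∧ (impact a h z k).1 < -h} = {i + 2, i + 3} := by
    ext k
    simp only [Set.mem_ofPred_eq, Set.mem_insert_iff, Set.mem_singleton_iff]
    constructor
    · rintro ⟨h1, h2⟩
      rcases impact_position_period H hε hz h1 with h3 | h3 | h3
      · have := H.pos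
        linarith [h3.2]
      · have := (abs_lt.1 h3.2).1
        linarith
      · exact h3.1
    · intro h1
      have h2 : k < 4 + 2 * i := by omega
      rcases impact_position_period H hε hz h2 with h3 | h3 | h3
      · omega
      · omega
      · exact ⟨h2, h3.2⟩
  have halt : ∀ k : ℕ, (impact a h z k).2 * (impact a h z (k + 1)).2 < 0 := by
    intro k
    rw [impact_snd H hε hz, impact_snd H hε hz]
    have h1 := height_pos (i := i) H.y_pos (k % (i + 2))
    have h2 := height_pos (i := i) H.y_pos ((k + 1) % (i + 2))
    have h3 := mul_pos h1 h2
    rw [pow_succ]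
    rcases sign_pow k with h4 | h4 <;> rw [h4] <;> linarith
  -- the links of the period with a given index
  have hred : ∀ k, impact a h z k = impact a h z (k % (4 + 2 * i)) ∧
      impact a h z (k + 1) = impact a h z (k % (4 + 2 * i) + 1) := by
    have h1 : ∀ n k, impact a h z (k + (4 + 2 * i) * n) = impact a h z k := by
      intro n
      induction n with
      | zero => intro k; rfl
      | succ n ih =>
        intro k
        rw [Nat.mul_succ, ← add_assoc, impact_add_period H hε hz, ih]
    intro k
    have h2 := h1 (k / (4 + 2 * i)) (k % (4 + 2 * i))
    have h3 := h1 (k / (4 + 2 * i)) (k % (4 + 2 * i) + 1)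
    rw [Nat.mod_add_div] at h2
    rw [add_right_comm, Nat.mod_add_div] at h3
    exact ⟨h2, h3⟩
  have hmlt : ∀ k, k % (4 + 2 * i) < 4 + 2 * i := fun k => Nat.mod_lt k (by omega)
  have h01 : (impact a h z 1).1 = (impact a h z 0).1 := by
    rw [impact_fst_of_lt H hε hz (by omega), impact_fst_of_lt H hε hz (by omega)]
    simp [travel]
  have hX := lt_abscissa (h := h) H.one_lt H.y_pos H.y_lt
  have h0 : h < (impact a h z 0).1 := by
    have : (0 : ℕ) ∈ {k : ℕ | k < 4 + 2 * i ∧ h < (impact a h z k).1} := by rw [hright]; simp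
    exact this.2
  refine
    { mem := hz.mem
      period := ?_
      symm_x := ?_
      symm_y := ?_
      alternating := halt
      right_card := by rw [hright, Set.ncard_pair (by omega)]
      right_vertical := ⟨0, h0, h01⟩
      left_card := by rw [hleft, Set.ncard_pair (by omega)]
      left_vertical := ⟨0 + (i + 2), ?_, ?_⟩
      upper_card := segment_card H hz (Or.inl rfl)
      lower_card := segment_card H hz (Or.inr rfl)
      crossings := crossings_card H hε hz }
  · have hper : Function.IsPeriodicPt (billiardMap a h) (4 + 2 * i) z := orbit_periodic H hε hz
    have hle := Nat.le_of_dvd (by omega) hper.minimalPeriod_dvd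
    have hpos := hper.minimalPeriod_pos (by omega)
    refine hle.antisymm (not_lt.1 fun hlt => ?_)
    set p := Function.minimalPeriod (billiardMap a h) z with hp
    have hip : impact a h z p = impact a h z 0 := by
      rw [impact, hp, Function.iterate_minimalPeriod]
      rfl
    have hmem : p ∈ {k : ℕ | k < 4 + 2 * i ∧ h < (impact a h z k).1} :=
      ⟨hlt, by rw [hip]; exact h0⟩
    rw [hright] at hmem
    have hp1 : p = 1 := by
      rcases hmem with h1 | h1
      · omega
      · exact h1
    have h2 := halt 0
    rw [zero_add, ← hp1, hip] at h2
    nlinarith [mul_self_nonneg (impact a h z 0).2]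
  · intro k
    refine ⟨4 + 2 * i - k % (4 + 2 * i), Or.inr ?_⟩
    have hk := hmlt k
    have h1 := hmirror (k := k % (4 + 2 * i)) (by omega)
    have h2 := hmirror (k := k % (4 + 2 * i) + 1) (by omega)
    rw [(hred k).1, (hred k).2]
    simp only
    rw [← h1, ← h2]
    constructor <;> congr 1 <;> omega
  · intro k
    have hk := hmlt k
    rcases Nat.even_or_odd i with he | ho
    · refine ⟨k + (i + 2), Or.inl ?_⟩
      rw [impact_add_half H hε hz, add_right_comm, impact_add_half H hε hz, he.neg_one_pow]
      simp
    · refine ⟨4 + 2 * i - k % (4 + 2 * i) + (i + 2), Or.inr ?_⟩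
      rw [add_right_comm, impact_add_half H hε hz, impact_add_half H hε hz,
        show 4 + 2 * i - k % (4 + 2 * i) + 1 = 4 + 2 * i + 1 - k % (4 + 2 * i) by omega,
        show 4 + 2 * i - k % (4 + 2 * i) = 4 + 2 * i + 1 - (k % (4 + 2 * i) + 1) by omega,
        hmirror (by omega), hmirror (by omega), ho.neg_one_pow, (hred k).1, (hred k).2]
      simp
  · rw [impact_add_half H hε hz]
    exact neg_lt_neg h0
  · rw [add_right_comm, impact_add_half H hε hz, impact_add_half H hε hz, zero_add, h01]

end

/-! ### Every pantographic orbit is explicit -/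

lemma mod_ne_of_lt {k l n : ℕ} (h1 : k < l) (h2 : l < k + n) : l % n ≠ k % n := by
  intro h
  have h3 : n ∣ l - k := (Nat.modEq_iff_dvd' h1.le).1 h.symm
  have := Nat.le_of_dvd (by omega) h3
  omega

lemma exists_mod_eq {n : ℕ} (hn : 0 < n) (k l : ℕ) : ∃ m, k ≤ m ∧ m < k + n ∧ m % n = l % n := by
  refine ⟨k + (l + k * (n - 1)) % n, by omega, ?_, ?_⟩
  · have := Nat.mod_lt (l + k * (n - 1)) hn
    omega
  · obtain ⟨n, rfl⟩ := Nat.exists_eq_succ_of_ne_zero hn.ne'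
    rw [Nat.add_mod_mod, Nat.succ_sub_one, show k + (l + k * n) = l + n.succ * k by
      rw [Nat.succ_eq_add_one]; ring, Nat.add_mul_mod_self_left]

/-- If a periodic property holds at exactly two instants in a period, and at two consecutive
instants, then it holds at these instants only. -/
lemma mod_eq_of_card_two {n : ℕ} (hn : 2 ≤ n) {P : ℕ → Prop} (hper : ∀ k, P (k % n) ↔ P k)
    (hcard : Set.ncard {k | k < n ∧ P k} = 2) {k₀ : ℕ} (h0 : P k₀) (h1 : P (k₀ + 1)) {k : ℕ}
    (hk : P k) : k % n = k₀ % n ∨ k % n = (k₀ + 1) % n := by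
  have hmem : ∀ l, P l → l % n ∈ {k | k < n ∧ P k} :=
    fun l hl => ⟨Nat.mod_lt l (by omega), (hper l).2 hl⟩
  have hne : (k₀ + 1) % n ≠ k₀ % n := mod_ne_of_lt (by omega) (by omega)
  obtain ⟨u, v, -, huv⟩ := Set.ncard_eq_two.1 hcard
  have m0 := hmem k₀ h0
  have m1 := hmem _ h1
  have m2 := hmem k hk
  rw [huv] at m0 m1 m2
  simp only [Set.mem_insert_iff, Set.mem_singleton_iff] at m0 m1 m2
  omega

/-- An orbit in the billiard table which avoids the joints and alternates between the upper and the
lower half-plane, described by its impact points `p` and directions `d`. -/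
structure IsChain (a h : ℝ) (p d : ℕ → ℝ × ℝ) : Prop where
  one_lt : 1 < a
  pos : 0 < h
  regular : ∀ k, Regular a h (p k)
  unit : ∀ k, dot (d k) (d k) = 1
  link : ∀ k, ∃ r : ℝ, 0 < r ∧ p (k + 1) = p k + r • d k
  dir_succ : ∀ k, d (k + 1) = reflect a h (p (k + 1)) (d k)
  alternating : ∀ k, (p k).2 * (p (k + 1)).2 < 0

section

variable {a h y α β : ℝ} {p d : ℕ → ℝ × ℝ}

/-- A vertical link between two points of a half-ellipse, and the motion after it. -/
lemma IsChain.vertical (C : IsChain a h p d) {k : ℕ} (hy0 : 0 < y) (hy1 : y < 1)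
    (hα : α = 1 ∨ α = -1) (h1 : (p k).1 = α * abscissa a h y)
    (h2 : (p (k + 1)).1 = α * abscissa a h y) (h3 : (p k).2 ^ 2 = y ^ 2)
    (h4 : (p (k + 1)).2 ^ 2 = y ^ 2) :
    ∃ β : ℝ, (β = 1 ∨ β = -1) ∧ p k = (α * abscissa a h y, -β * y) ∧ d k = (0, β) ∧
      p (k + 1) = (α * abscissa a h y, β * y) ∧
      d (k + 1) = (-α * (velocity a y).1, -β * (velocity a y).2) := by
  have halt := C.alternating k
  obtain ⟨β, hβ, hβ1⟩ : ∃ β : ℝ, (β = 1 ∨ β = -1) ∧ (p (k + 1)).2 = β * y := by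
    rcases sq_eq_sq_iff_eq_or_eq_neg.1 h4 with h5 | h5
    · exact ⟨1, Or.inl rfl, by rw [h5, one_mul]⟩
    · exact ⟨-1, Or.inr rfl, by rw [h5, neg_one_mul]⟩
  have hβ2 : β ^ 2 = 1 := sq_eq_one_iff.2 hβ
  have hβ0 : (p k).2 = -β * y := by
    rcases sq_eq_sq_iff_eq_or_eq_neg.1 h3 with h5 | h5 <;> rcases hβ with rfl | rfl <;>
      rw [h5, hβ1] at halt <;> nlinarith
  have e0 : p k = (α * abscissa a h y, -β * y) := Prod.ext h1 hβ0
  have e1 : p (k + 1) = (α * abscissa a h y, β * y) := Prod.ext h2 hβ1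
  obtain ⟨r, hr, hlink⟩ := C.link k
  have hd : d k = (0, β) := by
    have h5 := congrArg Prod.fst hlink
    have h6 := congrArg Prod.snd hlink
    have h7 := C.unit k
    simp only [Prod.fst_add, Prod.snd_add, Prod.smul_fst, Prod.smul_snd, smul_eq_mul] at h5 h6
    rw [h1, h2] at h5
    rw [hβ0, hβ1] at h6
    have h8 : (d k).1 = 0 := by
      have : r * (d k).1 = 0 := by linarith
      exact (mul_eq_zero.1 this).resolve_left hr.ne'
    refine Prod.ext h8 ?_
    rw [dot, h8] at h7
    have h9 : (d k).2 ^ 2 = 1 := by linarith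
    rcases sq_eq_one_iff.1 h9 with h10 | h10 <;> rcases hβ with rfl | rfl <;>
      rw [h10] at h6 ⊢ <;> nlinarith
  refine ⟨β, hβ, e0, hd, e1, ?_⟩
  rw [C.dir_succ, hd, e1, reflect_vertical C.one_lt C.pos hy0 hy1 hα hβ]

/-- The horizontal and the vertical distance travelled between the two half-ellipses. -/
lemma IsChain.traverse (C : IsChain a h p d) {m q : ℕ} (hy0 : 0 < y)
    (hβ : β = 1 ∨ β = -1)
    (hp : p m = (α * abscissa a h y, β * y))
    (hd : d m = (-α * (velocity a y).1, -β * (velocity a y).2))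
    (hseg : ∀ j, 1 ≤ j → j ≤ q → |(p (m + j)).1| < h ∧ (p (m + j)).2 ^ 2 = 1)
    (hlast1 : (p (m + q + 1)).1 = -α * abscissa a h y)
    (hlast2 : (p (m + q + 1)).2 ^ 2 = y ^ 2) (hα : α = 1 ∨ α = -1) :
    0 < (velocity a y).2 ∧
      abscissa a h y * (velocity a y).2 = (velocity a y).1 * (q + y) := by
  have hα2 : α ^ 2 = 1 := sq_eq_one_iff.2 hα
  -- one link, in the vertical direction
  have hstep : ∀ k (σ w w' : ℝ), (σ = 1 ∨ σ = -1) → 0 < w → 0 ≤ w' →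
      (p k).2 = σ * w → d k = (-α * (velocity a y).1, -σ * (velocity a y).2) →
      (p (k + 1)).2 ^ 2 = w' ^ 2 → (p (k + 1)).2 = -σ * w' ∧ 0 < (velocity a y).2 ∧
        (p (k + 1)).1 * (velocity a y).2 =
          (p k).1 * (velocity a y).2 - α * (velocity a y).1 * (w + w') := by
    intro k σ w w' hσ hw hw' h1 h2 h3
    have hσ2 : σ ^ 2 = 1 := sq_eq_one_iff.2 hσ
    have halt := C.alternating k
    have h4 : (p (k + 1)).2 = -σ * w' := by
      rcases sq_eq_sq_iff_eq_or_eq_neg.1 h3 with h5 | h5 <;> rcases hσ with rfl | rfl <;>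
        rw [h1, h5] at halt <;> nlinarith
    obtain ⟨r, hr, hlink⟩ := C.link k
    have h5 := congrArg Prod.fst hlink
    have h6 := congrArg Prod.snd hlink
    simp only [Prod.fst_add, Prod.snd_add, Prod.smul_fst, Prod.smul_snd, smul_eq_mul, h2] at h5 h6
    rw [h4, h1] at h6
    have h7 : r * (velocity a y).2 = w + w' := by
      linear_combination σ * h6 + (w + w' - r * (velocity a y).2) * hσ2
    refine ⟨h4, ?_, ?_⟩
    · by_contra hcon
      nlinarith
    · rw [h5]
      linear_combination (-α) * (velocity a y).1 * h7
  have hind : ∀ j ≤ q, ∃ σ w : ℝ, (σ = 1 ∨ σ = -1) ∧ 0 < w ∧ (p (m + j)).2 = σ * w ∧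
      d (m + j) = (-α * (velocity a y).1, -σ * (velocity a y).2) ∧
      (p (m + j)).1 * (velocity a y).2 =
        α * abscissa a h y * (velocity a y).2 - α * (velocity a y).1 * (2 * j + y - w) := by
    intro j
    induction j with
    | zero =>
      intro _
      refine ⟨β, y, hβ, hy0, by rw [add_zero, hp], hd, ?_⟩
      rw [add_zero, hp]
      simp
    | succ j ih =>
      intro hj
      obtain ⟨σ, w, hσ, hw, h1, h2, h3⟩ := ih (by omega)
      obtain ⟨h4, h5⟩ := hseg (j + 1) (by omega) hj
      rw [← add_assoc] at h4 h5
      obtain ⟨h6, -, h7⟩ := hstep (m + j) σ w 1 hσ hw zero_le_one h1 h2 (by rw [h5, one_pow])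
      refine ⟨-σ, 1, neg_sign hσ, one_pos, h6, ?_, ?_⟩
      · rw [← add_assoc, C.dir_succ, h2]
        have h8 : p (m + j + 1) = ((p (m + j + 1)).1, -σ) := Prod.ext rfl (by rw [h6, mul_one])
        rw [h8, reflect_segment h4 (sq_eq_one_iff.2 (neg_sign hσ))]
        simp
      · rw [← add_assoc, h7, h3]
        push_cast
        ring
  obtain ⟨σ, w, hσ, hw, h1, h2, h3⟩ := hind q le_rfl
  obtain ⟨-, h6, h7⟩ := hstep (m + q) σ w y hσ hw hy0.le h1 h2 hlast2
  refine ⟨h6, ?_⟩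
  rw [hlast1, h3] at h7
  rcases hα with rfl | rfl <;> linarith

end

section

variable {i : ℕ} {a h : ℝ} {z : ℝ × ℝ}

lemma IsPantographic.isPeriodicPt (P : IsPantographic i a h z) :
    Function.IsPeriodicPt (billiardMap a h) (4 + 2 * i) z :=
  P.period ▸ Function.isPeriodicPt_minimalPeriod _ _

lemma IsPantographic.impact_mod (P : IsPantographic i a h z) (k : ℕ) :
    impact a h z (k % (4 + 2 * i)) = impact a h z k := by
  rw [impact, P.isPeriodicPt.iterate_mod_apply]
  rfl

/-- Each impact is on one of the half-ellipses or on one of the segments, and not at a joint: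
otherwise there would be more than `4 + 2 i` impacts in a period. -/
lemma IsPantographic.position (P : IsPantographic i a h z) (hh : 0 < h) (k : ℕ) :
    h < (impact a h z k).1 ∨ (impact a h z k).1 < -h ∨
      (|(impact a h z k).1| < h ∧ (impact a h z k).2 ^ 2 = 1) := by
  set R := {k : ℕ | k < 4 + 2 * i ∧ h < (impact a h z k).1} with hR
  set S := {k : ℕ | k < 4 + 2 * i ∧ (impact a h z k).1 < -h} with hS
  set U := {k : ℕ | k < 4 + 2 * i ∧ |(impact a h z k).1| < h ∧ (impact a h z k).2 = 1} with hU
  set D := {k : ℕ | k < 4 + 2 * i ∧ |(impact a h z k).1| < h ∧ (impact a h z k).2 = -1} with hD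
  have hfin : (Set.Iio (4 + 2 * i)).Finite := Set.finite_Iio _
  have fR : R.Finite := hfin.subset fun k hk => hk.1
  have fS : S.Finite := hfin.subset fun k hk => hk.1
  have fU : U.Finite := hfin.subset fun k hk => hk.1
  have fD : D.Finite := hfin.subset fun k hk => hk.1
  have dRS : Disjoint R S := Set.disjoint_left.2 fun k h1 h2 => by linarith [h1.2, h2.2]
  have dUD : Disjoint U D := Set.disjoint_left.2 fun k h1 h2 => by linarith [h1.2.2, h2.2.2]
  have dRSUD : Disjoint (R ∪ S) (U ∪ D) := by
    rw [Set.disjoint_left]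
    rintro k h1 h2
    have h3 : |(impact a h z k).1| < h := by
      rcases h2 with h2 | h2
      · exact h2.2.1
      · exact h2.2.1
    rw [abs_lt] at h3
    rcases h1 with h1 | h1
    · linarith [h1.2]
    · linarith [h1.2]
  have hcard : ((R ∪ S) ∪ (U ∪ D)).ncard = 4 + 2 * i := by
    rw [Set.ncard_union_eq dRSUD (fR.union fS) (fU.union fD), Set.ncard_union_eq dRS fR fS,
      Set.ncard_union_eq dUD fU fD, P.right_card, P.left_card, P.upper_card, P.lower_card]
    omega
  have hall : (R ∪ S) ∪ (U ∪ D) = Set.Iio (4 + 2 * i) := by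
    refine Set.eq_of_subset_of_ncard_le ?_ ?_ hfin
    · rintro k ((h1 | h1) | (h1 | h1)) <;> exact h1.1
    · rw [hcard, ← Finset.coe_Iio, Set.ncard_coe_finset, Nat.card_Iio]
  have hmem : k % (4 + 2 * i) ∈ (R ∪ S) ∪ (U ∪ D) := by
    rw [hall]
    exact Nat.mod_lt k (by omega)
  have hmod := P.impact_mod k
  rcases hmem with (h1 | h1) | (h1 | h1)
  · exact Or.inl (hmod ▸ h1.2)
  · exact Or.inr (Or.inl (hmod ▸ h1.2))
  · exact Or.inr (Or.inr ⟨hmod ▸ h1.2.1, by rw [← hmod, h1.2.2, one_pow]⟩)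
  · exact Or.inr (Or.inr ⟨hmod ▸ h1.2.1, by rw [← hmod, h1.2.2]; norm_num⟩)

lemma IsPantographic.regular_of_mem (P : IsPantographic i a h z) (ha : 1 < a) (hh : 0 < h) {k : ℕ}
    (hk : ((billiardMap a h)^[k] z).1 ∈ Set.Ico 0 (totalLength a h)) :
    Regular a h (impact a h z k) := by
  refine regular_boundary ha hh hk ?_ ?_
  · rcases P.position hh k with h1 | h1 | h1
    · intro h2
      exact (lt_irrefl _ (h1.trans_le ((le_abs_self _).trans_eq h2)))
    · intro h2
      have := (neg_le_abs (impact a h z k).1).trans_eq h2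
      linarith
    · exact h1.1.ne
  · intro h0
    have := P.alternating k
    rw [impact, h0, zero_mul] at this
    exact lt_irrefl _ this

lemma IsPantographic.mem_phaseSpace (P : IsPantographic i a h z) (ha : 1 < a) (hh : 0 < h) (k : ℕ) :
    (billiardMap a h)^[k] z ∈ phaseSpace a h := by
  induction k with
  | zero => exact P.mem
  | succ k ih =>
    have h1 := P.regular_of_mem ha hh ih.1
    have h2 := (billiardMap_hit ha hh ih h1).1
    rw [← Function.iterate_succ_apply' (billiardMap a h) k z] at h2
    have h3 := P.regular_of_mem ha hh h2
    rw [impact, Function.iterate_succ_apply'] at h3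
    rw [Function.iterate_succ_apply']
    exact (billiardMap_represents ha hh ih h1 h3).mem

lemma IsPantographic.isChain (P : IsPantographic i a h z) (ha : 1 < a) (hh : 0 < h) :
    IsChain a h (impact a h z) fun k => direction a h ((billiardMap a h)^[k] z) := by
  have hmem := P.mem_phaseSpace ha hh
  have hreg : ∀ k, Regular a h (impact a h z k) := fun k => P.regular_of_mem ha hh (hmem k).1
  refine ⟨ha, hh, hreg, fun k => (dot_direction ha hh (hmem k) (hreg k)).1, fun k => ?_,
    fun k => ?_, P.alternating⟩
  · have h1 := (billiardMap_hit ha hh (hmem k) (hreg k)).2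
    rw [← Function.iterate_succ_apply' (billiardMap a h) k z] at h1
    exact h1
  · have h1 := hreg (k + 1)
    rw [impact, Function.iterate_succ_apply'] at h1
    have h2 := (billiardMap_represents ha hh (hmem k) (hreg k) h1).dir
    rw [← Function.iterate_succ_apply' (billiardMap a h) k z] at h2
    exact h2

/-- On a half-ellipse the ordinate is determined, up to sign, by the abscissa. -/
lemma sq_eq_of_level {u v w : ℝ} {α : ℝ} (hα : α = 1 ∨ α = -1) (ha : 1 < a) (hh : 0 < h)
    (hw0 : 0 < w) (hw1 : w < 1) (h1 : level a h (u, v) = 1) (h2 : u = α * abscissa a h w) :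
    v ^ 2 = w ^ 2 := by
  rw [h2, level] at h1
  simp only at h1
  have hα2 : α ^ 2 = 1 := sq_eq_one_iff.2 hα
  rw [soft_abscissa ha hh hw0 hw1 hα, mul_pow, mul_pow, hα2, one_mul, sq_sqrt_of_lt hw0 hw1,
    mul_div_cancel_left₀ _ (by positivity)] at h1
  linarith

/-- Every pantographic orbit is an explicit one: its two passages between the half-ellipses travel
the same horizontal distance, hence the same vertical distance, and so each of them has `i` impacts
at the segments. -/
theorem IsPantographic.exists_orbit (P : IsPantographic i a h z) (ha : 1 < a) (ha2 : a ^ 2 < 2)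
    (hh : 0 < h) : ∃ (y ε : ℝ) (w : ℝ × ℝ) (k : ℕ), Closing i a h y ∧ (ε = 1 ∨ ε = -1) ∧
      Represents a h w (abscissa a h y, -ε * y) (0, ε) ∧ z = (billiardMap a h)^[k] w := by
  have C := P.isChain ha hh
  set N := 4 + 2 * i with hN
  have hmod := P.impact_mod
  rw [← hN] at hmod
  have hcongr : ∀ k l, k % N = l % N → impact a h z k = impact a h z l := fun k l hkl => by
    rw [← hmod k, hkl, hmod]
  obtain ⟨k₀, hk0, hk0'⟩ := P.right_vertical
  obtain ⟨l, hl, hl'⟩ := P.left_vertical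
  obtain ⟨M, hM1, hM2, hM3⟩ := exists_mod_eq (by omega : 0 < N) k₀ l
  have hM4 : (M + 1) % N = (l + 1) % N := by rw [Nat.add_mod, hM3, ← Nat.add_mod]
  rw [← hcongr _ _ hM3] at hl
  rw [← hcongr _ _ hM3, ← hcongr _ _ hM4] at hl'
  have hright := fun {k} (hk : h < (impact a h z k).1) =>
    mod_eq_of_card_two (n := N) (P := fun k => h < (impact a h z k).1) (by omega)
      (fun k => by rw [hmod]) P.right_card hk0 (by rw [hk0']; exact hk0) hk
  have hleft := fun {k} (hk : (impact a h z k).1 < -h) =>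
    mod_eq_of_card_two (n := N) (P := fun k => (impact a h z k).1 < -h) (by omega)
      (fun k => by rw [hmod]) P.left_card hl (by rw [hl']; exact hl) hk
  -- the left impacts `M`, `M + 1` come after the right impacts `k₀`, `k₀ + 1` and before the
  -- right impact `k₀ + N`
  have hMk0 : k₀ + 2 ≤ M := by
    by_contra hcon
    have h1 : M = k₀ ∨ M = k₀ + 1 := by omega
    rcases h1 with h1 | h1
    · rw [h1] at hl; linarith
    · rw [h1, hk0'] at hl; linarith
  have hkN : impact a h z (k₀ + N) = impact a h z k₀ := hcongr _ _ (Nat.add_mod_right _ _)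
  have hMkN : M + 2 ≤ k₀ + N := by
    by_contra hcon
    have h1 : M + 1 = k₀ + N := by omega
    rw [h1, hkN] at hl'
    linarith
  have hseg : ∀ k, k₀ + 1 < k → k < k₀ + N → k ≠ M → k ≠ M + 1 →
      |(impact a h z k).1| < h ∧ (impact a h z k).2 ^ 2 = 1 := by
    intro k h1 h2 h3 h4
    rcases P.position hh k with h5 | h5 | h5
    · exfalso
      rcases hright h5 with h6 | h6
      · exact mod_ne_of_lt (by omega) h2 h6
      · exact mod_ne_of_lt h1 (by omega) h6
    · exfalso
      rcases hleft h5 with h6 | h6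
      · rcases lt_or_gt_of_ne h3 with h7 | h7
        · exact mod_ne_of_lt h7 (by omega) h6.symm
        · exact mod_ne_of_lt h7 (by omega) h6
      · rcases lt_or_gt_of_ne h4 with h7 | h7
        · exact mod_ne_of_lt h7 (by omega) h6.symm
        · exact mod_ne_of_lt h7 (by omega) h6
    · exact h5
  -- the vertical link on the right
  set y := |(impact a h z k₀).2| with hy
  have hy0 : 0 < y := abs_pos.2 (C.regular k₀).snd_ne
  have hlev := (C.regular k₀).level_eq
  rw [level, soft_of_ge hh hk0.le] at hlev
  have hsq0 : (impact a h z k₀).2 ^ 2 = y ^ 2 := (sq_abs _).symm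
  have hy1 : y < 1 := by
    have : 0 < ((impact a h z k₀).1 - h) ^ 2 / a ^ 2 :=
      div_pos (pow_pos (by linarith) 2) (by positivity)
    nlinarith
  have hX : (impact a h z k₀).1 = abscissa a h y := by
    have h1 := mul_cos_arcsin ha (by linarith) hlev
    rw [Real.cos_arcsin, hsq0] at h1
    rw [abscissa, h1]
    ring
  have hsq : ∀ k α, (α = 1 ∨ α = -1) → (impact a h z k).1 = α * abscissa a h y →
      (impact a h z k).2 ^ 2 = y ^ 2 := fun k α hα hk =>
    sq_eq_of_level hα ha hh hy0 hy1 (C.regular k).level_eq hk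
  obtain ⟨ε, hε, hp0, hd0, hp1, hd1⟩ := C.vertical (α := 1) hy0 hy1 (Or.inl rfl)
    (by rw [one_mul, hX]) (by rw [one_mul, hk0', hX]) hsq0
    (hsq _ 1 (Or.inl rfl) (by rw [one_mul, hk0', hX]))
  -- by symmetry, the vertical link on the left has the opposite abscissa
  have hXM : (impact a h z M).1 = -1 * abscissa a h y := by
    obtain ⟨m, hm⟩ : ∃ m, (impact a h z m).1 = -(impact a h z k₀).1 := by
      obtain ⟨m, hm | hm⟩ := P.symm_y k₀
      · exact ⟨m, (congrArg Prod.fst hm.1).symm⟩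
      · exact ⟨m + 1, (congrArg Prod.fst hm.1).symm⟩
    have h1 : (impact a h z m).1 < -h := by linarith
    have h2 : (impact a h z m).1 = (impact a h z M).1 := by
      rcases hleft h1 with h3 | h3
      · rw [hcongr _ _ h3]
      · rw [hcongr _ _ h3, hl']
    rw [← h2, hm, hX, neg_one_mul]
  obtain ⟨ε', hε', hp2, hd2, hp3, hd3⟩ := C.vertical (α := -1) hy0 hy1 (Or.inr rfl)
    hXM (by rw [hl', hXM]) (hsq _ (-1) (Or.inr rfl) hXM)
    (hsq _ (-1) (Or.inr rfl) (by rw [hl', hXM]))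
  -- the two passages
  obtain ⟨q, hq⟩ := Nat.exists_eq_add_of_le hMk0
  obtain ⟨q', hq'⟩ := Nat.exists_eq_add_of_le hMkN
  have hMq : k₀ + 1 + q + 1 = M := by omega
  have hkq : M + 1 + q' + 1 = k₀ + N := by omega
  obtain ⟨hv, he1⟩ := C.traverse (q := q) hy0 hε hp1 hd1
    (fun j h1 h2 => hseg _ (by omega) (by omega) (by omega) (by omega))
    (by rw [hMq, hXM]) (by rw [hMq]; exact hsq _ (-1) (Or.inr rfl) hXM) (Or.inl rfl)
  obtain ⟨-, he2⟩ := C.traverse (q := q') hy0 hε' hp3 hd3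
    (fun j h1 h2 => hseg _ (by omega) (by omega) (by omega) (by omega))
    (by rw [hkq, hkN, hX]; ring) (by rw [hkq, hkN]; exact hsq0) (Or.inr rfl)
  have hvx : 0 < (velocity a y).1 :=
    div_pos (mul_pos (by positivity) (sqrt_pos_of_lt hy0 hy1)) (norm_pos ha y)
  have hqq : q = q' := by
    have h1 := mul_left_cancel₀ hvx.ne' (he1.symm.trans he2)
    have h2 : (q : ℝ) = q' := by linarith
    exact_mod_cast h2
  have hqi : q = i := by omega
  rw [hqi] at he1
  have hn := norm_pos ha y
  have hden : 0 < (a ^ 2 + 1) * y ^ 2 - 1 := by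
    have h1 := mul_pos hv hn
    rw [velocity, div_mul_cancel₀ _ hn.ne'] at h1
    exact h1
  refine ⟨y, ε, (billiardMap a h)^[k₀] z, (N - 1) * k₀, ⟨ha, ha2, hh, hy0, hy1, hden, ?_⟩, hε,
    ⟨P.mem_phaseSpace ha hh k₀, ?_, hd0⟩, ?_⟩
  · rw [abscissa, velocity] at he1
    simp only at he1
    rw [mul_div_assoc', div_mul_eq_mul_div, div_left_inj' hn.ne'] at he1
    exact he1
  · rw [one_mul] at hp0
    exact hp0
  · rw [← Function.iterate_add_apply, ← Nat.succ_mul, Nat.succ_eq_add_one,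
      Nat.sub_add_cancel (by omega), mul_comm]
    exact (P.isPeriodicPt.const_mul k₀).symm

end

/-! ### The ordinate of the vertical links as a function of the height -/

section

variable {i : ℕ} {a h s t y : ℝ}

lemma closing_iff (ha : 1 < a) (ha2 : a ^ 2 < 2) (hh : 0 < h) (hy0 : 0 < y) (hy1 : y < 1)
    (hm : 0 < (a ^ 2 + 1) * y ^ 2 - 1) : Closing i a h y ↔ heightOfRoot i a y = h := by
  rw [heightOfRoot, div_mul_eq_mul_div, div_eq_iff hm.ne']
  refine ⟨fun H => ?_, fun H => ⟨ha, ha2, hh, hy0, hy1, hm, ?_⟩⟩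
  · linear_combination -H.closing
  · linear_combination -H

lemma Closing.heightOfRoot_eq (H : Closing i a h y) : heightOfRoot i a y = h :=
  (closing_iff H.one_lt H.sq_lt H.pos H.y_pos H.y_lt H.den_pos).1 H

lemma heightOfRoot_numerator_pos (i : ℕ) (ha2 : a ^ 2 < 2) (hy0 : 0 < y) (hy1 : y < 1) :
    0 < 2 * (i : ℝ) * y + 1 - (a ^ 2 - 1) * y ^ 2 := by
  have h1 : y ^ 2 < 1 := by nlinarith
  have h2 : (0 : ℝ) ≤ 2 * i * y := by positivity
  have h3 : (a ^ 2 - 1) * y ^ 2 ≤ 1 * y ^ 2 :=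
    mul_le_mul_of_nonneg_right (by linarith) (sq_nonneg y)
  linarith

lemma heightOfRoot_pos (i : ℕ) (ha : 1 < a) (ha2 : a ^ 2 < 2) (hy0 : 0 < y) (hy1 : y < 1)
    (hm : 0 < (a ^ 2 + 1) * y ^ 2 - 1) : 0 < heightOfRoot i a y :=
  mul_pos (div_pos (mul_pos (by linarith) (Real.sqrt_pos.2 (by nlinarith))) hm)
    (heightOfRoot_numerator_pos i ha2 hy0 hy1)

/-- Both factors `√(1 - y²)` and `(2iy + 1 - (a² - 1) y²) / ((a² + 1) y² - 1)` of the height are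
decreasing. -/
lemma heightOfRoot_strictAnti (i : ℕ) (ha : 1 < a) (ha2 : a ^ 2 < 2) (hs0 : 0 < s) (hst : s < t)
    (ht1 : t < 1) (hm : 0 < (a ^ 2 + 1) * s ^ 2 - 1) :
    heightOfRoot i a t < heightOfRoot i a s := by
  have hsq : s ^ 2 < t ^ 2 := by nlinarith
  have hmt : 0 < (a ^ 2 + 1) * t ^ 2 - 1 := by nlinarith
  have hroot : Real.sqrt (1 - t ^ 2) < Real.sqrt (1 - s ^ 2) :=
    Real.sqrt_lt_sqrt (by nlinarith) (by linarith)
  have hfrac : (2 * (i : ℝ) * t + 1 - (a ^ 2 - 1) * t ^ 2) / ((a ^ 2 + 1) * t ^ 2 - 1) ≤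
      (2 * (i : ℝ) * s + 1 - (a ^ 2 - 1) * s ^ 2) / ((a ^ 2 + 1) * s ^ 2 - 1) := by
    rw [div_le_div_iff₀ hmt hm, ← sub_nonneg]
    have h1 : (0 : ℝ) ≤ 2 * i * (t - s) * ((a ^ 2 + 1) * s * t + 1) := by
      have := sub_nonneg.2 hst.le
      have := hs0.trans hst
      positivity
    linarith
  have hpos : 0 < (2 * (i : ℝ) * s + 1 - (a ^ 2 - 1) * s ^ 2) / ((a ^ 2 + 1) * s ^ 2 - 1) :=
    div_pos (heightOfRoot_numerator_pos i ha2 hs0 (hst.trans ht1)) hm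
  have hform : ∀ y, heightOfRoot i a y = a * (Real.sqrt (1 - y ^ 2) *
      ((2 * (i : ℝ) * y + 1 - (a ^ 2 - 1) * y ^ 2) / ((a ^ 2 + 1) * y ^ 2 - 1))) := fun y => by
    rw [heightOfRoot]
    ring
  rw [hform, hform]
  refine mul_lt_mul_of_pos_left ?_ (by linarith)
  exact (mul_le_mul_of_nonneg_left hfrac (Real.sqrt_nonneg _)).trans_lt
    (mul_lt_mul_of_pos_right hroot hpos)

lemma Closing.lt_iff {h' y' : ℝ} (H : Closing i a h y) (H' : Closing i a h' y') :
    y < y' ↔ h' < h := by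
  have key : ∀ {h h' y y' : ℝ}, Closing i a h y → Closing i a h' y' → y < y' → h' < h := by
    intro h h' y y' H H' hlt
    rw [← H.heightOfRoot_eq, ← H'.heightOfRoot_eq]
    exact heightOfRoot_strictAnti i H.one_lt H.sq_lt H.y_pos hlt H'.y_lt H.den_pos
  refine ⟨key H H', fun hlt => ?_⟩
  rcases lt_trichotomy y y' with h1 | h1 | h1
  · exact h1
  · rw [← H.heightOfRoot_eq, ← H'.heightOfRoot_eq, h1] at hlt
    exact (lt_irrefl _ hlt).elim
  · exact (lt_asymm hlt (key H' H h1)).elim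

lemma sq_inv_sqrt_add_one (a : ℝ) : (a ^ 2 + 1) * (Real.sqrt (a ^ 2 + 1))⁻¹ ^ 2 = 1 := by
  rw [inv_pow, Real.sq_sqrt (by positivity), mul_inv_cancel₀ (by positivity)]

lemma inv_sqrt_add_one_pos (a : ℝ) : 0 < (Real.sqrt (a ^ 2 + 1))⁻¹ :=
  inv_pos.2 (Real.sqrt_pos.2 (by positivity))

lemma inv_sqrt_add_one_lt (ha : 1 < a) : (Real.sqrt (a ^ 2 + 1))⁻¹ < 1 := by
  refine inv_lt_one_of_one_lt₀ ((Real.lt_sqrt zero_le_one).2 ?_)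
  nlinarith

lemma den_pos_of_inv_sqrt_lt (h1 : (Real.sqrt (a ^ 2 + 1))⁻¹ < y) :
    0 < (a ^ 2 + 1) * y ^ 2 - 1 := by
  have h2 : (Real.sqrt (a ^ 2 + 1))⁻¹ ^ 2 < y ^ 2 :=
    pow_lt_pow_left₀ h1 (inv_sqrt_add_one_pos a).le two_ne_zero
  have h3 := mul_lt_mul_of_pos_left h2 (by positivity : 0 < a ^ 2 + 1)
  rw [sq_inv_sqrt_add_one] at h3
  linarith

/-- Every height is attained: as `y` runs from `1 / √(a² + 1)` to `1`, the height decreases from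
infinity to `0`. -/
lemma exists_closing (i : ℕ) (ha : 1 < a) (ha2 : a ^ 2 < 2) (hh : 0 < h) : ∃ y, Closing i a h y := by
  set s := (Real.sqrt (a ^ 2 + 1))⁻¹ with hs
  have hs0 : 0 < s := inv_sqrt_add_one_pos a
  have hs1 : s < 1 := inv_sqrt_add_one_lt ha
  have hs2 : (a ^ 2 + 1) * s ^ 2 = 1 := sq_inv_sqrt_add_one a
  set K : ℝ → ℝ := fun y => a * Real.sqrt (1 - y ^ 2) *
    (2 * (i : ℝ) * y + 1 - (a ^ 2 - 1) * y ^ 2) - h * ((a ^ 2 + 1) * y ^ 2 - 1) with hK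
  have hcont : ContinuousOn K (Set.Icc s 1) := by
    rw [hK]
    fun_prop
  have hKs : 0 < K s := by
    simp only [hK, hs2, sub_self, mul_zero, sub_zero]
    exact mul_pos (mul_pos (by linarith) (Real.sqrt_pos.2 (by nlinarith)))
      (heightOfRoot_numerator_pos i ha2 hs0 hs1)
  have hK1 : K 1 < 0 := by
    have h1 : K 1 = -(h * a ^ 2) := by
      simp [hK]
    rw [h1, neg_lt_zero]
    positivity
  obtain ⟨y, ⟨hy0, hy1⟩, hy⟩ := intermediate_value_Ioo' hs1.le hcont ⟨hK1, hKs⟩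
  have hm := den_pos_of_inv_sqrt_lt hy0
  refine ⟨y, (closing_iff ha ha2 hh (hs0.trans hy0) hy1 hm).2 ?_⟩
  rw [heightOfRoot, div_mul_eq_mul_div, div_eq_iff hm.ne']
  exact sub_eq_zero.1 hy

end

/-! ### The sign of the cubic polynomial -/

section

variable {i : ℕ} {a s t : ℝ}

/-- The quotient of the cubic polynomial by `y` is strictly increasing on `y > 0`. -/
lemma mul_cubic_lt (i : ℕ) (ha : 1 < a) (hs : 0 < s) (hst : s < t) :
    t * cubic i a s < s * cubic i a t := by
  have ht := hs.trans hst
  have h1 : 0 < s * t * (t - s) * (t + s) := by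
    have := sub_pos.2 hst
    positivity
  have h2 : 0 ≤ (i : ℝ) / (2 * a ^ 2) * ((a ^ 2 - 1) * (s * t) + 1) * (t - s) := by
    have := sub_pos.2 hst
    have : 0 < a ^ 2 - 1 := by nlinarith
    positivity
  rw [cubic, cubic]
  linarith

lemma cubic_neg_of_lt (ha : 1 < a) (hs : 0 < s) (hst : s < t) (h : cubic i a t ≤ 0) :
    cubic i a s < 0 := by
  have h1 := mul_cubic_lt i ha hs hst
  have h2 := mul_nonpos_of_nonneg_of_nonpos hs.le h
  by_contra! h3
  have := mul_nonneg (hs.trans hst).le h3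
  linarith

lemma cubic_pos_of_lt (ha : 1 < a) (hs : 0 < s) (hst : s < t) (h : 0 ≤ cubic i a s) :
    0 < cubic i a t := by
  by_contra! h1
  exact (cubic_neg_of_lt ha hs hst h1).not_ge h

lemma cubic_one (ha : 1 < a) :
    cubic i a 1 = ((2 + i) * a ^ 2 - (2 + 2 * i)) / (2 * a ^ 2) := by
  rw [cubic]
  field_simp
  ring

lemma cubic_root_unique (ha : 1 < a) (hs : 0 < s) (ht : 0 < t) (h1 : cubic i a s = 0)
    (h2 : cubic i a t = 0) : s = t := by
  rcases lt_trichotomy s t with h | h | h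
  · exact ((cubic_pos_of_lt ha hs h h1.ge).ne' h2).elim
  · exact h
  · exact ((cubic_pos_of_lt ha ht h h2.ge).ne' h1).elim

lemma one_le_alpha (i : ℕ) : 1 ≤ alpha i := by
  rw [alpha, Real.one_le_sqrt, one_le_div (by positivity)]
  have : (0 : ℝ) ≤ i := Nat.cast_nonneg i
  linarith

lemma cubic_one_pos (ha : alpha i < a) : 0 < cubic i a 1 := by
  have h1 := (one_le_alpha i).trans_lt ha
  rw [cubic_one h1]
  rw [alpha, Real.sqrt_lt' (by linarith), div_lt_iff₀ (by positivity)] at ha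
  exact div_pos (by linarith) (by positivity)

lemma cubic_one_neg (ha1 : 1 < a) (ha : a < alpha i) : cubic i a 1 < 0 := by
  rw [cubic_one ha1]
  rw [alpha, Real.lt_sqrt (by linarith), lt_div_iff₀ (by positivity)] at ha
  exact div_neg_of_neg_of_pos (by linarith) (by positivity)

lemma exists_cubic_root (ha : alpha i < a) :
    ∃ y, 0 < y ∧ y < 1 ∧ 0 < (a ^ 2 + 1) * y ^ 2 - 1 ∧ cubic i a y = 0 := by
  have ha1 := (one_le_alpha i).trans_lt ha
  set s := (Real.sqrt (a ^ 2 + 1))⁻¹ with hs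
  have hs0 : 0 < s := inv_sqrt_add_one_pos a
  have hs1 : s < 1 := inv_sqrt_add_one_lt ha1
  have hs2 : (a ^ 2 + 1) * s ^ 2 = 1 := sq_inv_sqrt_add_one a
  have hneg : cubic i a s < 0 := by
    have h1 : cubic i a s = -(2 * s ^ 3 + i * (2 * s ^ 2)) / (2 * a ^ 2) := by
      rw [cubic]
      field_simp
      linear_combination (2 * s + i) * hs2
    rw [h1]
    exact div_neg_of_neg_of_pos (neg_lt_zero.2 (by positivity)) (by positivity)
  have hcont : ContinuousOn (cubic i a) (Set.Icc s 1) := by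
    unfold cubic
    fun_prop
  obtain ⟨y, ⟨hy0, hy1⟩, hy⟩ := intermediate_value_Ioo hs1.le hcont ⟨hneg, cubic_one_pos ha⟩
  exact ⟨y, hs0.trans hy0, hy1, den_pos_of_inv_sqrt_lt hy0, hy⟩

end

/-! ### Elliptic and hyperbolic heights -/

section

variable {i : ℕ} {a h y : ℝ}

lemma sq_lt_two (ha : 1 < a) (ha2 : a < Real.sqrt 2) : a ^ 2 < 2 :=
  (Real.lt_sqrt (by linarith)).1 ha2

lemma Closing.exists_isPantographic (H : Closing i a h y) : ∃ z, IsPantographic i a h z := by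
  obtain ⟨z, hz⟩ := _root_.EllipticalStadium.exists_orbit H (Or.inl rfl)
  exact ⟨z, isPantographic_orbit H hz⟩

/-- All pantographic orbits have the ordinate `y`, and their derivatives have the type given by the
sign of the cubic polynomial at `y`. -/
lemma Closing.exists_hasFDerivAt (H : Closing i a h y) {z : ℝ × ℝ} (P : IsPantographic i a h z) :
    ∃ A, HasFDerivAt (billiardMap a h)^[4 + 2 * i] A z ∧
      (0 < cubic i a y → IsEllipticMap A) ∧ (cubic i a y < 0 → IsHyperbolicMap A) := by
  obtain ⟨y', ε, w, k, H', hε, hw, rfl⟩ := P.exists_orbit H.one_lt H.sq_lt H.pos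
  have hy : y' = y := le_antisymm (not_lt.1 fun h1 => lt_irrefl h ((H.lt_iff H').1 h1))
    (not_lt.1 fun h1 => lt_irrefl h ((H'.lt_iff H).1 h1))
  subst hy
  exact orbit_type H' hε hw k

lemma Closing.panIsElliptic (H : Closing i a h y) (hc : 0 < cubic i a y) : PanIsElliptic i a h :=
  ⟨H.exists_isPantographic, fun _ P =>
    let ⟨A, hA, hell, _⟩ := H.exists_hasFDerivAt P
    ⟨A, hA, hell hc⟩⟩

lemma Closing.panIsHyperbolic (H : Closing i a h y) (hc : cubic i a y < 0) :
    PanIsHyperbolic i a h :=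
  ⟨H.exists_isPantographic, fun _ P =>
    let ⟨A, hA, _, hhyp⟩ := H.exists_hasFDerivAt P
    ⟨A, hA, hhyp hc⟩⟩

lemma PanIsElliptic.not_panIsHyperbolic (h1 : PanIsElliptic i a h) : ¬ PanIsHyperbolic i a h := by
  intro h2
  obtain ⟨z, hz⟩ := h1.1
  obtain ⟨A, hA, hell⟩ := h1.2 z hz
  obtain ⟨B, hB, hhyp⟩ := h2.2 z hz
  rw [hB.unique hA] at hhyp
  exact hell.not_isHyperbolicMap hhyp

theorem isThreshold_heightOfRoot (ha : 1 < a) (ha2 : a ^ 2 < 2) (hy0 : 0 < y) (hy1 : y < 1)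
    (hm : 0 < (a ^ 2 + 1) * y ^ 2 - 1) (hc : cubic i a y = 0) :
    IsThreshold i a (heightOfRoot i a y) := by
  have hpos := heightOfRoot_pos i ha ha2 hy0 hy1 hm
  have H₀ : Closing i a (heightOfRoot i a y) y := (closing_iff ha ha2 hpos hy0 hy1 hm).2 rfl
  refine ⟨hpos, fun h hh hlt => ?_, fun h hlt => ?_⟩
  · obtain ⟨t, H⟩ := exists_closing i ha ha2 hh
    exact H.panIsElliptic (cubic_pos_of_lt ha hy0 ((H₀.lt_iff H).2 hlt) hc.ge)
  · obtain ⟨t, H⟩ := exists_closing i ha ha2 (hpos.trans hlt)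
    exact H.panIsHyperbolic (cubic_neg_of_lt ha H.y_pos ((H.lt_iff H₀).2 hlt) hc.le)

lemma IsThreshold.unique {h₁ h₂ : ℝ} (H₁ : IsThreshold i a h₁) (H₂ : IsThreshold i a h₂) :
    h₁ = h₂ := by
  have key : ∀ {h₁ h₂ : ℝ}, IsThreshold i a h₁ → IsThreshold i a h₂ → ¬ h₁ < h₂ := by
    intro h₁ h₂ H₁ H₂ hlt
    obtain ⟨h, hl, hr⟩ := exists_between hlt
    exact (H₂.2.1 h (H₁.1.trans hl) hr).not_panIsHyperbolic (H₁.2.2 h hl)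
  exact le_antisymm (not_lt.1 (key H₂ H₁)) (not_lt.1 (key H₁ H₂))

lemma panIsHyperbolic_of_lt_alpha (ha : 1 < a) (ha2 : a ^ 2 < 2) (hα : a < alpha i) (hh : 0 < h) :
    PanIsHyperbolic i a h := by
  obtain ⟨y, H⟩ := exists_closing i ha ha2 hh
  exact H.panIsHyperbolic (cubic_neg_of_lt ha H.y_pos H.y_lt (cubic_one_neg ha hα).le)

lemma alpha_lt_sqrt_two (i : ℕ) : alpha i < Real.sqrt 2 := by
  rw [alpha]
  refine Real.sqrt_lt_sqrt (by positivity) ?_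
  rw [div_lt_iff₀ (by positivity)]
  linarith

/-- For `i = 0` the positive root of the cubic polynomial is `1 / a`. -/
lemma isThreshold_zero (ha : 1 < a) (ha2 : a ^ 2 < 2) :
    IsThreshold 0 a (Real.sqrt (a ^ 2 - 1)) := by
  have ha0 : 0 < a := by linarith
  have hm : (a ^ 2 + 1) * a⁻¹ ^ 2 - 1 = a⁻¹ ^ 2 := by
    field_simp
    ring
  have hroot : a * Real.sqrt (1 - a⁻¹ ^ 2) = Real.sqrt (a ^ 2 - 1) := by
    rw [← Real.sqrt_sq ha0.le, ← Real.sqrt_mul (sq_nonneg a), Real.sqrt_sq ha0.le]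
    congr 1
    field_simp
  have hheight : heightOfRoot 0 a a⁻¹ = Real.sqrt (a ^ 2 - 1) := by
    rw [heightOfRoot, hm, hroot]
    field_simp
    push_cast
    ring
  rw [← hheight]
  refine isThreshold_heightOfRoot ha ha2 (inv_pos.2 ha0) (inv_lt_one_of_one_lt₀ ha) ?_ ?_
  · rw [hm]
    positivity
  · rw [cubic]
    field_simp
    push_cast
    ring

end

end EllipticalStadium

end

theorem proposition2 :
    (∀ (i : ℕ) (a : ℝ), EllipticalStadium.alpha i < a → a < Real.sqrt 2 →
      ∃! h₀ : ℝ, EllipticalStadium.IsThreshold i a h₀) ∧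
    (∀ (i : ℕ) (a : ℝ), 1 ≤ i → 1 < a → a < EllipticalStadium.alpha i →
      ∀ h : ℝ, 0 < h → EllipticalStadium.PanIsHyperbolic i a h) ∧
    (∀ a : ℝ, 1 < a → a < Real.sqrt 2 →
      EllipticalStadium.IsThreshold 0 a (Real.sqrt (a ^ 2 - 1))) ∧
    (∀ (i : ℕ) (a : ℝ), EllipticalStadium.alpha i < a → a < Real.sqrt 2 →
      ∃ y : ℝ, 0 < y ∧ y < 1 ∧ EllipticalStadium.cubic i a y = 0 ∧
        (∀ y' : ℝ, 0 < y' → y' < 1 → EllipticalStadium.cubic i a y' = 0 → y' = y) ∧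
        EllipticalStadium.IsThreshold i a (EllipticalStadium.heightOfRoot i a y)) := by
  have key : ∀ (i : ℕ) (a : ℝ), EllipticalStadium.alpha i < a → a < Real.sqrt 2 →
      ∃ y : ℝ, 0 < y ∧ y < 1 ∧ EllipticalStadium.cubic i a y = 0 ∧
        (∀ y' : ℝ, 0 < y' → y' < 1 → EllipticalStadium.cubic i a y' = 0 → y' = y) ∧
        EllipticalStadium.IsThreshold i a (EllipticalStadium.heightOfRoot i a y) := by
    intro i a ha ha2
    have ha1 := (EllipticalStadium.one_le_alpha i).trans_lt ha
    obtain ⟨y, hy0, hy1, hm, hc⟩ := EllipticalStadium.exists_cubic_root ha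
    exact ⟨y, hy0, hy1, hc,
      fun y' h0 _ h2 => EllipticalStadium.cubic_root_unique ha1 h0 hy0 h2 hc,
      EllipticalStadium.isThreshold_heightOfRoot ha1 (EllipticalStadium.sq_lt_two ha1 ha2)
        hy0 hy1 hm hc⟩
  refine ⟨fun i a ha ha2 => ?_, fun i a _ ha1 ha h hh => ?_, fun a ha1 ha2 => ?_, key⟩
  · obtain ⟨y, -, -, -, -, H⟩ := key i a ha ha2
    exact ⟨_, H, fun h' H' => H'.unique H⟩
  · exact EllipticalStadium.panIsHyperbolic_of_lt_alpha ha1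
      (EllipticalStadium.sq_lt_two ha1 (ha.trans (EllipticalStadium.alpha_lt_sqrt_two i))) ha hh
  · exact EllipticalStadium.isThreshold_zero ha1 (EllipticalStadium.sq_lt_two ha1 ha2)
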